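/- Let $m\ge 2$, $\mathbb I=\mathbb Z_+^m$, $\mathbb J=\mathbb Z_+^{m-1}$ (multi-indices in the directions $2,\dots,m$). Greek indices $\lambda,\mu$ run over $1,\dots,m$ and $\alpha,\beta$ over $2,\dots,m$; $(\mu)$ is the multi-index with a single $1$ in place $\mu$; repeated indices are summed. Let $\mathbf B$ be the space with coordinates $x^\mu,u^\mu_i,p_i$ ($i\in\mathbb I$), $\mathcal A(\mathbf B)$ the algebra of smooth real functions of finitely many of these coordinates, and $$D_\mu=\partial_{x^\mu}+u^\lambda_{i+(\mu)}\partial_{u^\lambda_i}+p_{i+(\mu)}\partial_{p_i}$$ the total derivatives. Let $\mathbf{CPE}\subset\mathbf B$ be the set of points with, for all $i\in\mathbb I$, $$u^\mu_{i+(\mu)}=0,\qquad \sum_\mu p_{i+2(\mu)}+\sum_{\lambda,\mu}\sum_{k+l=i}\binom ik u^\lambda_{k+(\mu)}u^\mu_{l+(\lambda)}=0,$$ and $\mathcal A=\mathcal A(\mathbf{CPE})=\mathcal A(\mathbf B)/\mathcal J$, where $\mathcal J$ is the ideal of functions vanishing on $\mathbf{CPE}$. The $D_\mu$ descend to $\mathcal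 A$. The space $\mathbf{CPE}$ has global coordinates $x^\mu$, $u^1_{0,j}$, $u^\alpha_{k,j}$, $p_{0,j}$, $p_{1,j}$ ($k\in\mathbb Z_+$, $j\in\mathbb J$), in which $\mathcal A$ is the algebra of smooth functions of finitely many of the coordinates. Let $\Omega^q_H$ ($q\in\mathbb Z$) be the space of forms of degree $q$ in $dx^1,\dots,dx^m$ with coefficients in $\mathcal A$, $d_H=dx^\mu\wedge D_\mu$, and $H^q_H(\mathbf{CPE})=\ker d_H^q/\operatorname{im}d_H^{q-1}$. Let $\Theta^q$ be the forms of degree $q$ in $dx^2,\dots,dx^m$ with coefficients in $\mathcal A$, $d_\Theta=dx^\alpha\wedge D_\alpha$, $H^q(\Theta)$ its cohomology, and $D_1^q:H^q(\Theta)\to H^q(\Theta)$, $[\theta]\mapsto[D_1\theta]$ (coefficientwise). Index the dependent variables by $a\in V=\{u^1_0,\ u^\alpha_k,\ p_0,\ p_1\}$ ($k\in\mathbb Z_+$), with coordinates $a_j$, $j\in\mathbb J$. For $L\in\mathcal A$ put $\delta_aL=(-D)_j\partial_{a_j}L$, where $D_j=D_2^{j^2}\cdots D_m^{j^m}$ and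 $(-D)_j=(-1)^{|j|}D_j$. For families $\chi=(\chi_a)_{a\in V}$ in $\mathcal A$ with finitely many nonzero members, written $(\chi^0_1,\chi^k_\alpha,\chi^0,\chi^1)$, define $f^*\chi$ by $$(f^*\chi)^0_1=2D_\alpha(u^\alpha_{(1)}\chi^1),\quad (f^*\chi)^0=-\sum_\alpha D_\alpha D_\alpha\chi^1,\quad (f^*\chi)^1=\chi^0,$$ $$(f^*\chi)^k_\alpha=\delta^k_0D_\alpha\chi^0_1+\chi^{k-1}_\alpha+2\Big(\delta^k_0D_\alpha(u^\beta_{(\beta)}\chi^1)-\delta^k_1u^1_{(\alpha)}\chi^1+\delta^k_0D_\beta(u^\beta_{(\alpha)}\chi^1)\Big)$$ with $\chi^{-1}_\alpha=0$. Let $\mathcal S$ be the space of such $\chi$ with $D_1\chi+f^*\chi=0$, and $\mathcal H$ the space of such $\chi$ with $\chi_*=\chi^*$ as operators on all families $g=(g^a)_{a\in V}$ in $\mathcal A$, where $(\chi_*g)_a=\sum_{b,j}\partial_{b_j}\chi_a\cdot D_jg^b$ and $(\chi^*g)_a=\sum_{b,j}(-D)_j(g^b\,\partial_{a_j}\chi_b)$.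 **Theorem.** As real linear spaces: 1. $H^q_H(\mathbf{CPE})=0$ for $q<0$, for $1\le q\le m-2$ and for $q>m$. 2. $H^0_H(\mathbf{CPE})\cong\mathbb R$, the class of the constant function $c$ corresponding to $c$. 3. $H^{m-1}_H(\mathbf{CPE})\cong\ker D_1^{m-1}\cong\mathcal S\cap\mathcal H$. The first isomorphism sends $[\omega]$ to the class of the part of $\omega$ free of $dx^1$; the second sends $[L\,dx^2\wedge\dots\wedge dx^m]$ to $(\delta_aL)_{a\in V}$. Hence the composite sends $[J^\mu d_\mu x]$ to $(\delta_aJ^1)_{a\in V}$, where $d_\mu x=(-1)^{\mu-1}dx^1\wedge\dots\widehat{dx^\mu}\dots\wedge dx^m$. 4. $H^m_H(\mathbf{CPE})\cong H^{m-1}(\Theta)/\operatorname{im}D_1^{m-1}$, where $[(-1)^{m-1}dx^1\wedge\theta]$ corresponds to the class of $[\theta]$. -/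

import Mathlib

noncomputable section

namespace NS

open scoped ContDiff

/-! ## Smooth functions of finitely many of the coordinates on `ℝ^ι` -/

section FinSmooth

variable {ι : Type*}

/-- `f` is a smooth function of finitely many of the coordinates. -/
def IsFinSmooth (f : (ι → ℝ) → ℝ) : Prop :=
  ∃ (s : Finset ι) (g : (s → ℝ) → ℝ), ContDiff ℝ ∞ g ∧ ∀ z, f z = g (fun i => z i)

theorem IsFinSmooth.comp {κ τ : Type*} {f : (κ → ℝ) → ℝ} (hf : IsFinSmooth f)
    {h : κ → (τ → ℝ) → ℝ} (hh : ∀ k, IsFinSmooth (h k)) :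
    IsFinSmooth (fun z => f (fun k => h k z)) := by
  classical
  obtain ⟨s, g, hg, hfg⟩ := hf
  choose t e he hte using hh
  refine ⟨s.biUnion t, fun y => g (fun k => e k (fun i => y ⟨i, Finset.mem_biUnion.2
    ⟨k, k.2, i.2⟩⟩)), ?_, ?_⟩
  · refine hg.comp (contDiff_pi.2 fun k => (he k).comp (contDiff_pi.2 fun i => ?_))
    exact contDiff_apply ℝ ℝ _
  · intro z
    simp only [hfg, hte]

theorem IsFinSmooth.of_contDiff {κ : Type*} [Fintype κ] {F : (κ → ℝ) → ℝ} (hF : ContDiff ℝ ∞ F) :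
    IsFinSmooth F :=
  ⟨Finset.univ, fun y => F (fun k => y ⟨k, Finset.mem_univ k⟩),
    hF.comp (contDiff_pi.2 fun _ => contDiff_apply ℝ ℝ _), fun _ => rfl⟩

theorem isFinSmooth_coord (i : ι) : IsFinSmooth (fun z : ι → ℝ => z i) :=
  ⟨{i}, fun y => y ⟨i, Finset.mem_singleton_self i⟩, contDiff_apply ℝ ℝ _, fun _ => rfl⟩

theorem isFinSmooth_const (c : ℝ) : IsFinSmooth (fun _ : ι → ℝ => c) :=
  ⟨∅, fun _ => c, contDiff_const, fun _ => rfl⟩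

theorem IsFinSmooth.comp₂ {F : ℝ → ℝ → ℝ} (hF : ContDiff ℝ ∞ (fun y : Fin 2 → ℝ => F (y 0) (y 1)))
    {f g : (ι → ℝ) → ℝ} (hf : IsFinSmooth f) (hg : IsFinSmooth g) :
    IsFinSmooth (fun z => F (f z) (g z)) := by
  have := (IsFinSmooth.of_contDiff hF).comp (h := ![f, g]) (by
    intro k; fin_cases k
    · exact hf
    · exact hg)
  simpa using this

variable (ι) in
/-- The algebra of smooth real functions of finite order on `ℝ^ι`. -/
def FinSmooth : Subalgebra ℝ ((ι → ℝ) → ℝ) where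
  carrier := {f | IsFinSmooth f}
  mul_mem' hf hg := IsFinSmooth.comp₂ (F := fun a b => a * b)
    ((contDiff_apply ℝ ℝ 0).mul (contDiff_apply ℝ ℝ 1)) hf hg
  add_mem' hf hg := IsFinSmooth.comp₂ (F := fun a b => a + b)
    ((contDiff_apply ℝ ℝ 0).add (contDiff_apply ℝ ℝ 1)) hf hg
  algebraMap_mem' c := isFinSmooth_const c

/-- A coordinate function. -/
def coord (i : ι) : FinSmooth ι := ⟨fun z => z i, isFinSmooth_coord i⟩

/-- Evaluation at a point. -/
def evalAt (z : ι → ℝ) : FinSmooth ι →ₐ[ℝ] ℝ :=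
  (Pi.evalAlgHom ℝ (fun _ : ι → ℝ => ℝ) z).comp (FinSmooth ι).val

@[simp] theorem evalAt_apply (z : ι → ℝ) (f : FinSmooth ι) : evalAt z f = f.1 z := rfl

theorem finSmooth_ext {f g : FinSmooth ι} (h : ∀ z, f.1 z = g.1 z) : f = g :=
  Subtype.ext (funext h)

open Classical in
/-- The value of the partial derivative with respect to the `i`-th coordinate. -/
def pdFun (i : ι) (f : (ι → ℝ) → ℝ) (z : ι → ℝ) : ℝ :=
  deriv (fun t => f (Function.update z i t)) (z i)

open Classical in
theorem hasDerivAt_curve_aux {s : Finset ι} {g : (s → ℝ) → ℝ} (hg : ContDiff ℝ ∞ g)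
    {c : ℝ → ι → ℝ} {v : ι → ℝ} {t : ℝ} (hc : ∀ i, HasDerivAt (fun τ => c τ i) (v i) t) :
    HasDerivAt (fun τ => g (fun i => c τ i))
      (fderiv ℝ g (fun i => c t i) (fun i => v i)) t := by
  have h1 : HasDerivAt (fun τ => (fun i : s => c τ i)) (fun i : s => v i) t :=
    hasDerivAt_pi.2 fun i => hc i
  have h2 : HasFDerivAt g (fderiv ℝ g (fun i => c t i)) (fun i : s => c t i) :=
    (hg.differentiable (by simp) _).hasFDerivAt
  exact h2.comp_hasDerivAt t h1

open Classical in
theorem hasDerivAt_update (z : ι → ℝ) (i k : ι) (t : ℝ) :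
    HasDerivAt (fun τ => Function.update z i τ k) ((Pi.single i 1 : ι → ℝ) k) t := by
  by_cases h : k = i
  · subst h; simpa using hasDerivAt_id' t
  · simpa [Function.update_of_ne h, Pi.single_eq_of_ne h] using hasDerivAt_const t (z k)

open Classical in
theorem pdFun_eq {s : Finset ι} {g : (s → ℝ) → ℝ} (hg : ContDiff ℝ ∞ g) {f : (ι → ℝ) → ℝ}
    (hfg : ∀ z, f z = g (fun i => z i)) (i : ι) (z : ι → ℝ) :
    pdFun i f z = fderiv ℝ g (fun k => z k) (fun k : s => (Pi.single i 1 : ι → ℝ) k) := by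
  have := hasDerivAt_curve_aux hg (fun k => hasDerivAt_update z i k (z i))
  simp only [Function.update_eq_self] at this
  simp only [pdFun, hfg]
  exact this.deriv

theorem IsFinSmooth.pdFun {f : (ι → ℝ) → ℝ} (hf : IsFinSmooth f) (i : ι) :
    IsFinSmooth (pdFun i f) := by
  classical
  obtain ⟨s, g, hg, hfg⟩ := hf
  refine ⟨s, fun y => fderiv ℝ g y (fun k : s => (Pi.single i 1 : ι → ℝ) k), ?_, ?_⟩
  · exact (hg.fderiv_right (by simp)).clm_apply contDiff_const
  · intro z; exact pdFun_eq hg hfg i z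

open Classical in
theorem IsFinSmooth.hasDerivAt_update {f : (ι → ℝ) → ℝ} (hf : IsFinSmooth f) (i : ι) (z : ι → ℝ) :
    HasDerivAt (fun t => f (Function.update z i t)) (NS.pdFun i f z) (z i) := by
  obtain ⟨s, g, hg, hfg⟩ := hf
  have := hasDerivAt_curve_aux hg (fun k => NS.hasDerivAt_update z i k (z i))
  simp only [← hfg] at this
  exact this.differentiableAt.hasDerivAt

/-- The partial derivative with respect to the `i`-th coordinate. -/
def pd (i : ι) : Derivation ℝ (FinSmooth ι) (FinSmooth ι) :=
  Derivation.mk'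
    { toFun := fun f => ⟨pdFun i f.1, f.2.pdFun i⟩
      map_add' := fun f g => finSmooth_ext fun z => by
        classical
        exact ((f.2.hasDerivAt_update i z).add (g.2.hasDerivAt_update i z)).deriv
      map_smul' := fun c f => finSmooth_ext fun z => by
        classical
        exact ((f.2.hasDerivAt_update i z).const_mul c).deriv }
    (fun f g => finSmooth_ext fun z => by
      classical
      have := ((f.2.hasDerivAt_update i z).mul (g.2.hasDerivAt_update i z)).deriv
      simp only [Function.update_eq_self] at this
      refine this.trans ?_
      change _ = f.1 z * pdFun i g.1 z + g.1 z * pdFun i f.1 z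
      ring)

theorem pd_val (i : ι) (f : FinSmooth ι) : (pd i f).1 = pdFun i f.1 := rfl

theorem pd_support_finite (f : FinSmooth ι) : {i | pd i f ≠ 0}.Finite := by
  classical
  obtain ⟨s, g, hg, hfg⟩ := f.2
  refine s.finite_toSet.subset fun i hi => ?_
  by_contra his
  refine hi (finSmooth_ext fun z => ?_)
  rw [pd_val, pdFun_eq hg hfg]
  have : (fun k : s => (Pi.single i 1 : ι → ℝ) k) = 0 := by
    funext k
    have : (k : ι) ≠ i := fun h => his (h ▸ k.2)
    simp [Pi.single_eq_of_ne this]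
  rw [this]; simp

theorem pd_coord [DecidableEq ι] (i k : ι) : pd i (coord k) = if k = i then 1 else 0 := by
  refine finSmooth_ext fun z => ?_
  have := (hasDerivAt_update z i k (z i)).deriv
  rw [pd_val]
  refine Eq.trans this ?_
  split_ifs with h
  · subst h; simp
  · simp [h]

theorem pd_comm (i k : ι) (f : FinSmooth ι) : pd i (pd k f) = pd k (pd i f) := by
  classical
  obtain ⟨s, g, hg, hfg⟩ := f.2
  set E : ι → (s → ℝ) := fun i => fun l : s => (Pi.single i 1 : ι → ℝ) l
  have h1 : ∀ k z, (pd k f).1 z = fderiv ℝ g (fun l => z l) (E k) := fun k z => pdFun_eq hg hfg k z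
  have hs : ∀ k, ContDiff ℝ ∞ (fun y => fderiv ℝ g y (E k)) := fun k =>
    (hg.fderiv_right (by simp)).clm_apply contDiff_const
  have h2 : ∀ i k z, (pd i (pd k f)).1 z
      = fderiv ℝ (fderiv ℝ g) (fun l => z l) (E i) (E k) := by
    intro i k z
    refine (pdFun_eq (hs k) (h1 k) i z).trans ?_
    have hd : DifferentiableAt ℝ (fderiv ℝ g) (fun l : s => z l) :=
      (hg.fderiv_right (m := ∞) (by simp)).differentiable (by simp) _
    rw [fderiv_clm_apply hd (differentiableAt_const _)]
    simp [E]
  refine finSmooth_ext fun z => ?_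
  rw [h2, h2]
  have := (hg.contDiffAt (x := fun l : s => z l)).isSymmSndFDerivAt
    (by simpa using (WithTop.coe_le_coe.2 (le_top : (2 : ℕ∞) ≤ ⊤)))
  exact this _ _

/-- The derivation `∑ aᵢ ∂ᵢ`; applied to a function it has finitely many nonzero terms. -/
def vectorField (a : ι → FinSmooth ι) : Derivation ℝ (FinSmooth ι) (FinSmooth ι) :=
  Derivation.mk'
    { toFun := fun f => ∑ᶠ i, a i * pd i f
      map_add' := fun f g => by
        rw [← finsum_add_distrib]
        · simp only [map_add, mul_add]
        · exact (pd_support_finite f).subset fun i hi h => hi (by simp [h])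
        · exact (pd_support_finite g).subset fun i hi h => hi (by simp [h])
      map_smul' := fun c f => by
        rw [RingHom.id_apply, smul_finsum' c]
        · simp
        · exact (pd_support_finite f).subset fun i hi h => hi (by simp [h]) }
    (fun f g => by
      change (∑ᶠ i, a i * pd i (f * g)) = f * (∑ᶠ i, a i * pd i g) + g * ∑ᶠ i, a i * pd i f
      rw [mul_finsum', mul_finsum', ← finsum_add_distrib]
      · refine finsum_congr fun i => ?_
        rw [Derivation.leibniz]; simp only [smul_eq_mul]; ring
      · exact (pd_support_finite g).subset fun i hi h => hi (by simp [h])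
      · exact (pd_support_finite f).subset fun i hi h => hi (by simp [h])
      · exact (pd_support_finite f).subset fun i hi h => hi (by simp [h])
      · exact (pd_support_finite g).subset fun i hi h => hi (by simp [h]))

theorem vectorField_apply (a : ι → FinSmooth ι) (f : FinSmooth ι) :
    vectorField a f = ∑ᶠ i, a i * pd i f := rfl


theorem vectorField_eq_sum (a : ι → FinSmooth ι) (f : FinSmooth ι) {s : Finset ι}
    (hs : ∀ i ∉ s, pd i f = 0) : vectorField a f = ∑ i ∈ s, a i * pd i f :=
  finsum_eq_sum_of_support_subset _ fun i hi => by
    by_contra h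
    exact hi (by simp [hs i h])

theorem vectorField_coord (a : ι → FinSmooth ι) (k : ι) : vectorField a (coord k) = a k := by
  classical
  rw [vectorField_eq_sum a (coord k) (s := {k})]
  · simp [pd_coord]
  · intro i hi
    rw [pd_coord, if_neg]
    rintro rfl
    exact hi (Finset.mem_singleton_self _)

/-- The chain rule along a curve. -/
theorem hasDerivAt_curve (a : ι → FinSmooth ι) (f : FinSmooth ι) {c : ℝ → ι → ℝ} {t : ℝ}
    (hc : ∀ i, HasDerivAt (fun τ => c τ i) ((a i).1 (c t)) t) :
    HasDerivAt (fun τ => f.1 (c τ)) ((vectorField a f).1 (c t)) t := by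
  classical
  obtain ⟨s, g, hg, hfg⟩ := f.2
  have h1 : ∀ k z, (pd k f).1 z
      = fderiv ℝ g (fun l => z l) (fun l : s => (Pi.single k 1 : ι → ℝ) l) :=
    fun k z => pdFun_eq hg hfg k z
  have h0 : ∀ i ∉ s, pd i f = 0 := fun i hi => finSmooth_ext fun z => by
    rw [h1]
    have : (fun k : s => (Pi.single i 1 : ι → ℝ) k) = 0 := by
      funext k
      have : (k : ι) ≠ i := fun h => hi (h ▸ k.2)
      simp [Pi.single_eq_of_ne this]
    rw [this]; simp
  have key := hasDerivAt_curve_aux hg hc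
  simp only [hfg]
  convert key using 1
  rw [vectorField_eq_sum a f h0, ← evalAt_apply, map_sum]
  simp only [map_mul, evalAt_apply, h1]
  have hv : (fun i : s => (a i).1 (c t))
      = ∑ i ∈ s, (a i).1 (c t) • (fun l : s => (Pi.single i 1 : ι → ℝ) l) := by
    funext l
    rw [Finset.sum_apply]
    simp only [Pi.smul_apply, smul_eq_mul]
    rw [Finset.sum_eq_single (l : ι)]
    · simp
    · intro b _ hb; simp [Pi.single_eq_of_ne hb.symm]
    · intro h; exact absurd l.2 h
  rw [hv, map_sum]
  simp

theorem vectorField_comm {a b : ι → FinSmooth ι} (h : ∀ i, vectorField a (b i) = vectorField b (a i))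
    (f : FinSmooth ι) : vectorField a (vectorField b f) = vectorField b (vectorField a f) := by
  classical
  set s := (pd_support_finite f).toFinset
  have hs : ∀ i ∉ s, pd i f = 0 := fun i hi => by simpa [s] using hi
  have hs' : ∀ k, ∀ i ∉ s, pd i (pd k f) = 0 := fun k i hi => by rw [pd_comm, hs i hi, map_zero]
  have key : ∀ a b : ι → FinSmooth ι, vectorField a (vectorField b f)
      = ∑ i ∈ s, vectorField a (b i) * pd i f
        + ∑ i ∈ s, ∑ k ∈ s, b i * a k * pd k (pd i f) := by
    intro a b
    rw [vectorField_eq_sum b f hs, map_sum, ← Finset.sum_add_distrib]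
    refine Finset.sum_congr rfl fun i _ => ?_
    rw [Derivation.leibniz, vectorField_eq_sum a (pd i f) (hs' i)]
    simp only [smul_eq_mul, Finset.mul_sum, mul_assoc]
    ring
  rw [key a b, key b a, Finset.sum_comm]
  simp only [h]
  congr 1
  refine Finset.sum_congr rfl fun i _ => Finset.sum_congr rfl fun k _ => ?_
  rw [pd_comm]; ring

end FinSmooth

/-! ## The base space -/

/-- Multi-indices over a finite set of directions. -/
abbrev MIdx (m : ℕ) := Fin m → ℕ

/-- The multi-index `(μ)`. -/
abbrev e {m : ℕ} (μ : Fin m) : MIdx m := Pi.single μ 1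

/-- The coordinates `x^μ`, `u^μ_i`, `p_i` of the base space in dimension `m = n + 1`;
the direction written `1` in the usual numbering is `0 : Fin (n + 1)`, and the
directions `2, …, m` are `α.succ` for `α : Fin n`. -/
inductive BCoord (n : ℕ)
  | x (μ : Fin (n + 1))
  | u (μ : Fin (n + 1)) (i : MIdx (n + 1))
  | p (i : MIdx (n + 1))

/-- The algebra of the base space. -/
abbrev ABase (n : ℕ) := FinSmooth (BCoord n)

/-- The coefficients of the total derivative along `x^μ`. -/
def totalCoeff {n : ℕ} (μ : Fin (n + 1)) : BCoord n → ABase n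
  | .x ν => if ν = μ then 1 else 0
  | .u lam i => coord (.u lam (i + e μ))
  | .p i => coord (.p (i + e μ))

/-- The total derivative `D_μ = ∂_{x^μ} + u^λ_{i+(μ)} ∂_{u^λ_i} + p_{i+(μ)} ∂_{p_i}`. -/
def totalD {n : ℕ} (μ : Fin (n + 1)) : Derivation ℝ (ABase n) (ABase n) :=
  vectorField (totalCoeff μ)

theorem totalD_comm {n : ℕ} (μ ν : Fin (n + 1)) (f : ABase n) :
    totalD μ (totalD ν f) = totalD ν (totalD μ f) := by
  refine vectorField_comm (fun i => ?_) f
  cases i with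
  | x l =>
    have : ∀ (P : Prop) [Decidable P] (X : Derivation ℝ (ABase n) (ABase n)),
        X (if P then 1 else 0) = 0 := by
      intro P _ X; split_ifs <;> simp
    simp only [totalCoeff, this]
  | u l i => simp only [totalCoeff, vectorField_coord, add_assoc, add_comm (e μ)]
  | p i => simp only [totalCoeff, vectorField_coord, add_assoc, add_comm (e μ)]

/-! ## The constraints -/

section Constraints

variable {R : Type*} [CommRing R] {n : ℕ}

/-- `u^μ_{i+(μ)}`. -/
def CE (u : Fin (n + 1) → MIdx (n + 1) → R) (i : MIdx (n + 1)) : R :=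
  ∑ μ, u μ (i + e μ)

/-- `∑_{k+l=i} binom(i,k) a_k b_l`. -/
def leibnizSum {m : ℕ} (a b : MIdx m → R) (i : MIdx m) : R :=
  ∑ k ∈ Finset.Iic i, ((∏ ν, (i ν).choose (k ν) : ℕ) : R) * (a k * b (i - k))

/-- `D_i (u^λ_{(μ)} u^μ_{(λ)})`, that is
`∑_{λ,μ} ∑_{k+l=i} binom(i,k) u^λ_{k+(μ)} u^μ_{l+(λ)}`. -/
def quad (u : Fin (n + 1) → MIdx (n + 1) → R) (i : MIdx (n + 1)) : R :=
  ∑ lam, ∑ μ, leibnizSum (fun k => u lam (k + e μ)) (fun l => u μ (l + e lam)) i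

/-- `Δ p_i = ∑_μ p_{i+2(μ)}`. -/
def lap (p : MIdx (n + 1) → R) (i : MIdx (n + 1)) : R :=
  ∑ μ, p (i + (e μ + e μ))

/-- `Δ p_i + D_i (u^λ_{(μ)} u^μ_{(λ)})`. -/
def PE (u : Fin (n + 1) → MIdx (n + 1) → R) (p : MIdx (n + 1) → R) (i : MIdx (n + 1)) : R :=
  lap p i + quad u i

end Constraints

/-- The divergence-free space with the pressure–Poisson constraint, as a subset of the
base space: all differential consequences of both constraints hold. -/
def solutionSet (n : ℕ) : Set (BCoord n → ℝ) :=
  {z | ∀ i, CE (fun μ i => z (.u μ i)) i = 0 ∧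
    PE (fun μ i => z (.u μ i)) (fun i => z (.p i)) i = 0}

/-- The ideal of functions vanishing on the constraint space. -/
def J (n : ℕ) : Ideal (ABase n) where
  carrier := {f | ∀ z ∈ solutionSet n, f.1 z = 0}
  add_mem' {f g} hf hg z hz := by
    change f.1 z + g.1 z = 0
    rw [hf z hz, hg z hz, add_zero]
  zero_mem' _ _ := rfl
  smul_mem' c f hf z hz := by
    change c.1 z * f.1 z = 0
    rw [hf z hz, mul_zero]

/-- The algebra of smooth functions on the constraint space. -/
def ACPE (n : ℕ) : Type := ABase n ⧸ J n

instance (n : ℕ) : CommRing (ACPE n) := inferInstanceAs (CommRing (ABase n ⧸ J n))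

instance (n : ℕ) : Algebra ℝ (ACPE n) := inferInstanceAs (Algebra ℝ (ABase n ⧸ J n))

/-- The restriction of functions to the constraint space. -/
def restr (n : ℕ) : ABase n →ₐ[ℝ] ACPE n := Ideal.Quotient.mkₐ ℝ (J n)

theorem restr_surjective (n : ℕ) : Function.Surjective (restr n) :=
  Ideal.Quotient.mkₐ_surjective ℝ (J n)

theorem restr_eq_restr {n : ℕ} {f g : ABase n} : restr n f = restr n g ↔ f - g ∈ J n :=
  Ideal.Quotient.eq

theorem restr_eq_zero {n : ℕ} {f : ABase n} : restr n f = 0 ↔ f ∈ J n :=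
  Ideal.Quotient.eq_zero_iff_mem

/-! ### Tangency of the total derivatives -/

section Solve

variable {R : Type*} [AddCommGroup R] {n : ℕ}

/-- The solution of `∑_μ p_{i+2(μ)} = r_i` with prescribed `p_{0,j}`, `p_{1,j}`. -/
def solve (r : MIdx (n + 1) → R) (a₀ a₁ : MIdx n → R) : ℕ → MIdx n → R
  | 0, j => a₀ j
  | 1, j => a₁ j
  | k + 2, j => r (Fin.cons k j) - ∑ α, solve r a₀ a₁ k (j + (e α + e α))

theorem cons_add_e_zero (k : ℕ) (j : MIdx n) :
    (Fin.cons k j : MIdx (n + 1)) + e 0 = Fin.cons (k + 1) j := by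
  funext μ
  refine Fin.cases ?_ (fun α => ?_) μ
  · simp
  · simp [Fin.succ_ne_zero]

theorem cons_add_e_succ (k : ℕ) (j : MIdx n) (α : Fin n) :
    (Fin.cons k j : MIdx (n + 1)) + e α.succ = Fin.cons k (j + e α) := by
  funext μ
  refine Fin.cases ?_ (fun β => ?_) μ
  · simp [(Fin.succ_ne_zero α).symm]
  · simp [Pi.single_apply]

end Solve

theorem lap_cons {R : Type*} [CommRing R] {n : ℕ} (p : MIdx (n + 1) → R) (k : ℕ) (j : MIdx n) :
    lap p (Fin.cons k j)
      = p (Fin.cons (k + 2) j) + ∑ α, p (Fin.cons k (j + (e α + e α))) := by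
  simp only [lap, Fin.sum_univ_succ, ← add_assoc, cons_add_e_zero, cons_add_e_succ]

theorem lap_solve {R : Type*} [CommRing R] {n : ℕ} (r : MIdx (n + 1) → R) (a₀ a₁ : MIdx n → R)
    (i : MIdx (n + 1)) : lap (fun i => solve r a₀ a₁ (i 0) (Fin.tail i)) i = r i := by
  obtain ⟨k, j, rfl⟩ : ∃ k j, i = Fin.cons k j := ⟨i 0, Fin.tail i, (Fin.cons_self_tail i).symm⟩
  rw [lap_cons]
  simp [solve]

/-- Uniqueness of the solution. -/
theorem eq_solve {R : Type*} [CommRing R] {n : ℕ} {r : MIdx (n + 1) → R} {a₀ a₁ : MIdx n → R}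
    {p : MIdx (n + 1) → R} (h : ∀ i, lap p i = r i) (h₀ : ∀ j, p (Fin.cons 0 j) = a₀ j)
    (h₁ : ∀ j, p (Fin.cons 1 j) = a₁ j) (k : ℕ) :
    ∀ j, p (Fin.cons k j) = solve r a₀ a₁ k j := by
  induction k using Nat.twoStepInduction with
  | zero => exact h₀
  | one => exact h₁
  | more k ih _ =>
    intro j
    have := h (Fin.cons k j)
    rw [lap_cons] at this
    rw [solve, ← this]
    simp [ih]

/-- The Leibniz rule for `leibnizSum`. -/
theorem leibnizSum_add_e {R : Type*} [CommRing R] {m : ℕ} (a b : MIdx m → R) (i : MIdx m)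
    (μ : Fin m) : leibnizSum a b (i + e μ)
      = leibnizSum (fun k => a (k + e μ)) b i + leibnizSum a (fun k => b (k + e μ)) i := by
  classical
  have hle : ∀ k : MIdx m, k ≤ i → k ≤ i + e μ := fun k hk => hk.trans (by simp)
  have he : ∀ k : MIdx m, k μ ≠ 0 → k - e μ + e μ = k := by
    intro k hk; funext ν
    by_cases h : ν = μ
    · subst h; simp; omega
    · simp [Pi.single_eq_of_ne h]
  have hB0 : ∀ k : MIdx m, ¬ k ≤ i → (∏ ν, (i ν).choose (k ν)) = 0 := by
    intro k hk
    obtain ⟨ν, hν⟩ := not_forall.1 hk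
    exact Finset.prod_eq_zero (Finset.mem_univ ν) (Nat.choose_eq_zero_of_lt (not_le.1 hν))
  have hB : ∀ k : MIdx m, (∏ ν, ((i + e μ) ν).choose (k ν))
      = (∏ ν, (i ν).choose (k ν))
        + if k μ = 0 then 0 else ∏ ν, (i ν).choose ((k - e μ) ν) := by
    intro k
    rw [← Finset.mul_prod_erase _ _ (Finset.mem_univ μ),
      ← Finset.mul_prod_erase Finset.univ (fun ν => (i ν).choose (k ν)) (Finset.mem_univ μ),
      ← Finset.mul_prod_erase Finset.univ (fun ν => (i ν).choose ((k - e μ) ν))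
        (Finset.mem_univ μ)]
    have h1 : ∏ ν ∈ Finset.univ.erase μ, ((i + e μ) ν).choose (k ν)
        = ∏ ν ∈ Finset.univ.erase μ, (i ν).choose (k ν) :=
      Finset.prod_congr rfl fun ν hν => by simp [Pi.single_eq_of_ne (Finset.ne_of_mem_erase hν)]
    have h2 : ∏ ν ∈ Finset.univ.erase μ, (i ν).choose ((k - e μ) ν)
        = ∏ ν ∈ Finset.univ.erase μ, (i ν).choose (k ν) :=
      Finset.prod_congr rfl fun ν hν => by simp [Pi.single_eq_of_ne (Finset.ne_of_mem_erase hν)]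
    rw [h1, h2]
    rcases hk : k μ with _ | c
    · simp
    · simp [hk, Nat.choose_succ_succ]; ring
  have h1 : leibnizSum a (fun k => b (k + e μ)) i = ∑ k ∈ Finset.Iic (i + e μ),
      ((∏ ν, (i ν).choose (k ν) : ℕ) : R) * (a k * b (i + e μ - k)) := by
    unfold leibnizSum
    rw [← Finset.sum_subset (s₁ := Finset.Iic i) (s₂ := Finset.Iic (i + e μ))]
    · refine Finset.sum_congr rfl fun k hk => ?_
      have hk := Finset.mem_Iic.1 hk
      have : i - k + e μ = i + e μ - k := (tsub_add_eq_add_tsub hk)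
      simp only [this]
    · intro k hk
      exact Finset.mem_Iic.2 (hle k (Finset.mem_Iic.1 hk))
    · intro k _ hk
      rw [hB0 k (fun h => hk (Finset.mem_Iic.2 h))]; simp
  have h2 : leibnizSum (fun k => a (k + e μ)) b i = ∑ k ∈ Finset.Iic (i + e μ),
      ((if k μ = 0 then 0 else ∏ ν, (i ν).choose ((k - e μ) ν) : ℕ) : R)
        * (a k * b (i + e μ - k)) := by
    unfold leibnizSum
    rw [← Finset.sum_filter_add_sum_filter_not (Finset.Iic (i + e μ)) (fun k => k μ = 0)]
    rw [Finset.sum_eq_zero (s := (Finset.Iic (i + e μ)).filter (fun k => k μ = 0)), zero_add]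
    · refine Finset.sum_nbij' (fun k => k + e μ) (fun k => k - e μ) ?_ ?_ ?_ ?_ ?_
      · intro k hk
        simp only [Finset.mem_filter, Finset.mem_Iic] at hk ⊢
        exact ⟨add_le_add_left hk _, by simp⟩
      · intro k hk
        simp only [Finset.mem_filter, Finset.mem_Iic] at hk ⊢
        exact tsub_le_iff_right.2 hk.1
      · intro k _; exact add_tsub_cancel_right _ _
      · intro k hk
        exact he k (Finset.mem_filter.1 hk).2
      · intro k _
        have h3 : (k + e μ) μ ≠ 0 := by simp
        rw [if_neg h3, add_tsub_cancel_right, add_tsub_add_eq_tsub_right]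
    · intro k hk
      simp [(Finset.mem_filter.1 hk).2]
  rw [h1, h2, ← Finset.sum_add_distrib]
  refine Finset.sum_congr rfl fun k _ => ?_
  rw [hB]; push_cast; ring

theorem leibnizSum_quadratic {R : Type*} [CommRing R] {m : ℕ} (a a' b b' : MIdx m → R) (t : R)
    (i : MIdx m) : leibnizSum (fun k => a k + t * a' k) (fun k => b k + t * b' k) i
      = leibnizSum a b i + t * (leibnizSum a' b i + leibnizSum a b' i)
        + t ^ 2 * leibnizSum a' b' i := by
  simp only [leibnizSum, Finset.mul_sum, ← Finset.sum_add_distrib]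
  exact Finset.sum_congr rfl fun k _ => by ring

theorem quad_quadratic {R : Type*} [CommRing R] {n : ℕ} (u : Fin (n + 1) → MIdx (n + 1) → R)
    (μ : Fin (n + 1)) (t : R) (i : MIdx (n + 1)) :
    quad (fun lam k => u lam k + t * u lam (k + e μ)) i
      = quad u i + t * quad u (i + e μ) + t ^ 2 * quad (fun lam k => u lam (k + e μ)) i := by
  simp only [quad, leibnizSum_add_e, leibnizSum_quadratic, Finset.mul_sum,
    ← Finset.sum_add_distrib, add_right_comm _ (e μ)]

/-- The total derivatives are tangent to the constraint space. -/
theorem totalD_mem_J {n : ℕ} (μ : Fin (n + 1)) {f : ABase n} (hf : f ∈ J n) :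
    totalD μ f ∈ J n := by
  intro z hz
  set q : MIdx (n + 1) → ℝ := fun i =>
    solve (fun i => - quad (fun lam k => z (.u lam (k + e μ))) i) 0 0 (i 0) (Fin.tail i) with hq
  set w : BCoord n → ℝ := fun b => match b with
    | .p i => q i
    | _ => 0
  set c : ℝ → BCoord n → ℝ := fun t b => z b + t * (totalCoeff μ b).1 z + t ^ 2 * w b with hcdef
  have c0 : c 0 = z := by funext b; simp [hcdef]
  have hc : ∀ b, HasDerivAt (fun τ => c τ b) ((totalCoeff μ b).1 (c 0)) 0 := by
    intro b
    have h1 := (((hasDerivAt_id' (0 : ℝ)).mul_const ((totalCoeff μ b).1 z)).const_add (z b)).add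
      (((hasDerivAt_id' (0 : ℝ)).pow 2).mul_const (w b))
    rw [c0]
    have h2 : HasDerivAt (fun τ => c τ b) _ 0 := h1
    simpa using h2
  have hmem : ∀ t, c t ∈ solutionSet n := by
    intro t i
    have hu : (fun μ i => c t (.u μ i)) = fun lam k => z (.u lam k) + t * z (.u lam (k + e μ)) := by
      funext lam k
      simp [hcdef, w, totalCoeff, coord]
    have hp : (fun i => c t (.p i)) = fun k => z (.p k) + t * z (.p (k + e μ)) + t ^ 2 * q k := by
      funext k
      simp [hcdef, w, totalCoeff, coord]
    rw [hu, hp]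
    obtain ⟨h1, h2⟩ := hz i
    obtain ⟨h3, h4⟩ := hz (i + e μ)
    have h5 : lap q i = _ := lap_solve _ _ _ i
    constructor
    · simp only [CE] at h1 h3 ⊢
      rw [Finset.sum_add_distrib, ← Finset.mul_sum, h1]
      simp only [add_right_comm _ (e μ)] at h3
      rw [h3]; ring
    · simp only [PE] at h2 h4 ⊢
      rw [quad_quadratic (fun lam k => z (.u lam k))]
      have h6 : lap (fun k => z (.p k) + t * z (.p (k + e μ)) + t ^ 2 * q k) i
          = lap (fun k => z (.p k)) i + t * lap (fun k => z (.p k)) (i + e μ)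
            + t ^ 2 * lap q i := by
        simp only [lap, Finset.mul_sum, ← Finset.sum_add_distrib, add_right_comm _ (e μ)]
      rw [h6, h5]
      linear_combination h2 + t * h4
  have hd := hasDerivAt_curve (totalCoeff μ) f hc
  have hz' : (fun τ => f.1 (c τ)) = fun _ => 0 := funext fun τ => hf _ (hmem τ)
  rw [hz', c0] at hd
  exact hd.unique (hasDerivAt_const _ _)

/-- The total derivative on the algebra of the constraint space, `D_μ (f + J) = D_μ f + J`. -/
def D {n : ℕ} (μ : Fin (n + 1)) : ACPE n →ₗ[ℝ] ACPE n where
  toFun := Quotient.map' (totalD μ) fun f g h => by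
    have h1 : f - g ∈ J n := (Submodule.quotientRel_def (J n)).1 h
    refine (Submodule.quotientRel_def (J n)).2 ?_
    rw [← map_sub]
    exact totalD_mem_J μ h1
  map_add' f g := by
    obtain ⟨f, rfl⟩ := restr_surjective n f
    obtain ⟨g, rfl⟩ := restr_surjective n g
    rw [← map_add]
    exact (congrArg (restr n) (map_add (totalD μ) f g)).trans (map_add _ _ _)
  map_smul' c f := by
    obtain ⟨f, rfl⟩ := restr_surjective n f
    rw [← map_smul]
    exact (congrArg (restr n) (Derivation.map_smul (totalD μ) c f)).trans (map_smul _ _ _)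

theorem D_restr {n : ℕ} (μ : Fin (n + 1)) (f : ABase n) :
    D μ (restr n f) = restr n (totalD μ f) := rfl

theorem D_comm {n : ℕ} (μ ν : Fin (n + 1)) (f : ACPE n) : D μ (D ν f) = D ν (D μ f) := by
  obtain ⟨f, rfl⟩ := restr_surjective n f
  simp only [D_restr, totalD_comm μ ν]

/-! ## Global coordinates on the constraint space -/

/-- The dependent variables `u^1_0`, `u^α_k`, `p_0`, `p_1` of the jets in the directions
`2, …, m`. -/
inductive Dep (n : ℕ)
  | u1
  | u (α : Fin n) (k : ℕ)
  | p (k : Fin 2)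

/-- The global coordinates `x^μ`, `u^1_{0,j}`, `u^α_{k,j}`, `p_{0,j}`, `p_{1,j}`. -/
inductive KCoord (n : ℕ)
  | x (μ : Fin (n + 1))
  | jet (a : Dep n) (j : MIdx n)

/-- The global coordinates as coordinates of the base space. -/
def KCoord.toB {n : ℕ} : KCoord n → BCoord n
  | .x μ => .x μ
  | .jet .u1 j => .u 0 (Fin.cons 0 j)
  | .jet (.u α k) j => .u α.succ (Fin.cons k j)
  | .jet (.p k) j => .p (Fin.cons k.val j)

/-- A function of the global coordinates, viewed as a function on the base space. -/
def incl (n : ℕ) : FinSmooth (KCoord n) →ₐ[ℝ] ABase n where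
  toFun g := ⟨fun z => g.1 (fun k => z k.toB), g.2.comp fun k => isFinSmooth_coord k.toB⟩
  map_one' := rfl
  map_mul' _ _ := rfl
  map_zero' := rfl
  map_add' _ _ := rfl
  commutes' _ := rfl

/-- A function of the global coordinates, viewed as a function on the constraint space. -/
def toCPE (n : ℕ) : FinSmooth (KCoord n) →ₐ[ℝ] ACPE n :=
  (restr n).comp (incl n)

/-- The velocity jets on the constraint space in global coordinates. -/
def sigU {n : ℕ} (μ : Fin (n + 1)) (i : MIdx (n + 1)) : FinSmooth (KCoord n) :=
  Fin.cases (motive := fun _ => FinSmooth (KCoord n))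
    (match i 0 with
      | 0 => coord (.jet .u1 (Fin.tail i))
      | k + 1 => - ∑ α, coord (.jet (.u α k) (Fin.tail i + e α)))
    (fun α => coord (.jet (.u α (i 0)) (Fin.tail i))) μ

/-- The coordinates of the base space on the constraint space in global coordinates. -/
def sig {n : ℕ} : BCoord n → FinSmooth (KCoord n)
  | .x μ => coord (.x μ)
  | .u μ i => sigU μ i
  | .p i => solve (fun i => - quad sigU i) (fun j => coord (.jet (.p 0) j))
      (fun j => coord (.jet (.p 1) j)) (i 0) (Fin.tail i)

theorem CE_cons {R : Type*} [CommRing R] {n : ℕ} (u : Fin (n + 1) → MIdx (n + 1) → R) (k : ℕ)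
    (j : MIdx n) : CE u (Fin.cons k j)
      = u 0 (Fin.cons (k + 1) j) + ∑ α : Fin n, u α.succ (Fin.cons k (j + e α)) := by
  simp only [CE, Fin.sum_univ_succ, cons_add_e_zero, cons_add_e_succ]

theorem map_CE {R S : Type*} [CommRing R] [CommRing S] (φ : R →+* S) {n : ℕ}
    (u : Fin (n + 1) → MIdx (n + 1) → R) (i : MIdx (n + 1)) :
    CE (fun μ i => φ (u μ i)) i = φ (CE u i) := by
  simp [CE]

theorem map_quad {R S : Type*} [CommRing R] [CommRing S] (φ : R →+* S) {n : ℕ}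
    (u : Fin (n + 1) → MIdx (n + 1) → R) (i : MIdx (n + 1)) :
    quad (fun μ i => φ (u μ i)) i = φ (quad u i) := by
  simp only [quad, leibnizSum, map_sum, map_mul, map_natCast]

theorem map_lap {R S : Type*} [CommRing R] [CommRing S] (φ : R →+* S) {n : ℕ}
    (p : MIdx (n + 1) → R) (i : MIdx (n + 1)) :
    lap (fun i => φ (p i)) i = φ (lap p i) := by
  simp only [lap, map_sum]

theorem sig_mem {n : ℕ} (w : KCoord n → ℝ) : (fun b => (sig b).1 w) ∈ solutionSet n := by
  intro i
  constructor
  · refine (map_CE (evalAt w).toRingHom sigU i).trans ?_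
    obtain ⟨k, j, rfl⟩ : ∃ k j, i = Fin.cons k j := ⟨i 0, Fin.tail i, (Fin.cons_self_tail i).symm⟩
    rw [CE_cons]
    simp [sigU]
  · have h1 := map_quad (evalAt w).toRingHom (sigU (n := n)) i
    have h2 := map_lap (evalAt w).toRingHom (fun i => sig (n := n) (.p i)) i
    refine (congrArg₂ (· + ·) h2 h1).trans ?_
    have h3 : lap (fun i => sig (n := n) (.p i)) i = _ := lap_solve _ _ _ i
    rw [h3]; simp

theorem sig_toB {n : ℕ} (k : KCoord n) : sig k.toB = coord k := by
  rcases k with μ | ⟨_ | ⟨α, k⟩ | k, j⟩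
  · rfl
  · simp [KCoord.toB, sig, sigU]
  · simp [KCoord.toB, sig, sigU]
  · fin_cases k <;> simp [KCoord.toB, sig, solve]

theorem sig_eq {n : ℕ} {z : BCoord n → ℝ} (hz : z ∈ solutionSet n) (b : BCoord n) :
    (sig b).1 (fun k => z k.toB) = z b := by
  set w : KCoord n → ℝ := fun k => z k.toB with hw
  have hu : ∀ μ i, (sigU μ i).1 w = z (.u μ i) := by
    intro μ i
    obtain ⟨k, j, rfl⟩ : ∃ k j, i = Fin.cons k j := ⟨i 0, Fin.tail i, (Fin.cons_self_tail i).symm⟩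
    refine Fin.cases ?_ (fun α => ?_) μ
    · rcases k with _ | k
      · rfl
      · have h := (hz (Fin.cons k j)).1
        rw [CE_cons] at h
        rw [eq_neg_of_add_eq_zero_left h, ← evalAt_apply]
        simp [sigU]
        rfl
    · rfl
  cases b with
  | x μ => rfl
  | u μ i => exact hu μ i
  | p i =>
    obtain ⟨k, j, rfl⟩ : ∃ k j, i = Fin.cons k j := ⟨i 0, Fin.tail i, (Fin.cons_self_tail i).symm⟩
    have h1 : ∀ i, lap (fun i => z (.p i)) i = - quad (fun μ i => z (.u μ i)) i :=
      fun i => eq_neg_of_add_eq_zero_left (hz i).2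
    have h2 : ∀ i, lap (fun i => (sig (n := n) (.p i)).1 w) i
        = - quad (fun μ i => z (.u μ i)) i := by
      intro i
      refine (map_lap (evalAt w).toRingHom (fun i => sig (n := n) (.p i)) i).trans ?_
      have h3 : lap (fun i => sig (n := n) (.p i)) i = _ := lap_solve _ _ _ i
      rw [h3, map_neg, ← map_quad]
      simp [hu]
    exact (eq_solve (a₀ := fun j => z (.p (Fin.cons 0 j))) (a₁ := fun j => z (.p (Fin.cons 1 j))) h2
      (fun _ => rfl) (fun _ => rfl) k j).trans
      (eq_solve h1 (fun _ => rfl) (fun _ => rfl) k j).symm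

theorem toCPE_bijective (n : ℕ) : Function.Bijective (toCPE n) := by
  constructor
  · refine (injective_iff_map_eq_zero _).2 fun g hg => finSmooth_ext fun w => ?_
    have h : incl n g ∈ J n := restr_eq_zero.1 hg
    have h1 := h _ (sig_mem w)
    have h2 : (fun k : KCoord n => (sig k.toB).1 w) = w := funext fun k => by rw [sig_toB]; rfl
    change g.1 (fun k : KCoord n => (sig k.toB).1 w) = 0 at h1
    rw [h2] at h1
    exact h1
  · intro f
    obtain ⟨f, rfl⟩ := restr_surjective n f
    refine ⟨⟨fun w => f.1 (fun b => (sig b).1 w), f.2.comp fun b => (sig b).2⟩, ?_⟩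
    refine restr_eq_restr.2 fun z hz => ?_
    change f.1 (fun b => (sig b).1 (fun k => z k.toB)) - f.1 z = 0
    rw [funext (sig_eq hz), sub_self]

/-- The algebra of the constraint space is the algebra of smooth functions of finite order of
the global coordinates. -/
def chart (n : ℕ) : FinSmooth (KCoord n) ≃ₐ[ℝ] ACPE n :=
  AlgEquiv.ofBijective (toCPE n) (toCPE_bijective n)

/-- The partial derivative with respect to the global coordinate `k`. -/
def pdC {n : ℕ} (k : KCoord n) : ACPE n →ₗ[ℝ] ACPE n :=
  (chart n).toLinearMap ∘ₗ (pd k).toLinearMap ∘ₗ (chart n).symm.toLinearMap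

/-- The function `u^μ_i` on the constraint space. -/
def uC {n : ℕ} (μ : Fin (n + 1)) (i : MIdx (n + 1)) : ACPE n :=
  restr n (coord (.u μ i))

/-! ## The complex of horizontal forms and its cohomology -/

section Forms

variable {ι : Type*} {A : Type*} [AddCommGroup A] [Module ℝ A]

variable (ι A) in
/-- Inhomogeneous horizontal forms. For `s = {μ₁ < ⋯ < μ_q}`, `om s` is the coefficient
`om(D_{μ₁}, …, D_{μ_q})` of `dx^{μ₁} ∧ ⋯ ∧ dx^{μ_q}`. -/
abbrev Form := Finset ι → A

/-- The space of forms of degree `q`; it is zero unless `0 ≤ q ≤ card ι`. -/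
def formsOfDegree (q : ℤ) : Submodule ℝ (Form ι A) where
  carrier := {om | ∀ s, (s.card : ℤ) ≠ q → om s = 0}
  add_mem' h h' s hs := by simp [h s hs, h' s hs]
  zero_mem' _ _ := rfl
  smul_mem' c _ h s hs := by simp [h s hs]

/-- An operator acting on forms by coefficients. -/
def coeffwise (T : A →ₗ[ℝ] A) : Form ι A →ₗ[ℝ] Form ι A where
  toFun om s := T (om s)
  map_add' om om' := by funext s; simp
  map_smul' c om := by funext s; simp

theorem coeffwise_mem_formsOfDegree (T : A →ₗ[ℝ] A) {q : ℤ} {om : Form ι A}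
    (hom : om ∈ formsOfDegree q) : coeffwise T om ∈ formsOfDegree q := fun s hs => by
  simp [coeffwise, hom s hs]

variable [LinearOrder ι]

/-- The differential: for `μ₀ < ⋯ < μ_q`,
`(d om)_{μ₀…μ_q} = ∑_k (-1)^k D_{μ_k} om_{μ₀…μ̌_k…μ_q}`. -/
def dForm (D : ι → A →ₗ[ℝ] A) : Form ι A →ₗ[ℝ] Form ι A where
  toFun om s := ∑ μ ∈ s, (-1 : ℝ) ^ (s.filter (· < μ)).card • D μ (om (s.erase μ))
  map_add' om om' := by funext s; simp [Finset.sum_add_distrib]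
  map_smul' c om := by
    funext s
    simp [Finset.smul_sum, smul_comm c]

/-- Closed forms of degree `q`. -/
def cocycles (D : ι → A →ₗ[ℝ] A) (q : ℤ) : Submodule ℝ (Form ι A) :=
  LinearMap.ker (dForm D) ⊓ formsOfDegree q

/-- Exact forms of degree `q`. -/
def coboundaries (D : ι → A →ₗ[ℝ] A) (q : ℤ) : Submodule ℝ (Form ι A) :=
  (formsOfDegree (q - 1)).map (dForm D)

/-- The cohomology in degree `q`. -/
abbrev Cohomology (D : ι → A →ₗ[ℝ] A) (q : ℤ) :=
  cocycles D q ⧸ (coboundaries D q).submoduleOf (cocycles D q)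

theorem dForm_coeffwise {D : ι → A →ₗ[ℝ] A} {T : A →ₗ[ℝ] A} (h : ∀ μ a, D μ (T a) = T (D μ a))
    (om : Form ι A) : dForm D (coeffwise T om) = coeffwise T (dForm D om) := by
  funext s
  simp [dForm, coeffwise, h]

theorem coeffwise_mem_cocycles {D : ι → A →ₗ[ℝ] A} {T : A →ₗ[ℝ] A}
    (h : ∀ μ a, D μ (T a) = T (D μ a)) {q : ℤ} {om : Form ι A} (hom : om ∈ cocycles D q) :
    coeffwise T om ∈ cocycles D q := by
  refine ⟨?_, coeffwise_mem_formsOfDegree T hom.2⟩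
  refine LinearMap.mem_ker.2 ?_
  rw [dForm_coeffwise h, LinearMap.mem_ker.1 hom.1, map_zero]

/-- The operator induced in cohomology, `[om] ↦ [T om]`. -/
def cohomologyMap {D : ι → A →ₗ[ℝ] A} (T : A →ₗ[ℝ] A) (h : ∀ μ a, D μ (T a) = T (D μ a)) (q : ℤ) :
    Cohomology D q →ₗ[ℝ] Cohomology D q :=
  Submodule.mapQ _ _ ((coeffwise T).restrict fun _ hom => coeffwise_mem_cocycles h hom) (by
    rintro ⟨_, hom⟩ ⟨η, hη, rfl⟩
    exact ⟨coeffwise T η, coeffwise_mem_formsOfDegree T hη, dForm_coeffwise h η⟩)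

/-- The cohomology class of a closed form. -/
def cls {D : ι → A →ₗ[ℝ] A} {q : ℤ} (om : cocycles D q) : Cohomology D q :=
  Submodule.Quotient.mk om

end Forms

/-- The horizontal cohomology of the constraint space. -/
abbrev H (n : ℕ) (q : ℤ) := Cohomology (D (n := n)) q

/-- The total derivatives in the directions `2, …, m`. -/
abbrev DTheta {n : ℕ} (α : Fin n) : ACPE n →ₗ[ℝ] ACPE n := D α.succ

/-- The cohomology of the auxiliary complex of forms in `dx^2, …, dx^m` with coefficients in the
algebra of the constraint space. -/
abbrev HTheta (n : ℕ) (q : ℤ) := Cohomology (DTheta (n := n)) q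

/-- The map `D_1^q` on the cohomology of the auxiliary complex. -/
def D1 (n : ℕ) (q : ℤ) : HTheta n q →ₗ[ℝ] HTheta n q :=
  cohomologyMap (D 0) (fun α a => D_comm α.succ 0 a) q

/-- The set `{2, …, m}`. -/
def tailSet (n : ℕ) : Finset (Fin (n + 1)) := Finset.univ.map (Fin.succEmb n)

/-! ## The spaces of solutions and the Helmholtz space -/

section Variational

variable {n : ℕ}

/-- `D_j = D_2^{j^2} ∘ ⋯ ∘ D_m^{j^m}`. -/
def DIter (j : MIdx n) : Module.End ℝ (ACPE n) :=
  (List.ofFn fun α => (DTheta α : Module.End ℝ (ACPE n)) ^ j α).prod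

/-- `(-D)_j`. -/
def negDIter (j : MIdx n) : Module.End ℝ (ACPE n) :=
  (-1 : ℝ) ^ (∑ α, j α) • DIter j

/-- The variational derivative `δ_a L = (-D)_j ∂_{a_j} L`. -/
def varDeriv (L : ACPE n) (a : Dep n) : ACPE n :=
  ∑ᶠ j : MIdx n, negDIter j (pdC (.jet a j) L)

/-- The operator `f^*`. -/
def fStar (χ : Dep n → ACPE n) : Dep n → ACPE n
  | .u1 => 2 * ∑ α : Fin n, DTheta α (uC α.succ (e 0) * χ (.p 1))
  | .u α 0 => DTheta α (χ .u1)
      + 2 * (DTheta α ((∑ β : Fin n, uC β.succ (e β.succ)) * χ (.p 1))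
        + ∑ β : Fin n, DTheta β (uC β.succ (e α.succ) * χ (.p 1)))
  | .u α 1 => χ (.u α 0) - 2 * (uC 0 (e α.succ) * χ (.p 1))
  | .u α (k + 2) => χ (.u α (k + 1))
  | .p 0 => - ∑ α : Fin n, DTheta α (DTheta α (χ (.p 1)))
  | .p 1 => χ (.p 0)

/-- The linearization `(χ_* f)_a = ∂_{b_j} χ_a · D_j f^b`. -/
def lin (χ : Dep n →₀ ACPE n) (f : Dep n → ACPE n) (a : Dep n) : ACPE n :=
  ∑ᶠ bj : Dep n × MIdx n, pdC (.jet bj.1 bj.2) (χ a) * DIter bj.2 (f bj.1)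

/-- The formal adjoint `(χ^* f)_a = (-D)_j (f^b · ∂_{a_j} χ_b)`. -/
def linAdj (χ : Dep n →₀ ACPE n) (f : Dep n → ACPE n) (a : Dep n) : ACPE n :=
  ∑ᶠ bj : Dep n × MIdx n, negDIter bj.2 (f bj.1 * pdC (.jet a bj.2) (χ bj.1))

theorem fStar_add (χ χ' : Dep n → ACPE n) (a : Dep n) :
    fStar (χ + χ') a = fStar χ a + fStar χ' a := by
  rcases a with _ | ⟨α, _ | _ | k⟩ | k
  · simp only [fStar, Pi.add_apply, mul_add, map_add, Finset.sum_add_distrib]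
  · simp only [fStar, Pi.add_apply, mul_add, map_add, Finset.sum_add_distrib]; ring
  · simp only [fStar, Pi.add_apply, mul_add]; ring
  · rfl
  · fin_cases k
    · simp only [fStar, Pi.add_apply, map_add, Finset.sum_add_distrib, neg_add]
    · rfl

theorem fStar_smul (c : ℝ) (χ : Dep n → ACPE n) (a : Dep n) :
    fStar (c • χ) a = c • fStar χ a := by
  rcases a with _ | ⟨α, _ | _ | k⟩ | k
  · simp only [fStar, Pi.smul_apply, mul_smul_comm, map_smul, ← Finset.smul_sum]
  · simp only [fStar, Pi.smul_apply, mul_smul_comm, map_smul, ← Finset.smul_sum, ← smul_add]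
  · simp only [fStar, Pi.smul_apply, mul_smul_comm, smul_sub]
  · rfl
  · fin_cases k
    · simp only [fStar, Pi.smul_apply, map_smul, Finset.smul_sum, smul_neg]
    · rfl

/-- The space of finite families `χ` with `(D_1 + f^*) χ = 0`. -/
def Sol (n : ℕ) : Submodule ℝ (Dep n →₀ ACPE n) where
  carrier := {χ | ∀ a, D 0 (χ a) + fStar χ a = 0}
  zero_mem' a := by
    have := fStar_smul (0 : ℝ) (0 : Dep n → ACPE n) a
    simp only [zero_smul] at this
    simp [this]
  add_mem' {χ χ'} h h' a := by
    rw [Finsupp.coe_add, fStar_add, Pi.add_apply, map_add]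
    have h1 := h a
    have h2 := h' a
    linear_combination h1 + h2
  smul_mem' c χ h a := by
    rw [Finsupp.coe_smul, fStar_smul, Pi.smul_apply, map_smul, ← smul_add, h a, smul_zero]

theorem pdC_support_finite (f : ACPE n) :
    {bj : Dep n × MIdx n | pdC (.jet bj.1 bj.2) f ≠ 0}.Finite := by
  have h := (pd_support_finite ((chart n).symm f)).preimage
    (f := fun bj : Dep n × MIdx n => KCoord.jet bj.1 bj.2) (by
      rintro ⟨a, j⟩ _ ⟨b, k⟩ _ h
      simpa using h)
  refine h.subset fun bj hbj h0 => hbj ?_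
  change chart n (pd _ ((chart n).symm f)) = 0
  rw [h0, map_zero]

theorem lin_support_finite (χ : Dep n →₀ ACPE n) (f : Dep n → ACPE n) (a : Dep n) :
    (Function.support fun bj : Dep n × MIdx n =>
      pdC (.jet bj.1 bj.2) (χ a) * DIter bj.2 (f bj.1)).Finite :=
  (pdC_support_finite (χ a)).subset fun bj hbj h => hbj (by simp only [h, zero_mul])

theorem linAdj_support_finite (χ : Dep n →₀ ACPE n) (f : Dep n → ACPE n) (a : Dep n) :
    (Function.support fun bj : Dep n × MIdx n =>
      negDIter bj.2 (f bj.1 * pdC (.jet a bj.2) (χ bj.1))).Finite := by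
  have h : ∀ b, {j : MIdx n | pdC (.jet a j) (χ b) ≠ 0}.Finite := fun b =>
    (pdC_support_finite (χ b)).preimage (f := fun j : MIdx n => (a, j))
      (fun _ _ _ _ h => (Prod.mk.inj h).2)
  refine (χ.support.finite_toSet.biUnion fun b _ => (h b).image (Prod.mk b)).subset ?_
  rintro ⟨b, j⟩ hbj
  have h1 : pdC (.jet a j) (χ b) ≠ 0 := fun h0 => hbj (by simp only [h0, mul_zero, map_zero])
  have h2 : b ∈ χ.support := Finsupp.mem_support_iff.2 fun h0 => h1 (by rw [h0, map_zero])
  exact Set.mem_biUnion (Finset.mem_coe.2 h2) ⟨j, h1, rfl⟩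

/-- The Helmholtz space of finite families `χ` with `χ_* = χ^*`. -/
def Helmholtz (n : ℕ) : Submodule ℝ (Dep n →₀ ACPE n) where
  carrier := {χ | lin χ = linAdj χ}
  zero_mem' := by
    funext f a
    simp [lin, linAdj]
  add_mem' {χ χ'} h h' := by
    funext f a
    have h1 := congrFun (congrFun h f) a
    have h2 := congrFun (congrFun h' f) a
    have h3 : lin (χ + χ') f a = lin χ f a + lin χ' f a := by
      unfold lin
      rw [← finsum_add_distrib (lin_support_finite χ f a) (lin_support_finite χ' f a)]
      simp only [Finsupp.add_apply, map_add, add_mul]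
    have h4 : linAdj (χ + χ') f a = linAdj χ f a + linAdj χ' f a := by
      unfold linAdj
      rw [← finsum_add_distrib (linAdj_support_finite χ f a) (linAdj_support_finite χ' f a)]
      simp only [Finsupp.add_apply, map_add, mul_add]
    rw [h3, h4, h1, h2]
  smul_mem' c χ h := by
    funext f a
    have h1 := congrFun (congrFun h f) a
    have h3 : lin (c • χ) f a = c • lin χ f a := by
      unfold lin
      rw [smul_finsum' c (lin_support_finite χ f a)]
      simp only [Finsupp.smul_apply, map_smul, smul_mul_assoc]
    have h4 : linAdj (c • χ) f a = c • linAdj χ f a := by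
      unfold linAdj
      rw [smul_finsum' c (linAdj_support_finite χ f a)]
      simp only [Finsupp.smul_apply, map_smul, mul_smul_comm]
    rw [h3, h4, h1]

end Variational

end NS

/-! Direction 1 is the index `0`, and $n=m-1$. Split $\omega=\omega'+dx^1\wedge\omega''$ with both
parts free of $dx^1$. Then $d_H(\xi+dx^1\wedge\zeta)=d_\Theta\xi+dx^1\wedge(D_1\xi-d_\Theta\zeta)$,
so $\omega$ is closed iff $d_\Theta\omega'=0$ and $D_1\omega'=d_\Theta\omega''$. This links $H_H^q$
with the kernel of $D_1^q$ and the cokernel of $D_1^{q-1}$, and everything comes down to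
$H^q(\Theta)$ and the action of $D_1$ on it.

In the global coordinates $D_2,\dots,D_m$ act as on a free jet space, with $x^1$ as a parameter. A
vertical form $\sum c_{j,a}\,\delta a_j$ can be rewritten uniquely as $\sum D_j(h_{j,a}\,\delta a)$;
in the coefficients $h$ the total derivative $D_\alpha$ is the shift $j\mapsto j+(\alpha)$
(`symbol_DV`). The vertical differential followed by this rewriting therefore carries $d_\Theta$ to
the Koszul complex of the shifts, which is exact except in top degree, where the obstruction is the
coefficient at $j=0$, that is, the variational derivative (`koszul_exact`). Contracting the Koszul
primitive with the Euler field $E=\sum a_j\partial_{a_j}$ and correcting by $(1+E)^{-1}$, which is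
an average over scalings of the jets, leaves a form whose coefficients depend on $x$ only
(`theta_reduce`); the Poincaré lemma in $x^2,\dots,x^m$ removes that (`theta_exact`).

Hence $H^q(\Theta)=0$ for $1\le q\le m-2$, $H^0(\Theta)$ consists of functions of $x^1$, and
$H^{m-1}(\Theta)$ embeds by variational derivatives. Below the top degree $D_1$ is onto on
$H^q(\Theta)$, in degree 0 by integration in $x^1$. So $H_H^q\to\ker D_1^q$ is injective for $q\le
m-1$ (`mem_coboundaries_of_tailPart`), and in degree $m$ only the cokernel of $D_1^{m-1}$ survives.

In degree $m-1$ the image of the variational derivative is the Helmholtz space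
(`varD_mem_Helmholtz`, `exists_varD_eq`). The commutator of the variational derivative with an
evolutionary field (`varD_evol`) turns $D_1$ into $D_1+f^*$ (`varClass_D1`), so $\ker D_1^{m-1}$
corresponds to $\mathcal S\cap\mathcal H$. -/

namespace NS

open scoped ContDiff

/-! ## Analysis of functions of finite order -/

/-! ### Smooth dependence of an integral on parameters. -/

section ParametricIntegral

variable {E : Type*} [NormedAddCommGroup E] [NormedSpace ℝ E] [FiniteDimensional ℝ E]

/-- In finite dimension the closed unit ball times $[0,1]$ is compact, so the derivative of the
integrand has a constant bound there and dominated differentiation applies. -/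
theorem hasFDerivAt_parametric_integral {g : E × ℝ → ℝ} (hg : ContDiff ℝ 1 g) (x₀ : E) :
    HasFDerivAt (fun x => ∫ t in (0 : ℝ)..1, g (x, t))
      (∫ t in (0 : ℝ)..1, (fderiv ℝ g (x₀, t)).comp (ContinuousLinearMap.inl ℝ E ℝ)) x₀ := by
  have : ProperSpace E := FiniteDimensional.proper ℝ E
  set F' : E → ℝ → E →L[ℝ] ℝ := fun x t =>
    (fderiv ℝ g (x, t)).comp (ContinuousLinearMap.inl ℝ E ℝ) with hF'
  have hF'c : Continuous (fun p : E × ℝ => F' p.1 p.2) :=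
    (hg.continuous_fderiv one_ne_zero).clm_comp continuous_const
  obtain ⟨C, hC⟩ := ((isCompact_closedBall x₀ 1).prod (isCompact_Icc (a := (0 : ℝ)) (b := 1))
    ).exists_bound_of_continuousOn hF'c.continuousOn
  have hgc : ∀ x, Continuous fun t : ℝ => g (x, t) := fun x => hg.continuous.comp (by fun_prop)
  refine intervalIntegral.hasFDerivAt_integral_of_dominated_of_fderiv_le (F' := F')
    (bound := fun _ => C) (Metric.closedBall_mem_nhds x₀ one_pos)
    (Filter.Eventually.of_forall fun x => (hgc x).aestronglyMeasurable)
    ((hgc x₀).intervalIntegrable _ _)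
    (Continuous.aestronglyMeasurable (hF'c.comp (by fun_prop : Continuous fun t : ℝ => (x₀, t))))
    (Filter.Eventually.of_forall fun t ht x hx => hC (x, t) ⟨hx, ?_⟩)
    intervalIntegrable_const
    (Filter.Eventually.of_forall fun t _ x _ => ?_)
  · rw [Set.uIoc_of_le zero_le_one] at ht
    exact ⟨ht.1.le, ht.2⟩
  · have h1 : HasFDerivAt g (fderiv ℝ g (x, t)) (x, t) :=
      (hg.differentiable one_ne_zero _).hasFDerivAt
    exact h1.comp x (hasFDerivAt_prodMk_left x t)

/-- The derivative in a fixed direction is again such an integral with a smooth integrand, which is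
why the induction on the order generalizes over `g`. -/
theorem contDiff_parametric_integral {g : E × ℝ → ℝ} (hg : ContDiff ℝ ∞ g) :
    ContDiff ℝ ∞ (fun x => ∫ t in (0 : ℝ)..1, g (x, t)) := by
  refine contDiff_infty.2 fun N => ?_
  induction N generalizing g with
  | zero =>
    exact contDiff_zero.2 (continuous_iff_continuousAt.2 fun x =>
      (hasFDerivAt_parametric_integral (hg.of_le (by simp)) x).continuousAt)
  | succ N ih =>
    have h1 : ContDiff ℝ 1 g := hg.of_le (by simp)
    have hd := hasFDerivAt_parametric_integral h1
    have hs : ContDiff ℝ ((N : WithTop ℕ∞) + 1) (fun x => ∫ t in (0 : ℝ)..1, g (x, t)) := by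
      refine contDiff_succ_iff_fderiv.2 ⟨fun x => (hd x).differentiableAt, by simp, ?_⟩
      rw [contDiff_clm_apply_iff]
      intro v
      have hv : ContDiff ℝ ∞ (fun p => fderiv ℝ g p (v, 0)) :=
        (hg.fderiv_right (by simp)).clm_apply contDiff_const
      convert ih hv using 2 with x
      rw [(hd x).fderiv, ContinuousLinearMap.intervalIntegral_apply]
      · simp
      · refine Continuous.intervalIntegrable ?_ _ _
        exact ((h1.continuous_fderiv one_ne_zero).comp
          (by fun_prop : Continuous fun t : ℝ => (x, t))).clm_comp continuous_const
    exact_mod_cast hs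

end ParametricIntegral

/-! ### Scalings of coordinates, Euler fields and primitives. -/

section Scaling

variable {ι : Type*}

open Classical in
/-- Multiplication of the coordinates in `P` by `t`. -/
def scale (P : Set ι) (t : ℝ) (z : ι → ℝ) (i : ι) : ℝ := if i ∈ P then t * z i else z i

theorem scale_one (P : Set ι) (z : ι → ℝ) : scale P 1 z = z := by
  funext i; simp [scale]

theorem scale_scale (P : Set ι) (s t : ℝ) (z : ι → ℝ) :
    scale P t (scale P s z) = scale P (t * s) z := by
  funext i
  by_cases h : i ∈ P <;> simp [scale, h, mul_assoc]

open Classical in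
/-- The infinitesimal generator of the scaling of the coordinates in `P`. -/
def eulerField (P : Set ι) : Derivation ℝ (FinSmooth ι) (FinSmooth ι) :=
  vectorField fun i => if i ∈ P then coord i else 0

/-- The scaling orbit is an integral curve of $t^{-1}E$. The factor comes from expressing the
velocity $z_i$ through the point $tz_i$ reached at time $t$, hence `t ≠ 0`. -/
theorem hasDerivAt_scale (P : Set ι) (f : FinSmooth ι) (z : ι → ℝ) {t : ℝ} (ht : t ≠ 0) :
    HasDerivAt (fun τ => f.1 (scale P τ z)) (t⁻¹ * (eulerField P f).1 (scale P t z)) t := by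
  classical
  have h := hasDerivAt_curve (fun i => t⁻¹ • if i ∈ P then coord i else 0) f
    (c := fun τ => scale P τ z) (t := t) (fun i => by
      by_cases hi : i ∈ P
      · simpa [scale, hi, coord, ht] using (hasDerivAt_id' t).mul_const (z i)
      · simpa [scale, hi] using hasDerivAt_const t (z i))
  convert h using 1
  rw [vectorField_apply, eulerField, vectorField_apply]
  simp only [smul_mul_assoc]
  rw [← smul_finsum' t⁻¹ ((pd_support_finite f).subset fun i hi h => hi (by simp [h]))]
  rfl

theorem continuous_scale (P : Set ι) (f : FinSmooth ι) (z : ι → ℝ) :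
    Continuous (fun τ => f.1 (scale P τ z)) := by
  obtain ⟨s, g, hg, hfg⟩ := f.2
  simp only [hfg]
  refine hg.continuous.comp (continuous_pi fun i => ?_)
  unfold scale
  split_ifs <;> fun_prop

/-- The average `∫₀¹ f (scale t z) dt`. -/
def scaleMean (P : Set ι) (f : FinSmooth ι) : FinSmooth ι :=
  ⟨fun z => ∫ t in (0 : ℝ)..1, f.1 (scale P t z), by
    classical
    obtain ⟨s, g, hg, hfg⟩ := f.2
    refine ⟨s, fun y => ∫ t in (0 : ℝ)..1, g (fun i => if (i : ι) ∈ P then t * y i else y i), ?_,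
      fun z => by simp only [hfg, scale]⟩
    refine contDiff_parametric_integral
      (g := fun p : (s → ℝ) × ℝ => g (fun i => if (i : ι) ∈ P then p.2 * p.1 i else p.1 i)) ?_
    refine hg.comp (contDiff_pi.2 fun i => ?_)
    split_ifs <;> fun_prop⟩

/-- Substitution gives $s\,\bar f(sz)=\int_0^s f(tz)\,dt$ for the mean $\bar f$; differentiate both
sides at $s=1$. Inverting $1+E$ instead of $E$ avoids dividing by $t$, so no vanishing of $f$ is
needed. -/
theorem add_eulerField_scaleMean (P : Set ι) (f : FinSmooth ι) :
    scaleMean P f + eulerField P (scaleMean P f) = f := by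
  refine finSmooth_ext fun z => ?_
  have h1 : ∀ s : ℝ, s * (scaleMean P f).1 (scale P s z)
      = ∫ t in (0 : ℝ)..s, f.1 (scale P t z) := by
    intro s
    have := intervalIntegral.smul_integral_comp_mul_right (a := 0) (b := 1)
      (fun t => f.1 (scale P t z)) s
    simp only [smul_eq_mul, zero_mul, one_mul] at this
    rw [← this]
    simp only [scaleMean, scale_scale]
  have h2 := (hasDerivAt_id' (1 : ℝ)).mul (hasDerivAt_scale P (scaleMean P f) z one_ne_zero)
  have h3 : HasDerivAt (fun s : ℝ => ∫ t in (0 : ℝ)..s, f.1 (scale P t z))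
      (f.1 (scale P 1 z)) 1 :=
    intervalIntegral.integral_hasDerivAt_right ((continuous_scale P f z).intervalIntegrable _ _)
      (continuous_scale P f z).stronglyMeasurable.stronglyMeasurableAtFilter
      (continuous_scale P f z).continuousAt
  have h4 := (h3.congr_of_eventuallyEq (Filter.Eventually.of_forall h1)).unique h2
  simp only [scale_one, inv_one, one_mul] at h4
  exact h4.symm

/-- The function $\tau\mapsto\tau f(\tau z)$ has zero derivative on $(0,1)$ and vanishes at $0$, so
the mean value theorem makes it vanish at $1$. -/
theorem eq_zero_of_add_eulerField (P : Set ι) {f : FinSmooth ι} (hf : f + eulerField P f = 0) :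
    f = 0 := by
  refine finSmooth_ext fun z => ?_
  have hz : ∀ w, f.1 w + (eulerField P f).1 w = 0 := fun w => congrArg (fun g => g.1 w) hf
  have h2 : ∀ t ∈ Set.Ioo (0 : ℝ) 1, HasDerivAt (fun τ => τ * f.1 (scale P τ z)) 0 t := by
    intro t ht
    have h := (hasDerivAt_id' t).mul (hasDerivAt_scale P f z ht.1.ne')
    rw [mul_inv_cancel_left₀ ht.1.ne', one_mul, hz] at h
    exact h
  have hc : ContinuousOn (fun τ => τ * f.1 (scale P τ z)) (Set.Icc 0 1) :=
    (continuous_id.mul (continuous_scale P f z)).continuousOn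
  obtain ⟨c, hcm, hc'⟩ := exists_hasDerivAt_eq_slope _ (fun _ => 0) zero_lt_one hc h2
  simp only [scale_one] at hc'
  change f.1 z = 0
  linarith

theorem pd_vectorField (a : ι → FinSmooth ι) (k : ι) (f : FinSmooth ι) :
    pd k (vectorField a f) = vectorField a (pd k f) + vectorField (fun i => pd k (a i)) f := by
  classical
  set s := (pd_support_finite f).toFinset
  have hs : ∀ i ∉ s, pd i f = 0 := fun i hi => by simpa [s] using hi
  have hs' : ∀ i ∉ s, pd i (pd k f) = 0 := fun i hi => by rw [pd_comm, hs i hi, map_zero]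
  rw [vectorField_eq_sum _ f hs, vectorField_eq_sum _ f hs, vectorField_eq_sum _ _ hs', map_sum,
    ← Finset.sum_add_distrib]
  refine Finset.sum_congr rfl fun i _ => ?_
  rw [Derivation.leibniz, pd_comm k i, smul_eq_mul, smul_eq_mul, mul_comm (pd i f)]

theorem pd_ite_coord (P : Set ι) [DecidablePred (· ∈ P)] [DecidableEq ι] (k i : ι) :
    pd k ((if i ∈ P then coord i else 0 : FinSmooth ι))
      = if i = k ∧ k ∈ P then 1 else 0 := by
  split_ifs with h1 h2 h2
  · rw [pd_coord, if_pos h2.1]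
  · rw [pd_coord, if_neg]; rintro rfl; exact h2 ⟨rfl, h1⟩
  · exact absurd (h2.1 ▸ h2.2) h1
  · exact map_zero _

theorem pd_eulerField_of_mem {P : Set ι} {k : ι} (hk : k ∈ P) (f : FinSmooth ι) :
    pd k (eulerField P f) = pd k f + eulerField P (pd k f) := by
  classical
  rw [eulerField, pd_vectorField, add_comm]
  congr 1
  rw [vectorField_apply, finsum_eq_single _ k]
  · simp [hk, pd_coord]
  · intro i hi
    rw [pd_ite_coord, if_neg (fun h => hi h.1), zero_mul]

theorem pd_eulerField_of_notMem {P : Set ι} {k : ι} (hk : k ∉ P) (f : FinSmooth ι) :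
    pd k (eulerField P f) = eulerField P (pd k f) := by
  classical
  rw [eulerField, pd_vectorField]
  rw [vectorField_apply (fun i => _) f, finsum_eq_zero_of_forall_eq_zero, add_zero]
  intro i
  rw [pd_ite_coord, if_neg (fun h => hk h.2), zero_mul]

/-- Since $[\partial_k,E]=\partial_k$, the function $\partial_kf$ is in the kernel of $1+E$, which
is trivial. -/
theorem pd_eq_zero_of_eulerField {P : Set ι} {f : FinSmooth ι} (hf : eulerField P f = 0) {k : ι}
    (hk : k ∈ P) : pd k f = 0 :=
  eq_zero_of_add_eulerField P (by rw [← pd_eulerField_of_mem hk, hf, map_zero])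

/-- The primitive is $z_i\int_0^1 f(\dots,tz_i,\dots)\,dt$. Preserving independence of the other
coordinates is what the Poincaré lemma, one variable at a time, requires. -/
theorem exists_pd_eq (i : ι) (f : FinSmooth ι) :
    ∃ F : FinSmooth ι, pd i F = f ∧ ∀ k, k ≠ i → pd k f = 0 → pd k F = 0 := by
  classical
  set G := scaleMean {i} f
  have hGf : G + eulerField {i} G = f := add_eulerField_scaleMean _ f
  refine ⟨coord i * G, ?_, fun k hki hk => ?_⟩
  · rw [Derivation.leibniz, pd_coord, if_pos rfl, ← hGf, eulerField, vectorField_apply,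
      finsum_eq_single _ i]
    · simp [add_comm]
    · intro k hk; simp [hk]
  -- For `k ≠ i` the derivative `pd k` commutes with the Euler field of `{i}`, so it sends $G+EG=f$
  -- to a homogeneous equation.
  · have : pd k G = 0 := eq_zero_of_add_eulerField {i} (by
      rw [← pd_eulerField_of_notMem (by simpa using hki), ← map_add, hGf, hk])
    rw [Derivation.leibniz, this, pd_coord, if_neg (Ne.symm hki)]
    simp

/-- Such a function is constant along every ray from the origin, hence equal to its value there. -/
theorem eq_algebraMap_of_pd_eq_zero {f : FinSmooth ι} (hf : ∀ k, pd k f = 0) :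
    ∃ c : ℝ, f = algebraMap ℝ (FinSmooth ι) c := by
  refine ⟨f.1 0, finSmooth_ext fun z => ?_⟩
  have h : ∀ t, HasDerivAt (fun τ : ℝ => f.1 (τ • z)) 0 t := by
    intro t
    have := hasDerivAt_curve (fun i => algebraMap ℝ _ (z i)) f (c := fun τ => τ • z) (t := t)
      (fun i => by simpa using (hasDerivAt_id' t).mul_const (z i))
    rwa [vectorField_eq_sum _ f (s := ∅) fun i _ => hf i] at this
  have := is_const_of_deriv_eq_zero (fun t => (h t).differentiableAt) (fun t => (h t).deriv) 1 0
  simpa using this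

end Scaling

end NS

namespace NS

/-! ## Exactness of complexes of forms -/

/-! ### Splitting a form along the first direction. -/

section FormParts

variable {A : Type*} {n : ℕ}

/-- The part of a form free of `dx^0`. -/
def tailPart (ω : Form (Fin (n + 1)) A) : Form (Fin n) A := fun s => ω (s.map (Fin.succEmb n))

/-- The form `ω''` in the decomposition `ω = ω' + dx^0 ∧ ω''`. -/
def headPart (ω : Form (Fin (n + 1)) A) : Form (Fin n) A :=
  fun s => ω (insert 0 (s.map (Fin.succEmb n)))

/-- The form `ω' + dx^0 ∧ ω''`. -/
def consForm (ω' ω'' : Form (Fin n) A) : Form (Fin (n + 1)) A := fun s =>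
  if 0 ∈ s then ω'' (Finset.univ.filter fun α => α.succ ∈ s)
  else ω' (Finset.univ.filter fun α => α.succ ∈ s)

theorem zero_notMem_map_succ (s : Finset (Fin n)) : (0 : Fin (n + 1)) ∉ s.map (Fin.succEmb n) := by
  simp [Fin.succ_ne_zero]

@[simp] theorem tailPart_consForm (ω' ω'' : Form (Fin n) A) : tailPart (consForm ω' ω'') = ω' := by
  funext s
  simp [tailPart, consForm, Fin.succ_ne_zero]

@[simp] theorem headPart_consForm (ω' ω'' : Form (Fin n) A) : headPart (consForm ω' ω'') = ω'' := by
  funext s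
  simp [headPart, consForm, Fin.succ_ne_zero]

theorem eq_map_or_eq_insert (s : Finset (Fin (n + 1))) :
    ∃ t : Finset (Fin n), s = t.map (Fin.succEmb n) ∨ s = insert 0 (t.map (Fin.succEmb n)) := by
  refine ⟨Finset.univ.filter fun α => α.succ ∈ s, ?_⟩
  by_cases h : 0 ∈ s
  · right
    ext μ
    refine Fin.cases ?_ (fun α => ?_) μ <;> simp [h, Fin.succ_ne_zero]
  · left
    ext μ
    refine Fin.cases ?_ (fun α => ?_) μ <;> simp [h, Fin.succ_ne_zero]

theorem form_ext {ω η : Form (Fin (n + 1)) A} (h : tailPart ω = tailPart η)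
    (h' : headPart ω = headPart η) : ω = η := by
  funext s
  obtain ⟨t, rfl | rfl⟩ := eq_map_or_eq_insert s
  · exact congrFun h t
  · exact congrFun h' t

end FormParts

/-! ### The differential in terms of the two parts. -/

section FormCalculus

variable {A B : Type*} [AddCommGroup A] [Module ℝ A] [AddCommGroup B] [Module ℝ B] {n : ℕ}

theorem dForm_apply {ι : Type*} [LinearOrder ι] (D : ι → A →ₗ[ℝ] A) (ω : Form ι A) (s : Finset ι) :
    dForm D ω s = ∑ μ ∈ s, (-1 : ℝ) ^ (s.filter (· < μ)).card • D μ (ω (s.erase μ)) := rfl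

theorem dForm_map {ι : Type*} [LinearOrder ι] {D : ι → A →ₗ[ℝ] A} {D' : ι → B →ₗ[ℝ] B}
    {T : A → B} (hT : IsLinearMap ℝ T) (h : ∀ μ a, D' μ (T a) = T (D μ a)) (ω : Form ι A) :
    dForm D' (fun s => T (ω s)) = fun s => T (dForm D ω s) := by
  funext s
  have := map_sum hT.mk' (fun μ => (-1 : ℝ) ^ (s.filter (· < μ)).card • D μ (ω (s.erase μ))) s
  simp only [IsLinearMap.mk'_apply] at this
  simp only [dForm_apply, this, h, hT.map_smul]

theorem formsOfDegree_map {ι : Type*} {q : ℤ} {ω : Form ι A} (hω : ω ∈ formsOfDegree q)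
    {T : A → B} (hT : T 0 = 0) : (fun s => T (ω s)) ∈ formsOfDegree q := fun s hs => by
  simp only [hω s hs, hT]

theorem eq_zero_of_mem_formsOfDegree {ι : Type*} {q : ℤ} {ω : Form ι A}
    (hω : ω ∈ formsOfDegree q) (hq : q < 0) : ω = 0 :=
  funext fun s => hω s (by omega)

theorem dForm_mem_formsOfDegree {ι : Type*} [LinearOrder ι] (D : ι → A →ₗ[ℝ] A) {q : ℤ}
    {ω : Form ι A} (hω : ω ∈ formsOfDegree (q - 1)) : dForm D ω ∈ formsOfDegree q := by
  intro s hs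
  refine Finset.sum_eq_zero fun μ hμ => ?_
  rw [hω _ ?_, map_zero, smul_zero]
  rw [Finset.card_erase_of_mem hμ]
  have := Finset.card_pos.2 ⟨μ, hμ⟩
  omega

theorem mem_formsOfDegree_iff_parts {q : ℤ} {ω : Form (Fin (n + 1)) A} :
    ω ∈ formsOfDegree q ↔
      tailPart ω ∈ formsOfDegree q ∧ headPart ω ∈ formsOfDegree (q - 1) := by
  constructor
  · refine fun h => ⟨fun t ht => h _ (by simpa using ht), fun t ht => h _ ?_⟩
    rw [Finset.card_insert_of_notMem (zero_notMem_map_succ t), Finset.card_map]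
    push_cast; omega
  · rintro ⟨h1, h2⟩ s hs
    obtain ⟨t, rfl | rfl⟩ := eq_map_or_eq_insert s
    · exact h1 t (by simpa using hs)
    · rw [Finset.card_insert_of_notMem (zero_notMem_map_succ t), Finset.card_map] at hs
      push_cast at hs
      exact h2 t (by omega)

theorem consForm_mem_formsOfDegree {q : ℤ} {ω' ω'' : Form (Fin n) A}
    (h : ω' ∈ formsOfDegree q) (h' : ω'' ∈ formsOfDegree (q - 1)) :
    consForm ω' ω'' ∈ formsOfDegree q :=
  mem_formsOfDegree_iff_parts.2 ⟨by simpa using h, by simpa using h'⟩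

theorem tailPart_dForm (D : Fin (n + 1) → A →ₗ[ℝ] A) (ω : Form (Fin (n + 1)) A) :
    tailPart (dForm D ω) = dForm (fun α => D α.succ) (tailPart ω) := by
  funext t
  simp only [tailPart, dForm_apply, Finset.sum_map]
  refine Finset.sum_congr rfl fun α _ => ?_
  rw [Finset.map_erase, Finset.filter_map, Finset.card_map]
  simp [Function.comp_def]

/-- The index `0` precedes every successor and raises the exponent of its sign by one, hence the
minus before the second term; the term of `0` itself has sign $+$. -/
theorem headPart_dForm (D : Fin (n + 1) → A →ₗ[ℝ] A) (ω : Form (Fin (n + 1)) A) :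
    headPart (dForm D ω)
      = (fun s => D 0 (tailPart ω s)) - dForm (fun α => D α.succ) (headPart ω) := by
  funext t
  simp only [headPart, tailPart, dForm_apply, Pi.sub_apply]
  rw [Finset.sum_insert (zero_notMem_map_succ t), Finset.erase_insert (zero_notMem_map_succ t),
    Finset.filter_false_of_mem (by simp), Finset.sum_map, sub_eq_add_neg, ← Finset.sum_neg_distrib]
  simp only [Finset.card_empty, pow_zero, one_smul]
  congr 1
  refine Finset.sum_congr rfl fun α _ => ?_
  have h0 : (0 : Fin (n + 1)) < Fin.succEmb n α := Fin.succ_pos α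
  rw [Finset.erase_insert_of_ne h0.ne, Finset.map_erase, Finset.filter_insert, if_pos h0,
    Finset.card_insert_of_notMem (fun h => zero_notMem_map_succ t (Finset.mem_filter.1 h).1),
    Finset.filter_map, Finset.card_map,
    pow_succ]
  simp [Function.comp_def]

theorem dForm_consForm (D : Fin (n + 1) → A →ₗ[ℝ] A) (ω' ω'' : Form (Fin n) A) :
    dForm D (consForm ω' ω'') = consForm (dForm (fun α => D α.succ) ω')
      ((fun s => D 0 (ω' s)) - dForm (fun α => D α.succ) ω'') :=
  form_ext (by simp [tailPart_dForm]) (by simp [headPart_dForm])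

theorem dForm_fin_zero (D : Fin 0 → A →ₗ[ℝ] A) (ω : Form (Fin 0) A) : dForm D ω = 0 := by
  funext s
  rw [dForm_apply, Finset.eq_empty_of_isEmpty s, Finset.sum_empty]
  rfl

/-- By induction on the number of directions, the only surviving terms are $D_0d\omega'$ and
$dD_0\omega'$, which cancel because the operators commute. -/
theorem dForm_dForm : ∀ {n : ℕ} {D : Fin n → A →ₗ[ℝ] A}
    (_ : ∀ μ ν a, D μ (D ν a) = D ν (D μ a)) (ω : Form (Fin n) A), dForm D (dForm D ω) = 0
  | 0, _, _, _ => dForm_fin_zero _ _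
  | n + 1, D, h, ω => by
    have ih := dForm_dForm (D := fun α => D α.succ) (fun _ _ a => h _ _ a)
    refine form_ext ?_ ?_
    · rw [tailPart_dForm, tailPart_dForm, ih]; rfl
    · rw [headPart_dForm, headPart_dForm, tailPart_dForm, map_sub, ih,
        dForm_map (D 0).isLinear (fun α a => h α.succ 0 a)]
      simp only [sub_zero, sub_self]; rfl

/-- The second equation exhibits $\omega''$ as a primitive of $D_0\omega'$; it is the source of the
condition on $\ker D_1$. -/
theorem closed_iff_parts {D : Fin (n + 1) → A →ₗ[ℝ] A} {ω : Form (Fin (n + 1)) A} :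
    dForm D ω = 0 ↔ dForm (fun α => D α.succ) (tailPart ω) = 0 ∧
      (fun s => D 0 (tailPart ω s)) = dForm (fun α => D α.succ) (headPart ω) := by
  constructor
  · intro h
    refine ⟨by rw [← tailPart_dForm, h]; rfl, ?_⟩
    rw [← sub_eq_zero, ← headPart_dForm, h]; rfl
  · rintro ⟨h1, h2⟩
    exact form_ext (by rw [tailPart_dForm, h1]; rfl) (by rw [headPart_dForm, h2, sub_self]; rfl)

theorem univ_eq_insert_map_succ :
    (Finset.univ : Finset (Fin (n + 1))) = insert 0 (Finset.univ.map (Fin.succEmb n)) := by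
  ext μ
  refine Fin.cases ?_ (fun α => ?_) μ <;> simp

end FormCalculus

/-! ### The Koszul complex of the index shifts. -/

section Koszul

variable {B : Type*} [AddCommGroup B] [Module ℝ B]

/-- The shift of multi-indices by `(α)`. -/
def shiftIdx {n : ℕ} (α : Fin n) : (MIdx n →₀ B) →ₗ[ℝ] (MIdx n →₀ B) :=
  Finsupp.lmapDomain B ℝ (· + e α)

@[simp] theorem shiftIdx_single {n : ℕ} (α : Fin n) (j : MIdx n) (b : B) :
    shiftIdx α (Finsupp.single j b) = Finsupp.single (j + e α) b := by
  simp [shiftIdx, Finsupp.mapDomain_single]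

theorem shiftIdx_apply_zero {n : ℕ} (α : Fin n) (h : MIdx n →₀ B) : shiftIdx α h 0 = 0 :=
  Finsupp.mapDomain_of_notMem_range _ _ fun ⟨j, hj⟩ => by
    have := congrFun hj α
    simp at this

theorem shiftIdx_apply_add {n : ℕ} (α : Fin n) (h : MIdx n →₀ B) (j : MIdx n) :
    shiftIdx α h (j + e α) = h j :=
  Finsupp.mapDomain_apply (add_left_injective (e α)) h j

theorem shiftIdx_comm {n : ℕ} (α β : Fin n) (h : MIdx n →₀ B) :
    shiftIdx α (shiftIdx β h) = shiftIdx β (shiftIdx α h) := by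
  induction h using Finsupp.induction_linear with
  | zero => simp
  | add f g hf hg => simp only [map_add, hf, hg]
  | single j b => simp only [shiftIdx_single, add_right_comm]

theorem cons_injective {n : ℕ} : Function.Injective (fun j : MIdx n => (Fin.cons 0 j : MIdx (n + 1))) :=
  fun _ _ h => (Fin.cons_injective2 h).2

/-- Extension of multi-indices by zero in the first direction. -/
def embIdx (n : ℕ) : (MIdx n →₀ B) →ₗ[ℝ] (MIdx (n + 1) →₀ B) :=
  Finsupp.lmapDomain B ℝ (fun j => Fin.cons 0 j)

/-- The coefficients with vanishing first index. -/
def projIdx (n : ℕ) : (MIdx (n + 1) →₀ B) →ₗ[ℝ] (MIdx n →₀ B) :=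
  Finsupp.lcomapDomain _ cons_injective

/-- The left inverse of the shift in the first direction. -/
def unshiftIdx (n : ℕ) : (MIdx (n + 1) →₀ B) →ₗ[ℝ] (MIdx (n + 1) →₀ B) :=
  Finsupp.lcomapDomain (· + e 0) (add_left_injective (e 0))

theorem embIdx_single {n : ℕ} (j : MIdx n) (b : B) :
    embIdx n (Finsupp.single j b) = Finsupp.single (Fin.cons 0 j) b := by
  simp [embIdx, Finsupp.mapDomain_single]

theorem projIdx_apply {n : ℕ} (h : MIdx (n + 1) →₀ B) (j : MIdx n) :
    projIdx n h j = h (Fin.cons 0 j) := rfl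

theorem unshiftIdx_apply {n : ℕ} (h : MIdx (n + 1) →₀ B) (j : MIdx (n + 1)) :
    unshiftIdx n h j = h (j + e 0) := rfl

theorem unshiftIdx_single_add {n : ℕ} (j : MIdx (n + 1)) (b : B) :
    unshiftIdx n (Finsupp.single (j + e 0) b) = Finsupp.single j b := by
  ext i
  classical
  simp only [unshiftIdx_apply, Finsupp.single_apply, add_left_inj]

theorem unshiftIdx_single_cons {n : ℕ} (j : MIdx n) (b : B) :
    unshiftIdx n (Finsupp.single (Fin.cons 0 j) b) = 0 := by
  ext i
  classical
  rw [unshiftIdx_apply, Finsupp.single_apply, if_neg]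
  · rfl
  · intro h
    simpa using congrFun h 0

theorem projIdx_single_cons {n : ℕ} (j : MIdx n) (b : B) :
    projIdx n (Finsupp.single (Fin.cons 0 j) b) = Finsupp.single j b := by
  ext i
  classical
  simp only [projIdx_apply, Finsupp.single_apply]
  congr 1
  exact propext ⟨fun h => cons_injective h, fun h => by rw [h]⟩

theorem projIdx_single_add {n : ℕ} (j : MIdx (n + 1)) (b : B) :
    projIdx n (Finsupp.single (j + e 0) b) = 0 := by
  ext i
  classical
  rw [projIdx_apply, Finsupp.single_apply, if_neg]
  · rfl
  · intro h
    simpa using congrFun h 0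

theorem eq_cons_or_eq_add {n : ℕ} (j : MIdx (n + 1)) :
    (∃ i : MIdx n, j = Fin.cons 0 i) ∨ ∃ i : MIdx (n + 1), j = i + e 0 := by
  obtain ⟨k, i, rfl⟩ : ∃ k i, j = Fin.cons k i := ⟨j 0, Fin.tail j, (Fin.cons_self_tail j).symm⟩
  rcases k with _ | k
  · exact .inl ⟨i, rfl⟩
  · exact .inr ⟨Fin.cons k i, (cons_add_e_zero k i).symm⟩

/-- If multi-indices are read as exponents, the shifts are multiplications by variables, and this is
division with remainder by the first variable. -/
theorem shiftIdx_unshiftIdx_add {n : ℕ} (h : MIdx (n + 1) →₀ B) :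
    shiftIdx 0 (unshiftIdx n h) + embIdx n (projIdx n h) = h := by
  induction h using Finsupp.induction_linear with
  | zero => simp
  | add f g hf hg =>
    nth_rw 3 [← hf, ← hg]
    simp only [map_add]
    abel
  | single j b =>
    obtain ⟨i, rfl⟩ | ⟨i, rfl⟩ := eq_cons_or_eq_add j
    · rw [unshiftIdx_single_cons, projIdx_single_cons, embIdx_single, map_zero, zero_add]
    · rw [unshiftIdx_single_add, projIdx_single_add, shiftIdx_single, map_zero, add_zero]

theorem unshiftIdx_shiftIdx_zero {n : ℕ} (h : MIdx (n + 1) →₀ B) :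
    unshiftIdx n (shiftIdx 0 h) = h :=
  Finsupp.ext fun j => shiftIdx_apply_add 0 h j

theorem projIdx_shiftIdx_zero {n : ℕ} (h : MIdx (n + 1) →₀ B) : projIdx n (shiftIdx 0 h) = 0 := by
  induction h using Finsupp.induction_linear with
  | zero => simp
  | add f g hf hg => simp only [map_add, hf, hg, add_zero]
  | single j b => rw [shiftIdx_single, projIdx_single_add]

theorem unshiftIdx_shiftIdx_succ {n : ℕ} (α : Fin n) (h : MIdx (n + 1) →₀ B) :
    unshiftIdx n (shiftIdx α.succ h) = shiftIdx α.succ (unshiftIdx n h) := by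
  induction h using Finsupp.induction_linear with
  | zero => simp
  | add f g hf hg => simp only [map_add, hf, hg]
  | single j b =>
    obtain ⟨i, rfl⟩ | ⟨i, rfl⟩ := eq_cons_or_eq_add j
    · rw [shiftIdx_single, cons_add_e_succ, unshiftIdx_single_cons, unshiftIdx_single_cons, map_zero]
    · rw [shiftIdx_single, add_right_comm, unshiftIdx_single_add, unshiftIdx_single_add,
        shiftIdx_single]

theorem projIdx_shiftIdx_succ {n : ℕ} (α : Fin n) (h : MIdx (n + 1) →₀ B) :
    projIdx n (shiftIdx α.succ h) = shiftIdx α (projIdx n h) := by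
  induction h using Finsupp.induction_linear with
  | zero => simp
  | add f g hf hg => simp only [map_add, hf, hg]
  | single j b =>
    obtain ⟨i, rfl⟩ | ⟨i, rfl⟩ := eq_cons_or_eq_add j
    · rw [shiftIdx_single, cons_add_e_succ, projIdx_single_cons, projIdx_single_cons,
        shiftIdx_single]
    · rw [shiftIdx_single, add_right_comm, projIdx_single_add, projIdx_single_add, map_zero]

theorem embIdx_shiftIdx {n : ℕ} (α : Fin n) (h : MIdx n →₀ B) :
    embIdx n (shiftIdx α h) = shiftIdx α.succ (embIdx n h) := by
  induction h using Finsupp.induction_linear with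
  | zero => simp
  | add f g hf hg => simp only [map_add, hf, hg]
  | single j b => rw [shiftIdx_single, embIdx_single, embIdx_single, shiftIdx_single, cons_add_e_succ]

/-- Exactness of the Koszul complex of the shifts: the cohomology is concentrated in top degree,
where it is detected by the coefficient at the zero multi-index. -/
theorem koszul_exact : ∀ {n : ℕ} {q : ℤ} {ω : Form (Fin n) (MIdx n →₀ B)},
    ω ∈ formsOfDegree q → dForm shiftIdx ω = 0 → ω Finset.univ 0 = 0 →
      ∃ η ∈ formsOfDegree (q - 1), dForm shiftIdx η = ω
  | 0, q, ω, _, _, h0 => by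
    -- With no directions there is one subset and one multi-index, so the condition on the top
    -- coefficient already says that the form vanishes.
    refine ⟨0, Submodule.zero_mem _, ?_⟩
    rw [map_zero]
    funext s
    refine Finsupp.ext fun j => ?_
    rw [Subsingleton.elim s Finset.univ, Subsingleton.elim j 0, h0]
    rfl
  | n + 1, q, ω, hq, hω, h0 => by
    obtain ⟨hq1, hq2⟩ := mem_formsOfDegree_iff_parts.1 hq
    obtain ⟨-, h2⟩ := closed_iff_parts.1 hω
    -- The remainder of the head part modulo the first variable is closed in one variable fewer,
    -- since its differential is the remainder of a multiple of that variable.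
    obtain ⟨ζ, hζ, hdζ⟩ := koszul_exact (ω := fun s => projIdx n (headPart ω s))
      (formsOfDegree_map hq2 (map_zero _)) (by
        rw [dForm_map (projIdx n).isLinear (fun α a => (projIdx_shiftIdx_succ α a).symm), ← h2]
        funext s
        exact projIdx_shiftIdx_zero _) (by
        rw [projIdx_apply, headPart, ← univ_eq_insert_map_succ]
        convert h0
        funext i
        refine Fin.cases rfl (fun _ => rfl) i)
    -- The quotient of the head part by the first variable becomes the tail of the primitive, and
    -- `ζ` accounts for the remainder. Its sign offsets the minus in `dForm_consForm`.
    refine ⟨consForm (fun s => unshiftIdx n (headPart ω s)) (fun s => - embIdx n (ζ s)),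
      consForm_mem_formsOfDegree (formsOfDegree_map hq2 (map_zero _))
        (formsOfDegree_map hζ (T := fun a => - embIdx n a) (by simp)), ?_⟩
    rw [dForm_consForm]
    refine form_ext ?_ ?_
    · rw [tailPart_consForm, dForm_map (unshiftIdx n).isLinear
        (fun α a => (unshiftIdx_shiftIdx_succ α a).symm), ← h2]
      funext s
      exact unshiftIdx_shiftIdx_zero _
    · rw [headPart_consForm, dForm_map (T := fun a => - embIdx n a) (-embIdx n).isLinear
        (D := shiftIdx) (fun α a => by rw [map_neg, embIdx_shiftIdx]), hdζ]
      funext s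
      rw [Pi.sub_apply, sub_neg_eq_add, shiftIdx_unshiftIdx_add]

end Koszul

/-! ### A Poincaré lemma for commuting operators. -/

section Poincare

/-- If each operator is onto on the joint kernel of the preceding ones, closed forms of positive
degree are exact. Membership of all coefficients in an invariant subspace is kept track of. -/
theorem poincare_exact {A : Type*} [AddCommGroup A] [Module ℝ A] :
    ∀ {n : ℕ} {D : Fin n → A →ₗ[ℝ] A} (_ : ∀ μ ν a, D μ (D ν a) = D ν (D μ a))
      (N : Submodule ℝ A) (_ : ∀ μ, ∀ a ∈ N, D μ a ∈ N)
      (_ : ∀ μ, ∀ a ∈ N, (∀ ν < μ, D ν a = 0) → ∃ b ∈ N, D μ b = a ∧ ∀ ν < μ, D ν b = 0)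
      {q : ℤ} {ω : Form (Fin n) A} (_ : 1 ≤ q) (_ : ω ∈ formsOfDegree q) (_ : dForm D ω = 0)
      (_ : ∀ s, ω s ∈ N), ∃ η ∈ formsOfDegree (q - 1), (∀ s, η s ∈ N) ∧ dForm D η = ω
  | 0, D, _, N, _, _, q, ω, hq, hω, _, _ => by
    refine ⟨0, Submodule.zero_mem _, fun _ => N.zero_mem, ?_⟩
    rw [map_zero]
    funext s
    refine (hω s ?_).symm
    rw [Finset.eq_empty_of_isEmpty s]
    simp; omega
  | n + 1, D, hD, N, hN, hs, q, ω, hq, hω, hd, hωN => by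
    obtain ⟨hq1, hq2⟩ := mem_formsOfDegree_iff_parts.1 hω
    obtain ⟨h1, h2⟩ := closed_iff_parts.1 hd
    choose! I hIN hI _ using fun a (ha : a ∈ N) => hs 0 a ha (fun ν hν => absurd hν (Fin.not_lt_zero ν))
    classical
    -- The chosen preimages `I` need not send $0$ to $0$; the case distinction keeps `α` homogeneous
    -- of degree $q-1$.
    set α : Form (Fin n) A := fun s => if headPart ω s = 0 then 0 else I (headPart ω s) with hα
    have hαN : ∀ s, α s ∈ N := fun s => by
      simp only [hα]
      split_ifs
      · exact N.zero_mem
      · exact hIN _ (hωN _)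
    have hDα : ∀ s, D 0 (α s) = headPart ω s := fun s => by
      simp only [hα]
      split_ifs with h
      · rw [h, map_zero]
      · exact hI _ (hωN _)
    have hαq : α ∈ formsOfDegree (q - 1) := fun s hs => by simp only [hα, hq2 s hs, if_true]
    set D' : Fin n → A →ₗ[ℝ] A := fun α => D α.succ
    have hdN : ∀ {θ : Form (Fin n) A}, (∀ s, θ s ∈ N) → ∀ s, dForm D' θ s ∈ N := fun hθ s =>
      Submodule.sum_mem _ fun μ _ => N.smul_mem _ (hN _ _ (hθ _))
    -- After subtracting $d\alpha$, the tail has coefficients killed by `D 0`. The induction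
    -- therefore runs inside this kernel, on which the next operator is onto by hypothesis; this is
    -- the reason for the subspace `N`.
    obtain ⟨β, hβq, hβN, hdβ⟩ := poincare_exact (D := D') (fun _ _ a => hD _ _ a)
      (N ⊓ LinearMap.ker (D 0))
      (fun μ a ha => ⟨hN _ _ ha.1, LinearMap.mem_ker.2 (by
        rw [hD, LinearMap.mem_ker.1 ha.2, map_zero])⟩)
      (fun μ a ha h => by
        obtain ⟨b, hbN, hb, hb'⟩ := hs μ.succ a ha.1 (fun ν => Fin.cases (fun _ => ha.2)
          (fun γ hγ => h γ (Fin.succ_lt_succ_iff.1 hγ)) ν)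
        exact ⟨b, ⟨hbN, hb' 0 (Fin.succ_pos μ)⟩, hb,
          fun ν hν => hb' _ (Fin.succ_lt_succ_iff.2 hν)⟩)
      (ω := tailPart ω - dForm D' α) hq
      (Submodule.sub_mem _ hq1 (dForm_mem_formsOfDegree _ hαq))
      (by rw [map_sub, h1, dForm_dForm (fun _ _ a => hD _ _ a), sub_zero])
      (fun s => ⟨N.sub_mem (hωN _) (hdN hαN s), by
        have h3 := dForm_map (D 0).isLinear (fun γ a => hD γ.succ 0 a) α
        simp only [hDα] at h3
        change D 0 (tailPart ω s - dForm D' α s) = 0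
        rw [map_sub, ← congrFun h3 s, sub_eq_zero]
        exact congrFun h2 s⟩)
    refine ⟨consForm (α + β) 0, consForm_mem_formsOfDegree (Submodule.add_mem _ hαq hβq)
      (Submodule.zero_mem _), fun s => ?_, ?_⟩
    · unfold consForm
      split_ifs
      · exact N.zero_mem
      · exact N.add_mem (hαN _) (hβN _).1
    · rw [dForm_consForm]
      refine form_ext ?_ ?_
      · rw [tailPart_consForm, map_add, hdβ, add_sub_cancel]
      · rw [headPart_consForm, map_zero, sub_zero]
        funext s
        rw [Pi.add_apply, map_add, hDα, LinearMap.mem_ker.1 (hβN s).2, add_zero]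

end Poincare

/-! ## Calculus in the global coordinates -/

section Calculus

variable {n : ℕ}

theorem toB_injective : Function.Injective (KCoord.toB (n := n)) := by
  rintro (μ | ⟨_ | ⟨α, k⟩ | k, j⟩) (ν | ⟨_ | ⟨β, l⟩ | l, i⟩) h <;>
    simp only [KCoord.toB, BCoord.x.injEq, BCoord.u.injEq, BCoord.p.injEq, reduceCtorEq,
      Fin.cons_inj, Fin.succ_inj, true_and, Fin.succ_ne_zero, (Fin.succ_ne_zero _).symm,
      false_and, Fin.val_inj] at h ⊢
  · rw [h]
  · rw [h]
  · obtain ⟨rfl, rfl, rfl⟩ := h; rfl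
  · obtain ⟨rfl, rfl⟩ := h; rfl

theorem pd_toB_incl (k : KCoord n) (f : FinSmooth (KCoord n)) :
    pd k.toB (incl n f) = incl n (pd k f) := by
  classical
  refine finSmooth_ext fun z => ?_
  change deriv (fun t => f.1 (fun l : KCoord n => Function.update z k.toB t l.toB)) (z k.toB)
    = deriv (fun t => f.1 (Function.update (fun l : KCoord n => z l.toB) k t)) (z k.toB)
  congr 1
  funext t
  refine congrArg f.1 (funext fun l => ?_)
  by_cases h : l = k
  · subst h; simp
  · rw [Function.update_of_ne h, Function.update_of_ne (fun h' => h (toB_injective h'))]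

theorem pd_incl_of_notMem_range {b : BCoord n} (hb : b ∉ Set.range (KCoord.toB (n := n)))
    (f : FinSmooth (KCoord n)) : pd b (incl n f) = 0 := by
  classical
  refine finSmooth_ext fun z => ?_
  have h : ∀ t, (fun l : KCoord n => Function.update z b t l.toB) = fun l => z l.toB :=
    fun t => funext fun l => Function.update_of_ne (fun h => hb ⟨l, h⟩) _ _
  change deriv (fun t => f.1 (fun l : KCoord n => Function.update z b t l.toB)) (z b) = 0
  simp only [h, deriv_const]

theorem chart_apply (f : FinSmooth (KCoord n)) : chart n f = restr n (incl n f) := rfl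

theorem restr_coord (b : BCoord n) : restr n (coord b) = chart n (sig b) := by
  rw [chart_apply]
  exact restr_eq_restr.2 fun z hz => sub_eq_zero.2 (sig_eq hz b).symm

theorem restr_coord_toB (k : KCoord n) : restr n (coord k.toB) = chart n (coord k) := by
  rw [restr_coord, sig_toB]

/-- The total derivatives in global coordinates. -/
theorem D_chart (μ : Fin (n + 1)) (f : FinSmooth (KCoord n)) : D μ (chart n f)
    = chart n (vectorField (fun k => (chart n).symm (restr n (totalCoeff μ k.toB))) f) := by
  classical
  set s := (pd_support_finite f).toFinset
  have hs : ∀ k ∉ s, pd k f = 0 := fun i hi => by simpa [s] using hi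
  rw [vectorField_eq_sum _ f hs, chart_apply, D_restr, totalD,
    vectorField_eq_sum (s := s.image KCoord.toB), Finset.sum_image toB_injective.injOn]
  · simp only [map_sum, map_mul, AlgEquiv.apply_symm_apply, pd_toB_incl, chart_apply]
  · intro b hb
    by_cases h : b ∈ Set.range (KCoord.toB (n := n))
    · obtain ⟨k, rfl⟩ := h
      rw [pd_toB_incl, hs k (fun hk => hb (Finset.mem_image_of_mem _ hk)), map_zero]
    · exact pd_incl_of_notMem_range h f

theorem D_mul (μ : Fin (n + 1)) (f g : ACPE n) : D μ (f * g) = f * D μ g + g * D μ f := by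
  obtain ⟨f, rfl⟩ := restr_surjective n f
  obtain ⟨g, rfl⟩ := restr_surjective n g
  rw [← map_mul, D_restr, Derivation.leibniz, map_add]
  rfl

theorem pdC_chart (k : KCoord n) (f : FinSmooth (KCoord n)) :
    pdC k (chart n f) = chart n (pd k f) := by
  change chart n (pd k ((chart n).symm (chart n f))) = _
  rw [AlgEquiv.symm_apply_apply]

theorem pdC_mul (k : KCoord n) (f g : ACPE n) : pdC k (f * g) = f * pdC k g + g * pdC k f := by
  obtain ⟨f, rfl⟩ := (chart n).surjective f
  obtain ⟨g, rfl⟩ := (chart n).surjective g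
  rw [← map_mul, pdC_chart, pdC_chart, pdC_chart, Derivation.leibniz]
  simp only [smul_eq_mul, map_add, map_mul]

theorem pdC_comm (k l : KCoord n) (f : ACPE n) : pdC k (pdC l f) = pdC l (pdC k f) := by
  obtain ⟨f, rfl⟩ := (chart n).surjective f
  simp only [pdC_chart, pd_comm k l]

/-- The coordinate `a_j`. -/
def jetC (a : Dep n) (j : MIdx n) : ACPE n := chart n (coord (.jet a j))

/-- The jets in the directions $2,\dots,m$ are unconstrained, so these derivatives only shift the
index. This makes the auxiliary complex that of a free jet space. -/
theorem D_jetC (α : Fin n) (a : Dep n) (j : MIdx n) :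
    DTheta α (jetC a j) = jetC a (j + e α) := by
  rw [jetC, DTheta, D_chart, vectorField_coord, AlgEquiv.apply_symm_apply, jetC, ← restr_coord_toB]
  rcases a with _ | ⟨β, k⟩ | k <;> simp only [KCoord.toB, totalCoeff, cons_add_e_succ]

theorem D_eq_vectorField (μ : Fin (n + 1)) (f : FinSmooth (KCoord n)) : D μ (chart n f)
    = chart n (vectorField (fun k => (chart n).symm (D μ (chart n (coord k)))) f) := by
  rw [D_chart]
  congr 3
  funext k
  rw [D_chart, vectorField_coord, AlgEquiv.apply_symm_apply]

theorem D_x (μ ν : Fin (n + 1)) :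
    D μ (chart n (coord (.x ν))) = if ν = μ then 1 else 0 := by
  rw [D_chart, vectorField_coord, AlgEquiv.apply_symm_apply]
  simp only [KCoord.toB, totalCoeff]
  split_ifs <;> simp

/-! ### Vertical one-forms -/

/-- Vertical one-forms `∑ c_{j,a} δa_j`. -/
abbrev VForm (n : ℕ) := MIdx n →₀ Dep n →₀ ACPE n

@[elab_as_elim]
theorem VForm.induction {p : VForm n → Prop} (c : VForm n) (zero : p 0)
    (add : ∀ c c', p c → p c' → p (c + c'))
    (single : ∀ j a x, p (Finsupp.single j (Finsupp.single a x))) : p c := by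
  induction c using Finsupp.induction_linear with
  | zero => exact zero
  | add f g hf hg => exact add f g hf hg
  | single j b =>
    induction b using Finsupp.induction_linear with
    | zero => simpa using zero
    | add f g hf hg => rw [Finsupp.single_add]; exact add _ _ hf hg
    | single a x => exact single j a x

/-- The vertical differential. -/
def dV : ACPE n →ₗ[ℝ] VForm n where
  toFun f := Finsupp.ofSupportFinite (fun j => Finsupp.ofSupportFinite
    (fun a => pdC (.jet a j) f) ((pdC_support_finite f).preimage (f := fun a => (a, j))
      (fun _ _ _ _ h => (Prod.mk.inj h).1)))
    (((pdC_support_finite f).image Prod.snd).subset fun j hj => by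
      obtain ⟨a, ha⟩ := Finsupp.ne_iff.1 hj
      exact ⟨(a, j), ha, rfl⟩)
  map_add' f g := by
    ext j a
    exact map_add (pdC _) f g
  map_smul' c f := by
    ext j a
    exact map_smul (pdC _) c f

@[simp] theorem dV_apply (f : ACPE n) (j : MIdx n) (a : Dep n) : dV f j a = pdC (.jet a j) f := rfl

theorem dV_mul (f g : ACPE n) : dV (f * g) = f • dV g + g • dV f := by
  ext j a
  simp [pdC_mul]

theorem dV_jetC (a : Dep n) (j : MIdx n) :
    dV (jetC a j) = Finsupp.single j (Finsupp.single a 1) := by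
  classical
  ext i b
  rw [dV_apply, jetC, pdC_chart, pd_coord, Finsupp.single_apply]
  by_cases h : j = i
  · subst h
    by_cases h' : a = b
    · subst h'; simp
    · simp [h']
  · simp [h]

/-- The contraction of a vertical form with the vector field `∑ h_{j,a} ∂_{a_j}`. -/
def contract (h : MIdx n → Dep n → ACPE n) : VForm n →ₗ[ℝ] ACPE n :=
  Finsupp.lsum ℝ fun j => Finsupp.lsum ℝ fun a => LinearMap.mulLeft ℝ (h j a)

@[simp] theorem contract_single (h : MIdx n → Dep n → ACPE n) (j : MIdx n) (a : Dep n)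
    (x : ACPE n) : contract h (Finsupp.single j (Finsupp.single a x)) = h j a * x := by
  rw [contract, Finsupp.lsum_single, Finsupp.lsum_single, LinearMap.mulLeft_apply]

theorem vform_support_finite (c : VForm n) :
    {bj : Dep n × MIdx n | c bj.2 bj.1 ≠ 0}.Finite := by
  classical
  refine (c.support.finite_toSet.biUnion fun j _ =>
    ((c j).support.finite_toSet.image fun a => (a, j))).subset ?_
  rintro ⟨a, j⟩ h
  have h1 : c j ≠ 0 := fun h0 => h (by simp [h0])
  exact Set.mem_biUnion (Finset.mem_coe.2 (Finsupp.mem_support_iff.2 h1))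
    ⟨a, Finsupp.mem_support_iff.2 h, rfl⟩

theorem contract_eq_finsum (h : MIdx n → Dep n → ACPE n) (c : VForm n) :
    contract h c = ∑ᶠ bj : Dep n × MIdx n, h bj.2 bj.1 * c bj.2 bj.1 := by
  induction c using VForm.induction with
  | zero => simp
  | add c c' hc hc' =>
    rw [map_add, hc, hc', ← finsum_add_distrib]
    · simp only [Finsupp.add_apply, mul_add]
    · exact (vform_support_finite c).subset fun bj hbj h0 => hbj (by simp only [h0, mul_zero])
    · exact (vform_support_finite c').subset fun bj hbj h0 => hbj (by simp only [h0, mul_zero])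
  | single j a x =>
    classical
    rw [contract_single, finsum_eq_single _ (a, j)]
    · simp
    · rintro ⟨b, i⟩ hbi
      by_cases hi : j = i
      · subst hi
        have : a ≠ b := fun h => hbi (by rw [h])
        simp [this]
      · simp [hi]

theorem chart_vectorField (a : KCoord n → FinSmooth (KCoord n)) (f : FinSmooth (KCoord n)) :
    chart n (vectorField a f) = ∑ μ, chart n (a (.x μ)) * pdC (.x μ) (chart n f)
      + contract (fun j b => chart n (a (.jet b j))) (dV (chart n f)) := by
  classical
  have hinj : Function.Injective (fun bj : Dep n × MIdx n => KCoord.jet bj.1 bj.2) := by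
    rintro ⟨a, j⟩ ⟨b, k⟩ h
    simpa using h
  have hx : Function.Injective (KCoord.x (n := n)) := fun _ _ h => by simpa using h
  set T := (pdC_support_finite (chart n f)).toFinset
  have hT : ∀ bj : Dep n × MIdx n, bj ∉ T → pdC (.jet bj.1 bj.2) (chart n f) = 0 :=
    fun bj h => by simpa [T] using h
  rw [contract_eq_finsum, finsum_eq_sum_of_support_subset (s := T),
    vectorField_eq_sum (s := Finset.univ.image KCoord.x
      ∪ T.image (fun bj : Dep n × MIdx n => KCoord.jet bj.1 bj.2)), Finset.sum_union,
    Finset.sum_image hx.injOn, Finset.sum_image hinj.injOn]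
  · simp only [map_add, map_sum, map_mul, dV_apply, pdC_chart]
  · rw [Finset.disjoint_left]
    intro k hk hk'
    obtain ⟨μ, -, rfl⟩ := Finset.mem_image.1 hk
    obtain ⟨bj, -, h⟩ := Finset.mem_image.1 hk'
    exact absurd h (by simp)
  · rintro (μ | ⟨b, j⟩) hk
    · exact absurd (Finset.mem_union_left _ (Finset.mem_image_of_mem _ (Finset.mem_univ μ))) hk
    · refine (chart n).injective ?_
      rw [← pdC_chart, map_zero]
      exact hT (b, j) fun h => hk (Finset.mem_union_right _ (Finset.mem_image.2 ⟨_, h, rfl⟩))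
  · intro bj hbj
    by_contra h
    exact hbj (by simp only [dV_apply, hT bj h, mul_zero])

theorem D_eq (μ : Fin (n + 1)) (f : ACPE n) :
    D μ f = pdC (.x μ) f + contract (fun j a => D μ (jetC a j)) (dV f) := by
  obtain ⟨f, rfl⟩ := (chart n).surjective f
  rw [D_eq_vectorField, chart_vectorField]
  simp only [AlgEquiv.apply_symm_apply, D_x]
  rw [Finset.sum_eq_single μ]
  · rw [if_pos rfl, one_mul]; rfl
  · intro ν _ h; rw [if_neg h, zero_mul]
  · simp

theorem pdC_eq_vectorField (k : KCoord n) (a : KCoord n → FinSmooth (KCoord n))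
    (f : FinSmooth (KCoord n)) : pdC k (chart n (vectorField a f))
      = chart n (vectorField a (pd k f)) + chart n (vectorField (fun i => pd k (a i)) f) := by
  rw [pdC_chart, pd_vectorField, map_add]

/-- An operator acting on the coefficients of a vertical form. -/
def coeffV (T : ACPE n →ₗ[ℝ] ACPE n) : VForm n →ₗ[ℝ] VForm n :=
  Finsupp.mapRange.linearMap (Finsupp.mapRange.linearMap T)

@[simp] theorem coeffV_apply (T : ACPE n →ₗ[ℝ] ACPE n) (c : VForm n) (j : MIdx n) (a : Dep n) :
    coeffV T c j a = T (c j a) := by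
  simp [coeffV]

@[simp] theorem coeffV_single (T : ACPE n →ₗ[ℝ] ACPE n) (j : MIdx n) (a : Dep n) (x : ACPE n) :
    coeffV T (Finsupp.single j (Finsupp.single a x))
      = Finsupp.single j (Finsupp.single a (T x)) := by
  simp [coeffV, Finsupp.mapRange_single]

theorem coeffV_shiftIdx (T : ACPE n →ₗ[ℝ] ACPE n) (α : Fin n) (c : VForm n) :
    coeffV T (shiftIdx α c) = shiftIdx α (coeffV T c) := by
  induction c using VForm.induction with
  | zero => simp
  | add c c' hc hc' => simp only [map_add, hc, hc']
  | single j a x => simp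

/-- The total derivative of a vertical form. -/
def DV (α : Fin n) : VForm n →ₗ[ℝ] VForm n := coeffV (DTheta α) + shiftIdx α

theorem DV_single (α : Fin n) (j : MIdx n) (a : Dep n) (x : ACPE n) :
    DV α (Finsupp.single j (Finsupp.single a x)) = Finsupp.single j (Finsupp.single a (DTheta α x))
      + Finsupp.single (j + e α) (Finsupp.single a x) := by
  simp [DV]

theorem D_chart_succ (α : Fin n) (f : FinSmooth (KCoord n)) : DTheta α (chart n f)
    = chart n (vectorField (fun k => match k with
      | .x μ => if μ = α.succ then 1 else 0
      | .jet a j => coord (.jet a (j + e α))) f) := by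
  rw [DTheta, D_eq_vectorField]
  congr 3
  funext k
  rw [AlgEquiv.symm_apply_eq]
  rcases k with μ | ⟨a, j⟩
  · rw [D_x]; simp only; split_ifs <;> simp
  · exact D_jetC α a j

/-- The commutator of $\partial_{b_i}$ with $D_\alpha$ is $\partial_{b_{i-(\alpha)}}$, or zero when
$i$ has no component along $\alpha$; on vertical forms this is the shift. -/
theorem dV_DTheta (α : Fin n) (f : ACPE n) : dV (DTheta α f) = DV α (dV f) := by
  classical
  obtain ⟨f, rfl⟩ := (chart n).surjective f
  ext i b
  rw [dV_apply, D_chart_succ, pdC_eq_vectorField, ← D_chart_succ, ← pdC_chart, DV,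
    LinearMap.add_apply, Finsupp.add_apply, Finsupp.add_apply, coeffV_apply, dV_apply]
  congr 1
  rw [vectorField_apply]
  have hx : ∀ μ : Fin (n + 1), pd (.jet b i : KCoord n) (if μ = α.succ then 1 else 0) = 0 :=
    fun μ => by split_ifs <;> simp
  by_cases h : ∃ j, i = j + e α
  · obtain ⟨j, rfl⟩ := h
    rw [shiftIdx_apply_add, dV_apply, pdC_chart, finsum_eq_single _ (.jet b j)]
    · simp [pd_coord]
    · rintro (μ | ⟨a, l⟩) hk
      · simp only [hx, zero_mul]
      · rw [pd_coord, if_neg, zero_mul]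
        intro h
        simp only [KCoord.jet.injEq, add_left_inj] at h
        exact hk (by rw [h.1, h.2])
  · rw [shiftIdx, Finsupp.lmapDomain_apply, Finsupp.mapDomain_of_notMem_range _ _
      (fun ⟨j, hj⟩ => h ⟨j, hj.symm⟩), finsum_eq_zero_of_forall_eq_zero, map_zero]
    · rfl
    · rintro (μ | ⟨a, l⟩)
      · simp only [hx, zero_mul]
      · rw [pd_coord, if_neg, zero_mul]
        intro h'
        simp only [KCoord.jet.injEq] at h'
        exact h ⟨l, h'.2.symm⟩

theorem pdC_x_DTheta (μ : Fin (n + 1)) (α : Fin n) (f : ACPE n) :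
    pdC (.x μ) (DTheta α f) = DTheta α (pdC (.x μ) f) := by
  classical
  obtain ⟨f, rfl⟩ := (chart n).surjective f
  rw [D_chart_succ, pdC_eq_vectorField, ← D_chart_succ, ← pdC_chart, vectorField_apply,
    finsum_eq_zero_of_forall_eq_zero, map_zero, add_zero]
  rintro (ν | ⟨a, l⟩)
  · simp only; split_ifs <;> simp
  · simp [pd_coord]

/-! ### The field generating the scaling of the jets -/

/-- The operator `∑ a_j ∂_{a_j}`. -/
def eulerOp : ACPE n →ₗ[ℝ] ACPE n := contract (fun j a => jetC a j) ∘ₗ dV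

theorem eulerOp_chart (f : FinSmooth (KCoord n)) :
    eulerOp (chart n f) = chart n (eulerField {k | ∃ a j, k = .jet a j} f) := by
  classical
  rw [eulerField, chart_vectorField]
  simp [eulerOp]
  rfl

theorem exists_add_eulerOp_eq (f : ACPE n) : ∃ g, g + eulerOp g = f := by
  obtain ⟨f, rfl⟩ := (chart n).surjective f
  refine ⟨chart n (scaleMean {k | ∃ a j, k = .jet a j} f), ?_⟩
  rw [eulerOp_chart, ← map_add, add_eulerField_scaleMean]

theorem eq_zero_of_add_eulerOp {f : ACPE n} (h : f + eulerOp f = 0) : f = 0 := by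
  obtain ⟨f, rfl⟩ := (chart n).surjective f
  rw [eulerOp_chart, ← map_add, map_eq_zero_iff _ (chart n).injective] at h
  rw [eq_zero_of_add_eulerField _ h, map_zero]

theorem dV_eq_zero_of_eulerOp {f : ACPE n} (h : eulerOp f = 0) : dV f = 0 := by
  obtain ⟨f, rfl⟩ := (chart n).surjective f
  rw [eulerOp_chart, map_eq_zero_iff _ (chart n).injective] at h
  ext j a
  rw [dV_apply, pdC_chart, pd_eq_zero_of_eulerField h ⟨a, j, rfl⟩, map_zero]
  rfl

theorem eulerOp_mul (f g : ACPE n) : eulerOp (f * g) = f * eulerOp g + g * eulerOp f := by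
  obtain ⟨f, rfl⟩ := (chart n).surjective f
  obtain ⟨g, rfl⟩ := (chart n).surjective g
  rw [← map_mul, eulerOp_chart, eulerOp_chart, eulerOp_chart, Derivation.leibniz]
  simp only [map_add, smul_eq_mul, map_mul]

theorem eulerOp_jetC (a : Dep n) (j : MIdx n) : eulerOp (jetC a j) = jetC a j := by
  rw [eulerOp, LinearMap.comp_apply, dV_jetC, contract_single, mul_one]

/-! ### Functions of the independent variables -/

theorem D_eq_pdC {f : ACPE n} (h : dV f = 0) (μ : Fin (n + 1)) : D μ f = pdC (.x μ) f := by
  rw [D_eq, h, map_zero, add_zero]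

/-- The functions of the independent variables. -/
def xFunctions (n : ℕ) : Submodule ℝ (ACPE n) := LinearMap.ker dV

/-- On functions of $x$ alone the total derivatives are partial ones, so integration in one
coordinate suffices and does not disturb constancy in the others. -/
theorem exists_D_eq (μ : Fin (n + 1)) {f : ACPE n} (h : f ∈ xFunctions n) :
    ∃ g ∈ xFunctions n, D μ g = f ∧ ∀ ν, ν ≠ μ → D ν f = 0 → D ν g = 0 := by
  have h : dV f = 0 := h
  obtain ⟨F, rfl⟩ := (chart n).surjective f
  have h1 : ∀ k, pdC k (chart n F) = 0 → pd k F = 0 := fun k hk => by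
    rwa [pdC_chart, map_eq_zero_iff _ (chart n).injective] at hk
  obtain ⟨G, hG, hG'⟩ := exists_pd_eq (.x μ) F
  have hdG : dV (chart n G) = 0 := by
    ext j a
    rw [dV_apply, pdC_chart, hG' _ (by simp) (h1 _ _), map_zero]
    · rfl
    · rw [← dV_apply, h]; rfl
  refine ⟨chart n G, hdG, ?_, fun ν hν hf => ?_⟩
  · rw [D_eq_pdC hdG, pdC_chart, hG]
  · rw [D_eq_pdC h] at hf
    rw [D_eq_pdC hdG, pdC_chart, hG' _ (by simpa using hν) (h1 _ hf), map_zero]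

theorem eq_algebraMap_of_D_eq_zero {f : ACPE n} (h : f ∈ xFunctions n) (hD : ∀ μ, D μ f = 0) :
    ∃ c : ℝ, f = algebraMap ℝ (ACPE n) c := by
  have h : dV f = 0 := h
  have h2 : ∀ μ, pdC (.x μ) f = 0 := fun μ => by rw [← D_eq_pdC h, hD]
  have h3 : ∀ a j, pdC (.jet a j) f = 0 := fun a j => by rw [← dV_apply, h]; rfl
  obtain ⟨F, rfl⟩ := (chart n).surjective f
  obtain ⟨c, hc⟩ := eq_algebraMap_of_pd_eq_zero (f := F) (fun k => by
    refine (chart n).injective ?_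
    rw [← pdC_chart, map_zero]
    rcases k with μ | ⟨a, j⟩
    · exact h2 μ
    · exact h3 a j)
  exact ⟨c, by rw [hc, AlgEquiv.commutes]⟩

end Calculus

/-! ## Iterated operators -/

section Iterate

theorem MIdx.induction {n : ℕ} {p : MIdx n → Prop} (j : MIdx n) (zero : p 0)
    (add : ∀ j α, p j → p (j + e α)) : p j := by
  induction h : ∑ α, j α generalizing j with
  | zero =>
    have : j = 0 := funext fun α => by
      have := (Finset.sum_eq_zero_iff.1 h) α (Finset.mem_univ α)
      exact this
    rwa [this]
  | succ N ih =>
    obtain ⟨α, -, hα⟩ := Finset.exists_ne_zero_of_sum_ne_zero (h.trans_ne N.succ_ne_zero)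
    have hle : e α ≤ j := fun β => by
      by_cases hβ : β = α
      · subst hβ; simp; omega
      · simp [hβ]
    have hj : j - e α + e α = j := tsub_add_cancel_of_le hle
    rw [← hj]
    refine add _ _ (ih _ ?_)
    have h2 : ∑ β, (j - e α + e α) β = ∑ β, (j - e α) β + 1 := by
      simp only [Pi.add_apply, Finset.sum_add_distrib]
      congr 1
      simp
    rw [hj] at h2
    omega

/-- `T_1^{j_1} ⋯ T_n^{j_n}`. -/
def iter {M : Type*} [Monoid M] {n : ℕ} (T : Fin n → M) (j : MIdx n) : M :=
  (List.ofFn fun α => T α ^ j α).prod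

variable {M : Type*} [Monoid M]

theorem iter_zero {n : ℕ} (T : Fin n → M) : iter T 0 = 1 := by
  simp [iter]

theorem commute_iter {n : ℕ} {T : Fin n → M} {x : M} (h : ∀ α, Commute x (T α)) (j : MIdx n) :
    Commute x (iter T j) := by
  refine Commute.list_prod_right _ _ fun y hy => ?_
  obtain ⟨α, rfl⟩ := (List.mem_ofFn' _ _).1 hy
  exact (h α).pow_right _

/-- The product is ordered, so a new factor from a later direction has to pass the power of the
first operator; commutativity is used there. -/
theorem iter_add_e : ∀ {n : ℕ} {T : Fin n → M} (_ : ∀ α β, Commute (T α) (T β)) (j : MIdx n)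
    (α : Fin n), iter T (j + e α) = T α * iter T j
  | 0, _, _, _, α => α.elim0
  | n + 1, T, h, j, α => by
    have h0 : ∀ j : MIdx (n + 1), iter T j
        = T 0 ^ j 0 * iter (fun β => T β.succ) (fun β : Fin n => j β.succ) := fun j => by
      simp [iter, List.ofFn_succ]
    rw [h0, h0]
    refine Fin.cases ?_ (fun γ => ?_) α
    · have : (fun β : Fin n => (j + e (0 : Fin (n + 1)) : MIdx (n + 1)) β.succ) = fun β => j β.succ := by
        funext β; simp [Fin.succ_ne_zero]
      rw [this]
      simp [pow_succ', mul_assoc]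
    · have : (fun β : Fin n => (j + e γ.succ : MIdx (n + 1)) β.succ) = (fun β => j β.succ) + e γ := by
        funext β; simp [Pi.single_apply]
      rw [this, iter_add_e (fun _ _ => h _ _)]
      have h1 : (j + e γ.succ) 0 = j 0 := by simp [(Fin.succ_ne_zero γ).symm]
      rw [h1, ← mul_assoc, ← mul_assoc, ((h γ.succ 0).pow_right _).eq]

end Iterate

/-! ## The variational derivative -/

section Euler

variable {n : ℕ}

theorem commute_DTheta (α β : Fin n) :
    Commute (DTheta α : Module.End ℝ (ACPE n)) (DTheta β) :=
  LinearMap.ext fun f => D_comm _ _ f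

theorem DIter_zero (f : ACPE n) : DIter 0 f = f := by
  change iter (fun α => (DTheta α : Module.End ℝ (ACPE n))) 0 f = f
  rw [iter_zero]; rfl

theorem DIter_add_e (j : MIdx n) (α : Fin n) (f : ACPE n) :
    DIter (j + e α) f = DTheta α (DIter j f) :=
  LinearMap.congr_fun (iter_add_e (T := fun α => (DTheta α : Module.End ℝ (ACPE n)))
    commute_DTheta j α) f

theorem DIter_comm {T : ACPE n →ₗ[ℝ] ACPE n} (hT : ∀ α f, T (DTheta α f) = DTheta α (T f))
    (j : MIdx n) (f : ACPE n) : T (DIter j f) = DIter j (T f) :=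
  LinearMap.congr_fun (commute_iter (T := fun α => (DTheta α : Module.End ℝ (ACPE n)))
    (x := (T : Module.End ℝ (ACPE n))) (fun α => LinearMap.ext fun f => hT α f) j) f

theorem negDIter_zero (f : ACPE n) : negDIter 0 f = f := by
  rw [negDIter, LinearMap.smul_apply, DIter_zero]; simp

theorem negDIter_add_e (j : MIdx n) (α : Fin n) (f : ACPE n) :
    negDIter (j + e α) f = - DTheta α (negDIter j f) := by
  have : ∑ β, (j + e α) β = ∑ β, j β + 1 := by
    simp [Finset.sum_add_distrib]
  rw [negDIter, negDIter, LinearMap.smul_apply, LinearMap.smul_apply, DIter_add_e, map_smul, this,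
    pow_succ]
  simp

theorem DIter_jetC (a : Dep n) (j : MIdx n) : DIter j (jetC a 0) = jetC a j := by
  induction j using MIdx.induction with
  | zero => rw [DIter_zero]
  | add j α ih => rw [DIter_add_e, ih, D_jetC]

/-- The difference of the shift and the coefficientwise derivative. -/
def twist (α : Fin n) : Module.End ℝ (VForm n) := shiftIdx α + coeffV (-DTheta α)

theorem twist_apply (α : Fin n) (c : VForm n) :
    twist α c = shiftIdx α c + coeffV (-DTheta α) c := rfl

theorem coeffV_comm {T T' : ACPE n →ₗ[ℝ] ACPE n} (h : ∀ f, T (T' f) = T' (T f)) (c : VForm n) :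
    coeffV T (coeffV T' c) = coeffV T' (coeffV T c) := by
  ext j a
  simp only [coeffV_apply, h]

theorem coeffV_twist {T : ACPE n →ₗ[ℝ] ACPE n} (hT : ∀ α f, T (DTheta α f) = DTheta α (T f))
    (α : Fin n) (c : VForm n) : coeffV T (twist α c) = twist α (coeffV T c) := by
  rw [twist_apply, twist_apply, map_add, coeffV_shiftIdx, coeffV_comm (fun f => by
    rw [LinearMap.neg_apply, LinearMap.neg_apply, map_neg, hT])]

theorem commute_twist (α β : Fin n) : Commute (twist α) (twist β) := by
  refine LinearMap.ext fun c => ?_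
  change twist α (twist β c) = twist β (twist α c)
  have h : ∀ f : ACPE n, (-DTheta α) ((-DTheta β) f) = (-DTheta β) ((-DTheta α) f) := fun f => by
    simp only [LinearMap.neg_apply, map_neg, D_comm α.succ β.succ]
  simp only [twist_apply, map_add, coeffV_shiftIdx, shiftIdx_comm α β, coeffV_comm h]
  exact add_add_add_comm _ _ _ _

theorem coeffV_iter_twist {T : ACPE n →ₗ[ℝ] ACPE n} (hT : ∀ α f, T (DTheta α f) = DTheta α (T f))
    (j : MIdx n) (c : VForm n) : coeffV T (iter twist j c) = iter twist j (coeffV T c) :=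
  LinearMap.congr_fun (commute_iter (T := twist) (x := (coeffV T : Module.End ℝ (VForm n)))
    (fun α => LinearMap.ext fun c => coeffV_twist hT α c) j) c

theorem iter_twist_add_e (j : MIdx n) (α : Fin n) (c : VForm n) :
    iter twist (j + e α) c = twist α (iter twist j c) :=
  LinearMap.congr_fun (iter_add_e commute_twist j α) c

/-- The rewriting of a vertical form `∑ c_{j,a} δa_j` as `∑ D_j (h_{j,a} δa)`. -/
def symbol : VForm n →ₗ[ℝ] VForm n :=
  Finsupp.lsum ℝ fun j => iter twist j ∘ₗ Finsupp.lsingle 0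

theorem symbol_single (j : MIdx n) (b : Dep n →₀ ACPE n) :
    symbol (Finsupp.single j b) = iter twist j (Finsupp.single 0 b) := by
  rw [symbol, Finsupp.lsum_single]; rfl

/-- From $D_\alpha(x\,\delta a_j)=D_\alpha x\,\delta a_j+x\,\delta a_{j+(\alpha)}$: the extra
`twist` in the second term is the shift minus $D_\alpha$ on coefficients, and the latter cancels the
first term. -/
theorem symbol_DV (α : Fin n) (c : VForm n) : symbol (DV α c) = shiftIdx α (symbol c) := by
  induction c using VForm.induction with
  | zero => simp
  | add c c' hc hc' => simp only [map_add, hc, hc']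
  | single j a x =>
    rw [DV_single, map_add, symbol_single, symbol_single, symbol_single, iter_twist_add_e,
      twist_apply, coeffV_iter_twist (fun β f => by
        rw [LinearMap.neg_apply, LinearMap.neg_apply, map_neg, D_comm]), coeffV_single,
      add_left_comm, ← map_add, ← Finsupp.single_add, ← Finsupp.single_add, LinearMap.neg_apply,
      add_neg_cancel, Finsupp.single_zero, Finsupp.single_zero, map_zero, add_zero]

theorem coeffV_symbol {T : ACPE n →ₗ[ℝ] ACPE n} (hT : ∀ α f, T (DTheta α f) = DTheta α (T f))
    (c : VForm n) : coeffV T (symbol c) = symbol (coeffV T c) := by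
  induction c using VForm.induction with
  | zero => simp
  | add c c' hc hc' => simp only [map_add, hc, hc']
  | single j a x =>
    rw [coeffV_single, symbol_single, symbol_single, coeffV_iter_twist hT, coeffV_single]

/-- The operator `∑ c_{j,a} δa_j ↦ ∑ (-D)_j c_{j,a}`. -/
def eulerV : VForm n →ₗ[ℝ] Dep n →₀ ACPE n := Finsupp.lapply 0 ∘ₗ symbol

theorem eulerV_apply (c : VForm n) : eulerV c = symbol c 0 := rfl

/-- A total derivative becomes a shift, and a shift has no coefficient at the zero multi-index. -/
theorem eulerV_DV (α : Fin n) (c : VForm n) : eulerV (DV α c) = 0 := by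
  rw [eulerV_apply, symbol_DV, shiftIdx_apply_zero]

/-- Only the parts $-D_\alpha$ of the twists contribute at the zero multi-index, since the shifts
never reach it. -/
theorem eulerV_single (j : MIdx n) (a : Dep n) (x : ACPE n) :
    eulerV (Finsupp.single j (Finsupp.single a x)) = Finsupp.single a (negDIter j x) := by
  rw [eulerV_apply, symbol_single]
  induction j using MIdx.induction with
  | zero => rw [iter_zero, negDIter_zero, Module.End.one_apply, Finsupp.single_eq_same]
  | add j α ih =>
    rw [iter_twist_add_e, twist_apply, Finsupp.add_apply, shiftIdx_apply_zero, negDIter_add_e]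
    ext b
    rw [Finsupp.add_apply, coeffV_apply, ih]
    classical
    rw [Finsupp.single_apply, Finsupp.single_apply]
    split_ifs <;> simp

theorem eulerV_single_zero (b : Dep n →₀ ACPE n) : eulerV (Finsupp.single 0 b) = b := by
  rw [eulerV_apply, symbol_single, iter_zero, Module.End.one_apply, Finsupp.single_eq_same]

theorem eulerV_apply_apply (c : VForm n) (a : Dep n) :
    eulerV c a = ∑ᶠ j, negDIter j (c j a) := by
  have hfin : ∀ c : VForm n, (Function.support fun j => negDIter j (c j a)).Finite := fun c =>
    c.support.finite_toSet.subset fun j hj => Finset.mem_coe.2 (Finsupp.mem_support_iff.2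
      fun h => hj (by simp only [h, Finsupp.coe_zero, Pi.zero_apply, map_zero]))
  induction c using VForm.induction with
  | zero => simp
  | add c c' hc hc' =>
    rw [map_add, Finsupp.add_apply, hc, hc', ← finsum_add_distrib (hfin c) (hfin c')]
    simp only [Finsupp.add_apply, map_add]
  | single j b x =>
    classical
    rw [eulerV_single, finsum_eq_single _ j]
    · rw [Finsupp.single_eq_same, Finsupp.single_apply, Finsupp.single_apply]
      split_ifs <;> simp
    · intro i hi
      rw [Finsupp.single_eq_of_ne hi, Finsupp.coe_zero, Pi.zero_apply, map_zero]

/-- The family of variational derivatives. -/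
def varD : ACPE n →ₗ[ℝ] Dep n →₀ ACPE n := eulerV ∘ₗ dV

theorem varD_apply (f : ACPE n) (a : Dep n) : varD f a = varDeriv f a :=
  eulerV_apply_apply _ _

theorem varD_eq (f : ACPE n) : varD f = eulerV (dV f) := rfl

theorem varD_DTheta (α : Fin n) (f : ACPE n) : varD (DTheta α f) = 0 := by
  rw [varD_eq, dV_DTheta, eulerV_DV]

theorem DV_smul (α : Fin n) (f : ACPE n) (c : VForm n) :
    DV α (f • c) = f • DV α c + DTheta α f • c := by
  induction c using VForm.induction with
  | zero => simp
  | add c c' hc hc' => simp only [smul_add, map_add, hc, hc']; abel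
  | single j a x =>
    simp only [Finsupp.smul_single, smul_eq_mul, DV_single, D_mul, smul_add, Finsupp.single_add,
      mul_comm x]
    abel

/-- Integration by parts. -/
theorem eulerV_smul_DV (α : Fin n) (f : ACPE n) (c : VForm n) :
    eulerV (f • DV α c) = - eulerV (DTheta α f • c) := by
  rw [eq_neg_iff_add_eq_zero, ← map_add, ← DV_smul, eulerV_DV]

theorem eulerV_smul_dV_DTheta (α : Fin n) (f g : ACPE n) :
    eulerV (f • dV (DTheta α g)) = - eulerV (DTheta α f • dV g) := by
  rw [dV_DTheta, eulerV_smul_DV]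

theorem negDIter_comm (α : Fin n) (j : MIdx n) (f : ACPE n) :
    DTheta α (negDIter j f) = negDIter j (DTheta α f) := by
  rw [negDIter, LinearMap.smul_apply, LinearMap.smul_apply, map_smul,
    DIter_comm (T := DTheta α) (fun _ _ => D_comm _ _ _)]

theorem eulerV_smul_dV_DIter (j : MIdx n) (f g : ACPE n) :
    eulerV (f • dV (DIter j g)) = eulerV (negDIter j f • dV g) := by
  induction j using MIdx.induction generalizing f with
  | zero => rw [DIter_zero, negDIter_zero]
  | add j α ih =>
    rw [DIter_add_e, eulerV_smul_dV_DTheta, ih, negDIter_add_e, negDIter_comm, neg_eq_iff_add_eq_zero,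
      ← map_add, ← add_smul, add_neg_cancel, zero_smul, map_zero]

/-- The evolutionary field with characteristic `g`, `∑ D_j g^a ∂_{a_j}`. -/
def evol (g : Dep n → ACPE n) : ACPE n →ₗ[ℝ] ACPE n := contract (fun j a => DIter j (g a)) ∘ₗ dV

theorem evol_apply (g : Dep n → ACPE n) (f : ACPE n) :
    evol g f = contract (fun j a => DIter j (g a)) (dV f) := rfl

theorem contract_DV (g : Dep n → ACPE n) (α : Fin n) (c : VForm n) :
    contract (fun j a => DIter j (g a)) (DV α c)
      = DTheta α (contract (fun j a => DIter j (g a)) c) := by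
  induction c using VForm.induction with
  | zero => simp
  | add c c' hc hc' => simp only [map_add, hc, hc']
  | single j a x =>
    rw [DV_single, map_add, contract_single, contract_single, contract_single, DIter_add_e, D_mul,
      mul_comm x]

theorem evol_DTheta (g : Dep n → ACPE n) (α : Fin n) (f : ACPE n) :
    evol g (DTheta α f) = DTheta α (evol g f) := by
  rw [evol_apply, dV_DTheta, contract_DV, evol_apply]

/-- The operator `h ↦ ∑ D_j (g^a h_{j,a})`. -/
def assemble (g : Dep n → ACPE n) : VForm n →ₗ[ℝ] ACPE n :=
  Finsupp.lsum ℝ fun j => (DIter j : Module.End ℝ (ACPE n)) ∘ₗ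
    Finsupp.lsum ℝ fun a => LinearMap.mulLeft ℝ (g a)

@[simp] theorem assemble_single (g : Dep n → ACPE n) (j : MIdx n) (a : Dep n) (x : ACPE n) :
    assemble g (Finsupp.single j (Finsupp.single a x)) = DIter j (g a * x) := by
  rw [assemble, Finsupp.lsum_single, LinearMap.comp_apply, Finsupp.lsum_single,
    LinearMap.mulLeft_apply]

theorem assemble_shiftIdx (g : Dep n → ACPE n) (α : Fin n) (c : VForm n) :
    assemble g (shiftIdx α c) = DTheta α (assemble g c) := by
  induction c using VForm.induction with
  | zero => simp
  | add c c' hc hc' => simp only [map_add, hc, hc']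
  | single j a x => rw [shiftIdx_single, assemble_single, assemble_single, DIter_add_e]

/-- This is $D_\alpha(gx)-g\,D_\alpha x=(D_\alpha g)\,x$: a twist of the coefficients moves the
derivative onto `g`. -/
theorem assemble_twist (g : Dep n → ACPE n) (α : Fin n) (c : VForm n) :
    assemble g (twist α c) = assemble (fun a => DTheta α (g a)) c := by
  induction c using VForm.induction with
  | zero => simp
  | add c c' hc hc' => simp only [map_add, hc, hc']
  | single j a x =>
    rw [twist_apply, map_add, assemble_shiftIdx, coeffV_single, assemble_single, assemble_single,
      assemble_single, DIter_comm (T := DTheta α) (fun _ _ => D_comm _ _ _), D_mul, ← map_add,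
      LinearMap.neg_apply, mul_neg, mul_comm x, add_neg_cancel_comm]

theorem assemble_iter_twist (g : Dep n → ACPE n) (j : MIdx n) (c : VForm n) :
    assemble g (iter twist j c) = assemble (fun a => DIter j (g a)) c := by
  induction j using MIdx.induction generalizing g with
  | zero => simp only [iter_zero, DIter_zero, Module.End.one_apply]
  | add j α ih =>
    rw [iter_twist_add_e, assemble_twist, ih]
    simp only [DIter_add_e, DIter_comm (T := DTheta α) (fun _ _ => D_comm _ _ _)]

/-- Integration by parts with the divergences kept: the terms with $j\neq0$ on the left are total
derivatives, and the term $j=0$ pairs `g` with the Euler expression. -/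
theorem assemble_symbol (g : Dep n → ACPE n) (c : VForm n) :
    assemble g (symbol c) = contract (fun j a => DIter j (g a)) c := by
  induction c using VForm.induction with
  | zero => simp
  | add c c' hc hc' => simp only [map_add, hc, hc']
  | single j a x =>
    rw [symbol_single, assemble_iter_twist, assemble_single, contract_single, DIter_zero]

theorem evol_eq_assemble (g : Dep n → ACPE n) (f : ACPE n) :
    evol g f = assemble g (symbol (dV f)) := (assemble_symbol g _).symm

theorem evol_jetC : evol (fun a => jetC a 0) = (eulerOp : ACPE n →ₗ[ℝ] ACPE n) := by
  simp only [evol, eulerOp, DIter_jetC]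

end Euler

/-! ### Adjoint linearizations and the Helmholtz condition. -/

section Adjoint

variable {n : ℕ}

/-- The bilinear operator `(f, g) ↦ (∑_j (-D)_j (f ∂_{b_j} g))_b`. -/
def adjPair : ACPE n →ₗ[ℝ] ACPE n →ₗ[ℝ] Dep n →₀ ACPE n :=
  LinearMap.mk₂ ℝ (fun f g => eulerV (f • dV g))
    (fun f f' g => by rw [add_smul, map_add])
    (fun c f g => by rw [smul_assoc]; exact map_smul eulerV c _)
    (fun f g g' => by rw [map_add, smul_add, map_add])
    (fun c f g => by rw [map_smul dV, smul_comm]; exact map_smul eulerV c _)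

theorem adjPair_apply (f g : ACPE n) : adjPair f g = eulerV (f • dV g) := rfl

theorem adjPair_DTheta (α : Fin n) (f g : ACPE n) :
    adjPair f (DTheta α g) = - adjPair (DTheta α f) g := eulerV_smul_dV_DTheta α f g

theorem adjPair_mul (f g h : ACPE n) :
    adjPair f (g * h) = adjPair (f * g) h + adjPair (f * h) g := by
  simp only [adjPair_apply, dV_mul, smul_add, map_add, smul_smul]

theorem adjPair_jetC (f : ACPE n) (a : Dep n) :
    adjPair f (jetC a 0) = Finsupp.single a f := by
  rw [adjPair_apply, dV_jetC, Finsupp.smul_single, eulerV_single_zero, Finsupp.smul_single,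
    smul_eq_mul, mul_one]

/-- The adjoint of the linearization of `g`. -/
def adjLin (g : Dep n → ACPE n) : (Dep n →₀ ACPE n) →ₗ[ℝ] Dep n →₀ ACPE n :=
  Finsupp.lsum ℝ fun a => adjPair.flip (g a)

theorem adjLin_single (g : Dep n → ACPE n) (a : Dep n) (x : ACPE n) :
    adjLin g (Finsupp.single a x) = adjPair x (g a) := by
  rw [adjLin, Finsupp.lsum_single]; rfl

theorem coeffV_dV {T : ACPE n →ₗ[ℝ] ACPE n} (hT : ∀ a j f, pdC (.jet a j) (T f) = T (pdC (.jet a j) f))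
    (f : ACPE n) : coeffV T (dV f) = dV (T f) := by
  ext j a
  rw [coeffV_apply, dV_apply, dV_apply, hT]

theorem eulerV_coeffV {T : ACPE n →ₗ[ℝ] ACPE n} (hT : ∀ α f, T (DTheta α f) = DTheta α (T f))
    (c : VForm n) (a : Dep n) : eulerV (coeffV T c) a = T (eulerV c a) := by
  rw [eulerV_apply, eulerV_apply, ← coeffV_symbol hT, coeffV_apply]

/-- The operator `∑ c_{j,a} δa_j ↦ ∑ D_j g^a dV c_{j,a}`. -/
def contractDV (g : Dep n → ACPE n) : VForm n →ₗ[ℝ] VForm n :=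
  Finsupp.lsum ℝ fun j => Finsupp.lsum ℝ fun a =>
    { toFun := fun x => DIter j (g a) • dV x
      map_add' := fun x y => by rw [map_add, smul_add]
      map_smul' := fun c x => by rw [map_smul, smul_comm, RingHom.id_apply] }

theorem contractDV_single (g : Dep n → ACPE n) (j : MIdx n) (a : Dep n) (x : ACPE n) :
    contractDV g (Finsupp.single j (Finsupp.single a x)) = DIter j (g a) • dV x := by
  rw [contractDV, Finsupp.lsum_single, Finsupp.lsum_single]; rfl

/-- The second partial derivatives of `f` are symmetric, so differentiating the coefficients of its
vertical differential is the same as applying the field to them. -/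
theorem contractDV_dV (g : Dep n → ACPE n) (f : ACPE n) :
    contractDV g (dV f) = coeffV (evol g) (dV f) := by
  have h : ∀ (c : VForm n) (i : MIdx n) (b : Dep n), contractDV g c i b
      = contract (fun j a => DIter j (g a)) (coeffV (pdC (.jet b i)) c) := by
    intro c i b
    induction c using VForm.induction with
    | zero => simp
    | add c c' hc hc' => simp only [map_add, Finsupp.add_apply, hc, hc']
    | single j a x => rw [contractDV_single, coeffV_single, contract_single]; rfl
  ext i b
  rw [h, coeffV_apply, dV_apply, evol_apply, coeffV_dV (fun _ _ _ => pdC_comm _ _ _)]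

/-- The commutator of the variational derivative and an evolutionary field. -/
theorem varD_evol (g : Dep n → ACPE n) (f : ACPE n) (a : Dep n) :
    varD (evol g f) a = evol g (varD f a) + adjLin g (varD f) a := by
  -- For an arbitrary vertical form, the product rule gives a part differentiating the coefficients
  -- and a part differentiating $D_jg^a$; integration by parts turns the second into the adjoint of
  -- the linearization of `g`.
  have h : ∀ c : VForm n, eulerV (dV (contract (fun j a => DIter j (g a)) c))
      = eulerV (contractDV g c) + adjLin g (eulerV c) := by
    intro c
    induction c using VForm.induction with
    | zero => simp
    | add c c' hc hc' => simp only [map_add, hc, hc', add_add_add_comm]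
    | single j a x =>
      rw [contract_single, dV_mul, map_add, contractDV_single, eulerV_single, adjLin_single,
        adjPair_apply, eulerV_smul_dV_DIter]
  rw [varD_eq, evol_apply, h, contractDV_dV, Finsupp.add_apply,
    eulerV_coeffV (evol_DTheta g), varD_eq]

theorem varD_DIter {j : MIdx n} (hj : j ≠ 0) (f : ACPE n) : varD (DIter j f) = 0 := by
  induction j using MIdx.induction with
  | zero => exact absurd rfl hj
  | add j α _ => rw [DIter_add_e, varD_DTheta]

/-- The first variation formula, `ev_g f = g^a δ_a f` modulo total divergences. -/
theorem varD_evol_eq (g : Dep n → ACPE n) (f : ACPE n) :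
    varD (evol g f) = (varD f).sum fun a x => varD (g a * x) := by
  -- All terms with $j\neq0$ are total derivatives, which `varD` kills.
  have h : ∀ c : VForm n, varD (assemble g c) = (c 0).sum fun a x => varD (g a * x) := by
    intro c
    have hadd : ∀ b b' : Dep n →₀ ACPE n, ((b + b').sum fun a x => varD (g a * x))
        = (b.sum fun a x => varD (g a * x)) + b'.sum fun a x => varD (g a * x) := fun b b' =>
      Finsupp.sum_add_index' (fun a => by simp) (fun a x y => by rw [mul_add, map_add])
    induction c using VForm.induction with
    | zero => simp
    | add c c' hc hc' => rw [map_add, map_add, Finsupp.add_apply, hadd, hc, hc']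
    | single j a x =>
      rw [assemble_single]
      by_cases hj : j = 0
      · subst hj
        rw [DIter_zero, Finsupp.single_eq_same, Finsupp.sum_single_index (by simp)]
      · rw [varD_DIter hj, Finsupp.single_eq_of_ne (Ne.symm hj), Finsupp.sum_zero_index]
  rw [evol_eq_assemble, h]; rfl

theorem varD_mul (f g : ACPE n) : varD (f * g) = adjPair f g + adjPair g f := by
  rw [varD_eq, dV_mul, map_add]; rfl

theorem lin_eq_evol (χ : Dep n →₀ ACPE n) (g : Dep n → ACPE n) (a : Dep n) :
    lin χ g a = evol g (χ a) := by
  rw [evol_apply, contract_eq_finsum]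
  exact finsum_congr fun bj => mul_comm _ _

theorem linAdj_eq_sum (χ : Dep n →₀ ACPE n) (g : Dep n → ACPE n) (a : Dep n) :
    linAdj χ g a = (χ.sum fun b x => adjPair (g b) x) a := by
  rw [linAdj, finsum_curry _ (linAdj_support_finite χ g a), Finsupp.sum_apply, Finsupp.sum,
    finsum_eq_sum_of_support_subset (s := χ.support)]
  · exact Finset.sum_congr rfl fun b _ => (eulerV_apply_apply (g b • dV (χ b)) a).symm
  · intro b hb
    rw [Finset.mem_coe, Finsupp.mem_support_iff]
    intro h
    exact hb (by simp only [h, map_zero, mul_zero, finsum_zero])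

theorem adjLin_eq_sum (χ : Dep n →₀ ACPE n) (g : Dep n → ACPE n) :
    adjLin g χ = χ.sum fun b x => adjPair x (g b) := by
  rw [adjLin, Finsupp.lsum_apply]; rfl

/-- Variational derivatives have self-adjoint linearization. -/
theorem varD_mem_Helmholtz (f : ACPE n) : varD f ∈ Helmholtz n := by
  change lin (varD f) = linAdj (varD f)
  funext g a
  -- The variational derivative of $\mathrm{ev}_gf$ is computed twice, by the commutator and by the
  -- first variation with the product rule. The adjoint of the linearization of `g` occurs in both
  -- and cancels.
  have h := varD_evol g f a
  rw [varD_evol_eq] at h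
  simp only [varD_mul, Finsupp.sum_add] at h
  rw [← adjLin_eq_sum, Finsupp.add_apply, ← linAdj_eq_sum] at h
  rw [lin_eq_evol]
  exact (add_right_cancel h).symm

/-- Families with self-adjoint linearization are variational derivatives. -/
theorem exists_varD_eq {χ : Dep n →₀ ACPE n} (h : χ ∈ Helmholtz n) : ∃ f, varD f = χ := by
  have h : lin χ = linAdj χ := h
  choose I hI using exists_add_eulerOp_eq (n := n)
  -- The homotopy Lagrangian $\sum a_0\int_0^1\chi_a\,dt$ along the scaling of the jets: `I` inverts
  -- $1+E$ and $Ea_0=a_0$, so $Ef=\sum a_0\chi_a$.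
  set f : ACPE n := χ.sum fun a x => jetC a 0 * I x with hf
  have hV : eulerOp f = χ.sum fun a x => jetC a 0 * x := by
    rw [hf, Finsupp.sum, map_sum]
    refine Finset.sum_congr rfl fun a _ => ?_
    rw [eulerOp_mul, eulerOp_jetC, mul_comm (I _), ← mul_add, add_comm, hI]
  refine ⟨f, Finsupp.ext fun b => ?_⟩
  have h1 := varD_evol (fun a => jetC a 0) f b
  rw [evol_jetC] at h1
  have h2 : adjLin (fun a => jetC a 0) (varD f) = varD f := by
    rw [adjLin_eq_sum]
    simp only [adjPair_jetC, Finsupp.sum_single]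
  -- The product rule yields $\chi$ and the adjoint linearization at $(a_0)_a$; by self-adjointness
  -- the latter is the linearization there, which is $E\chi$.
  have h3 : varD (eulerOp f) b = eulerOp (χ b) + χ b := by
    rw [hV, Finsupp.sum, map_sum]
    simp only [varD_mul, adjPair_jetC]
    rw [Finset.sum_add_distrib, Finsupp.add_apply]
    congr 1
    · have h4 := linAdj_eq_sum χ (fun a => jetC a 0) b
      rw [← h, lin_eq_evol, evol_jetC] at h4
      exact h4.symm
    · exact DFunLike.congr_fun (Finsupp.sum_single χ) b
  rw [h3, h2] at h1
  -- The commutator formula also gives $(1+E)$ applied to `varD f b`, so injectivity of $1+E$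
  -- finishes the proof.
  have h5 : (varD f b - χ b) + eulerOp (varD f b - χ b) = 0 := by
    rw [map_sub]; linear_combination -h1
  exact sub_eq_zero.1 (eq_zero_of_add_eulerOp h5)

/-- As $D_1$ commutes with $D_j$, one has $D_1a_j=D_j(D_1a_0)$: the constraints form an evolution
system in $x^1$ for the chosen dependent variables. -/
theorem D_zero_eq_evol (f : ACPE n) :
    D 0 f = pdC (.x 0) f + evol (fun a => D 0 (jetC a 0)) f := by
  have h : (fun (j : MIdx n) (a : Dep n) => D 0 (jetC a j))
      = fun j a => DIter j (D 0 (jetC a 0)) := by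
    funext j a
    rw [← DIter_comm (T := D 0) (fun _ _ => D_comm _ _ _), DIter_jetC]
  rw [D_eq, h, evol_apply]

/-- The explicit derivative $\partial_{x^1}$ commutes with the variational derivative, so the extra
term comes only from `varD_evol` applied to the evolutionary part. -/
theorem varD_D_zero (f : ACPE n) (a : Dep n) :
    varD (D 0 f) a = D 0 (varD f a) + adjLin (fun a => D 0 (jetC a 0)) (varD f) a := by
  rw [D_zero_eq_evol f, map_add, Finsupp.add_apply, varD_evol, D_zero_eq_evol (varD f a), varD_eq,
    ← coeffV_dV (fun _ _ _ => pdC_comm _ _ _), eulerV_coeffV (pdC_x_DTheta 0), ← varD_eq, add_assoc]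

/-! ### The adjoint of the linearization of the evolution equations -/

theorem D_zero_jetC (a : Dep n) (j : MIdx n) :
    D 0 (jetC a j) = restr n (totalCoeff 0 (KCoord.jet a j).toB) := by
  rw [jetC, D_chart, vectorField_coord, AlgEquiv.apply_symm_apply]

theorem uC_eq (μ : Fin (n + 1)) (i : MIdx (n + 1)) : uC μ i = chart n (sigU μ i) := restr_coord _

theorem zero_eq_cons : (0 : MIdx (n + 1)) = Fin.cons 0 0 := by
  funext μ; refine Fin.cases rfl (fun _ => rfl) μ

theorem e_zero_eq_cons : (e 0 : MIdx (n + 1)) = Fin.cons 1 0 := by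
  rw [← zero_add (e 0), zero_eq_cons, cons_add_e_zero]

theorem e_succ_eq_cons (α : Fin n) : (e α.succ : MIdx (n + 1)) = Fin.cons 0 (e α) := by
  rw [← zero_add (e α.succ), zero_eq_cons, cons_add_e_succ, zero_add]

/-- The continuity equation eliminates $u^1_{(1)}$; this is where the divergence $u^\beta_{(\beta)}$
in $f^*$ comes from. -/
theorem uC_zero_e_zero : uC (n := n) 0 (e 0) = - ∑ α, DTheta α (jetC (.u α 0) 0) := by
  rw [uC_eq, e_zero_eq_cons]
  simp only [D_jetC, sigU, Fin.cases_zero, Fin.cons_zero, Fin.tail_cons, map_neg, map_sum]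
  rfl

theorem uC_zero_e_succ (α : Fin n) : uC 0 (e α.succ) = DTheta α (jetC .u1 0) := by
  rw [uC_eq, e_succ_eq_cons, D_jetC, zero_add]
  simp [sigU, jetC]

theorem uC_succ_e_zero (α : Fin n) : uC α.succ (e 0) = jetC (.u α 1) 0 := by
  rw [uC_eq, e_zero_eq_cons]
  simp [sigU, jetC]

theorem uC_succ_e_succ (α β : Fin n) : uC α.succ (e β.succ) = DTheta β (jetC (.u α 0) 0) := by
  rw [uC_eq, e_succ_eq_cons, D_jetC, zero_add]
  simp [sigU, jetC]

theorem D_zero_u1 : D 0 (jetC (n := n) .u1 0) = - ∑ α, DTheta α (jetC (.u α 0) 0) := by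
  rw [D_zero_jetC, ← uC_zero_e_zero, e_zero_eq_cons]
  simp only [KCoord.toB, totalCoeff, cons_add_e_zero]
  rfl

theorem D_zero_u (α : Fin n) (k : ℕ) : D 0 (jetC (.u α k) 0) = jetC (.u α (k + 1)) 0 := by
  rw [D_zero_jetC]
  simp only [KCoord.toB, totalCoeff, cons_add_e_zero]
  exact restr_coord_toB (.jet (.u α (k + 1)) 0)

theorem D_zero_p_zero : D 0 (jetC (n := n) (.p 0) 0) = jetC (.p 1) 0 := by
  rw [D_zero_jetC]
  simp only [KCoord.toB, totalCoeff, cons_add_e_zero]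
  exact restr_coord_toB (.jet (.p 1) 0)

theorem quad_zero {R : Type*} [CommRing R] (u : Fin (n + 1) → MIdx (n + 1) → R) :
    quad u 0 = ∑ lam, ∑ μ, u lam (e μ) * u μ (e lam) := by
  have h : Finset.Iic (0 : MIdx (n + 1)) = {0} := by
    ext i; simp
  simp [quad, leibnizSum, h]

/-- Here $p_2$ is eliminated by the pressure equation at the zero multi-index. -/
theorem D_zero_p_one : D 0 (jetC (n := n) (.p 1) 0) = - (∑ lam, ∑ μ, uC lam (e μ) * uC μ (e lam))
    - ∑ α, DTheta α (DTheta α (jetC (.p 0) 0)) := by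
  rw [D_zero_jetC]
  simp only [KCoord.toB, totalCoeff, cons_add_e_zero, restr_coord, sig]
  -- The form `0 + 2` lets `solve` unfold in its recursive case.
  have h1 : (Fin.cons (((1 : Fin 2) : ℕ) + 1) 0 : MIdx (n + 1)) 0 = 0 + 2 := rfl
  rw [h1, solve]
  simp only [solve, Fin.tail_cons, map_sub, map_neg, map_sum, ← zero_eq_cons, quad_zero, map_mul, ← uC_eq,
    zero_add]
  congr 1
  refine Finset.sum_congr rfl fun α _ => ?_
  rw [D_jetC, D_jetC, zero_add]; rfl

theorem adjPair_DTheta_jetC (x : ACPE n) (α : Fin n) (a : Dep n) :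
    adjPair x (DTheta α (jetC a 0)) = Finsupp.single a (- DTheta α x) := by
  rw [adjPair_DTheta, adjPair_jetC, Finsupp.single_neg]

/-- The quadratic term is symmetric under exchange of $\lambda$ and $\mu$, so both halves of the
product rule give the same sum; hence the factor 2. -/
theorem adjPair_D_zero_p_one (x : ACPE n) (b : Dep n) : adjPair x (D 0 (jetC (.p 1) 0)) b
    = -(2 * ∑ lam, ∑ μ, adjPair (uC μ (e lam) * x) (uC lam (e μ)) b)
      - ∑ α : Fin n, Finsupp.single (.p 0) (DTheta α (DTheta α x)) b := by
  have h1 : ∀ α, adjPair x (DTheta α (DTheta α (jetC (.p 0) 0)))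
      = Finsupp.single (.p 0) (DTheta α (DTheta α x)) := fun α => by
    rw [adjPair_DTheta, adjPair_DTheta_jetC, Finsupp.single_neg, neg_neg]
  have h2 : ∑ lam : Fin (n + 1), ∑ μ : Fin (n + 1), adjPair (uC lam (e μ) * x) (uC μ (e lam)) b
      = ∑ lam : Fin (n + 1), ∑ μ : Fin (n + 1), adjPair (uC μ (e lam) * x) (uC lam (e μ)) b :=
    Finset.sum_comm
  rw [D_zero_p_one]
  simp only [map_sub, map_neg, map_sum, h1, adjPair_mul, mul_comm x, Finsupp.sub_apply,
    Finsupp.neg_apply, Finsupp.finsetSum_apply, Finsupp.add_apply, Finset.sum_add_distrib, h2]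
  ring

/-- By linearity a single nonzero component of `χ` suffices. The right-hand sides for $u^1_0$,
$u^\alpha_k$ and $p_0$ are linear with constant coefficients; all quadratic terms of $f^*$ come from
that of $p_1$. -/
theorem adjLin_D_zero (χ : Dep n →₀ ACPE n) (b : Dep n) :
    adjLin (fun a => D 0 (jetC a 0)) χ b = fStar χ b := by
  classical
  induction χ using Finsupp.induction_linear with
  | zero =>
    have := fStar_smul (0 : ℝ) (0 : Dep n → ACPE n) b
    simp only [zero_smul] at this
    simp [this]
  | add f g hf hg => rw [map_add, Finsupp.add_apply, hf, hg, Finsupp.coe_add, fStar_add]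
  | single a x =>
    rw [adjLin_single]
    rcases a with _ | ⟨α, k⟩ | k
    · rw [D_zero_u1, map_neg, map_sum]
      simp only [adjPair_DTheta_jetC, Finsupp.neg_apply, Finsupp.finsetSum_apply]
      rcases b with _ | ⟨β, _ | _ | l⟩ | l
      · simp [fStar]
      · simp [fStar, Finsupp.single_apply]
      · simp [fStar]
      · simp [fStar]
      · fin_cases l <;> simp [fStar]
    · rw [D_zero_u, adjPair_jetC]
      rcases b with _ | ⟨β, _ | _ | l⟩ | l
      · simp [fStar]
      · simp [fStar]
      · simp [fStar, Finsupp.single_apply]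
      · simp [fStar, Finsupp.single_apply]
      · fin_cases l <;> simp [fStar]
    · fin_cases k
      · change adjPair x (D 0 (jetC (.p 0) 0)) b = _
        rw [D_zero_p_zero, adjPair_jetC]
        rcases b with _ | ⟨β, _ | _ | l⟩ | l
        · simp [fStar]
        · simp [fStar]
        · simp [fStar]
        · simp [fStar]
        · fin_cases l <;> simp [fStar]
      · change adjPair x (D 0 (jetC (.p 1) 0)) b = _
        rw [adjPair_D_zero_p_one]
        simp only [Fin.sum_univ_succ, uC_zero_e_zero, uC_zero_e_succ, uC_succ_e_zero,
          uC_succ_e_succ, map_neg, map_sum, adjPair_DTheta_jetC, adjPair_jetC]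
        rcases b with _ | ⟨β, _ | _ | l⟩ | l
        · simp [fStar, uC_succ_e_zero]
        · simp [fStar, uC_succ_e_succ, Finsupp.single_apply]
          ring
        · simp [fStar, uC_zero_e_succ, Finsupp.single_apply]
        · simp [fStar]
        · fin_cases l <;> simp [fStar]

end Adjoint

/-! ## The cohomology of the auxiliary complex -/

section Theta

variable {n : ℕ}

/-- The operator `1 + ∑ a_j ∂_{a_j}` as an equivalence. -/
def oneAddEuler (n : ℕ) : ACPE n ≃ₗ[ℝ] ACPE n :=
  LinearEquiv.ofBijective (LinearMap.id + eulerOp)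
    ⟨(injective_iff_map_eq_zero _).2 fun _ h => eq_zero_of_add_eulerOp h,
      fun f => exists_add_eulerOp_eq f⟩

theorem oneAddEuler_symm (f : ACPE n) :
    (oneAddEuler n).symm f + eulerOp ((oneAddEuler n).symm f) = f :=
  (oneAddEuler n).apply_symm_apply f

theorem eulerOp_DTheta (α : Fin n) (f : ACPE n) :
    eulerOp (DTheta α f) = DTheta α (eulerOp f) := by
  rw [← evol_jetC, evol_DTheta]

/-- $E$ commutes with $D_j$, and $E(a_0y)=a_0(y+Ey)$; with $y=(1+E)^{-1}x$ this is $a_0x$. So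
dividing by $1+E$ on the coefficients undoes $E$ on the assembled function. -/
theorem eulerOp_assemble (c : VForm n) :
    eulerOp (assemble (fun a => jetC a 0) (coeffV (oneAddEuler n).symm.toLinearMap c))
      = assemble (fun a => jetC a 0) c := by
  induction c using VForm.induction with
  | zero => simp
  | add c c' hc hc' => simp only [map_add, hc, hc']
  | single j a x =>
    have h := oneAddEuler_symm x
    rw [coeffV_single, assemble_single, assemble_single, DIter_comm eulerOp_DTheta, eulerOp_mul,
      eulerOp_jetC, LinearEquiv.coe_coe]
    congr 1
    linear_combination jetC a 0 * h

theorem dForm_symbol_dV (θ : Form (Fin n) (ACPE n)) :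
    dForm shiftIdx (fun s => symbol (dV (θ s))) = fun s => symbol (dV (dForm DTheta θ s)) :=
  dForm_map (T := fun f => symbol (dV f)) (symbol ∘ₗ dV).isLinear
    (fun α f => by rw [dV_DTheta, symbol_DV]) θ

theorem dForm_assemble (g : Dep n → ACPE n) (η : Form (Fin n) (VForm n)) :
    dForm DTheta (fun s => assemble g (η s)) = fun s => assemble g (dForm shiftIdx η s) :=
  dForm_map (D := shiftIdx) (D' := DTheta) (T := fun c => assemble g c) (assemble g).isLinear
    (fun α c => (assemble_shiftIdx g α c).symm) η

theorem dForm_eulerOp (θ : Form (Fin n) (ACPE n)) :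
    dForm DTheta (fun s => eulerOp (θ s)) = fun s => eulerOp (dForm DTheta θ s) :=
  dForm_map eulerOp.isLinear (fun α f => (eulerOp_DTheta α f).symm) θ

/-- A closed form without variational derivatives is cohomologous to a form whose coefficients
depend on the independent variables only. -/
theorem theta_reduce {q : ℤ} {θ : Form (Fin n) (ACPE n)} (hq : θ ∈ formsOfDegree q)
    (hd : dForm DTheta θ = 0) (hv : varD (θ Finset.univ) = 0) :
    ∃ ζ : Form (Fin n) (ACPE n), ζ ∈ formsOfDegree (q - 1) ∧
      ∀ s, θ s - dForm DTheta ζ s ∈ xFunctions n := by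
  have h1 : (fun s => symbol (dV (θ s))) ∈ formsOfDegree q :=
    formsOfDegree_map hq (T := fun f => symbol (dV f)) (by rw [map_zero, map_zero])
  have h2 : dForm shiftIdx (fun s => symbol (dV (θ s))) = 0 := by
    rw [dForm_symbol_dV, hd]
    funext s
    rw [Pi.zero_apply, map_zero, map_zero]; rfl
  -- The vanishing top coefficient required by the Koszul lemma is exactly `hv`.
  obtain ⟨η, hη, hdη⟩ : ∃ η : Form (Fin n) (VForm n), η ∈ formsOfDegree (q - 1) ∧
      dForm shiftIdx η = fun s => symbol (dV (θ s)) := koszul_exact h1 h2 hv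
  refine ⟨fun s => assemble (fun a => jetC a 0) (coeffV (oneAddEuler n).symm.toLinearMap (η s)),
    formsOfDegree_map hη (T := fun c => assemble (fun a => jetC a 0)
      (coeffV (oneAddEuler n).symm.toLinearMap c)) (by rw [map_zero, map_zero]),
    fun s => dV_eq_zero_of_eulerOp ?_⟩
  have h3 := congrFun (dForm_eulerOp
    (fun s => assemble (fun a => jetC a 0) (coeffV (oneAddEuler n).symm.toLinearMap (η s)))) s
  simp only [eulerOp_assemble] at h3
  rw [map_sub, ← h3, dForm_assemble, hdη, ← evol_jetC, evol_eq_assemble, sub_self]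

/-- What remains after `theta_reduce` has coefficients depending on $x$ only; the Poincaré lemma in
$x^2,\dots,x^m$ applies with $x^1$ as a parameter. -/
theorem theta_exact {q : ℤ} (h1 : 1 ≤ q) {θ : Form (Fin n) (ACPE n)} (hq : θ ∈ formsOfDegree q)
    (hd : dForm DTheta θ = 0) (hv : varD (θ Finset.univ) = 0) :
    ∃ ζ ∈ formsOfDegree (q - 1), dForm DTheta ζ = θ := by
  obtain ⟨ζ, hζ, hx⟩ := theta_reduce hq hd hv
  obtain ⟨ξ, hξ, -, hdξ⟩ := poincare_exact (D := DTheta) (fun _ _ f => D_comm _ _ f) (xFunctions n)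
    (fun α f (hf : dV f = 0) => by
      change dV (DTheta α f) = 0
      rw [dV_DTheta, hf, map_zero])
    (fun α f hf h => by
      obtain ⟨g, hg, hgf, hg'⟩ := exists_D_eq α.succ hf
      exact ⟨g, hg, hgf, fun β hβ => hg' _ (fun h => hβ.ne (Fin.succ_injective _ h)) (h β hβ)⟩)
    h1 (Submodule.sub_mem _ hq (dForm_mem_formsOfDegree DTheta hζ))
    (by rw [map_sub, hd, dForm_dForm fun _ _ f => D_comm _ _ f, sub_zero]) hx
  exact ⟨ζ + ξ, Submodule.add_mem _ hζ hξ, by rw [map_add, hdξ, add_sub_cancel]⟩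

/-- Below the top degree this makes the variational obstruction vacuous. -/
theorem apply_univ_eq_zero {A : Type*} [AddCommGroup A] [Module ℝ A] {q : ℤ} (hqn : q < n)
    {θ : Form (Fin n) A} (hq : θ ∈ formsOfDegree q) : θ Finset.univ = 0 :=
  hq _ (by rw [Finset.card_univ, Fintype.card_fin]; exact hqn.ne')

theorem dForm_singleton {ι A : Type*} [LinearOrder ι] [AddCommGroup A] [Module ℝ A]
    (D : ι → A →ₗ[ℝ] A) (ω : Form ι A) (μ : ι) : dForm D ω {μ} = D μ (ω ∅) := by
  rw [dForm_apply, Finset.sum_singleton, Finset.filter_singleton]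
  simp

/-- The form of degree zero with coefficient `f`. -/
def zeroForm {ι A : Type*} [Zero A] (f : A) : Form ι A := fun s => if s.card = 0 then f else 0

theorem zeroForm_mem {ι A : Type*} [AddCommGroup A] [Module ℝ A] (f : A) :
    (zeroForm f : Form ι A) ∈ formsOfDegree 0 := fun s hs => by
  rw [zeroForm, if_neg (by exact_mod_cast hs)]

theorem eq_zeroForm {ι A : Type*} [AddCommGroup A] [Module ℝ A] {ω : Form ι A}
    (h : ω ∈ formsOfDegree 0) : ω = zeroForm (ω ∅) := by
  funext s
  rw [zeroForm]
  split_ifs with hs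
  · rw [Finset.card_eq_zero.1 hs]
  · exact h s (by exact_mod_cast hs)

theorem dForm_zeroForm {ι A : Type*} [LinearOrder ι] [AddCommGroup A] [Module ℝ A]
    {D : ι → A →ₗ[ℝ] A} {f : A} (h : ∀ μ, D μ f = 0) : dForm D (zeroForm f) = 0 := by
  funext s
  refine Finset.sum_eq_zero fun μ _ => ?_
  unfold zeroForm
  split_ifs <;> simp [h]

/-- There are no forms of degree $-1$, so the correction in `theta_reduce` is zero. A closed
function thus depends on $x^1$ alone. -/
theorem theta_zero (hn : 1 ≤ n) {θ : Form (Fin n) (ACPE n)} (hq : θ ∈ formsOfDegree 0)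
    (hd : dForm DTheta θ = 0) : θ ∅ ∈ xFunctions n ∧ ∀ α, DTheta α (θ ∅) = 0 := by
  obtain ⟨ζ, hζ, hx⟩ := theta_reduce hq hd
    (by rw [apply_univ_eq_zero (by omega) hq, map_zero])
  refine ⟨?_, fun α => by rw [← dForm_singleton (D := DTheta), hd]; rfl⟩
  have := hx ∅
  rwa [eq_zero_of_mem_formsOfDegree hζ (by norm_num), map_zero, Pi.zero_apply, sub_zero] at this

/-- `D_1` is onto on the cohomology of the auxiliary complex below the top degree. -/
theorem exists_D_zero_add_dForm {q : ℤ} (hqn : q < n) {θ : Form (Fin n) (ACPE n)}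
    (hq : θ ∈ formsOfDegree q) (hd : dForm DTheta θ = 0) :
    ∃ η ∈ formsOfDegree q, ∃ ζ ∈ formsOfDegree (q - 1), dForm DTheta η = 0 ∧
      θ = (fun s => D 0 (η s)) + dForm DTheta ζ := by
  rcases lt_trichotomy q 0 with h0 | rfl | h0
  · exact ⟨0, Submodule.zero_mem _, 0, Submodule.zero_mem _, map_zero _, by
      rw [eq_zero_of_mem_formsOfDegree hq h0]
      funext s
      simp⟩
  -- Degree 0: a primitive in $x^1$ that stays constant in the other directions is again closed.
  · obtain ⟨h1, h2⟩ := theta_zero (by omega) hq hd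
    obtain ⟨g, -, hg, hg'⟩ := exists_D_eq 0 h1
    refine ⟨zeroForm g, zeroForm_mem g, 0, Submodule.zero_mem _,
      dForm_zeroForm fun α => hg' _ (Fin.succ_ne_zero α) (h2 α), ?_⟩
    rw [map_zero, add_zero]
    funext s
    rw [eq_zeroForm hq]
    unfold zeroForm
    split_ifs
    · simp [hg]
    · simp
  · obtain ⟨ζ, hζ, h⟩ := theta_exact (by omega) hq hd
      (by rw [apply_univ_eq_zero hqn hq, map_zero])
    refine ⟨0, Submodule.zero_mem _, ζ, hζ, map_zero _, ?_⟩
    rw [h]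
    funext s
    simp

end Theta

section Horizontal

variable {n : ℕ}

/-! ## The horizontal cohomology -/

theorem cls_eq_zero {ι A : Type*} [LinearOrder ι] [AddCommGroup A] [Module ℝ A]
    {D : ι → A →ₗ[ℝ] A} {q : ℤ} {ω : cocycles D q} : cls ω = 0 ↔ ω.1 ∈ coboundaries D q := by
  rw [cls, Submodule.Quotient.mk_eq_zero]; rfl

theorem cls_surjective {ι A : Type*} [LinearOrder ι] [AddCommGroup A] [Module ℝ A]
    {D : ι → A →ₗ[ℝ] A} {q : ℤ} : Function.Surjective (cls (D := D) (q := q)) :=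
  Submodule.Quotient.mk_surjective _

theorem subsingleton_cohomology {ι A : Type*} [LinearOrder ι] [AddCommGroup A] [Module ℝ A]
    {D : ι → A →ₗ[ℝ] A} {q : ℤ} (h : ∀ ω ∈ cocycles D q, ω ∈ coboundaries D q) :
    Subsingleton (Cohomology D q) :=
  subsingleton_of_forall_eq 0 fun x => by
    obtain ⟨ω, rfl⟩ := cls_surjective x
    exact cls_eq_zero.2 (h _ ω.2)

theorem D_family_eq_DTheta : (fun α : Fin n => D (n := n) α.succ) = DTheta := rfl

theorem tailPart_mem_cocycles {q : ℤ} {ω : Form (Fin (n + 1)) (ACPE n)}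
    (h : ω ∈ cocycles D q) : tailPart ω ∈ cocycles DTheta q :=
  ⟨(closed_iff_parts.1 h.1).1, (mem_formsOfDegree_iff_parts.1 h.2).1⟩

/-- A closed form of degree at most `m - 1` is exact if the part free of `dx^1` is. -/
theorem mem_coboundaries_of_tailPart {q : ℤ} (hqn : q ≤ n) {ω : Form (Fin (n + 1)) (ACPE n)}
    (hω : ω ∈ cocycles D q) (h : tailPart ω ∈ coboundaries DTheta q) : ω ∈ coboundaries D q := by
  obtain ⟨hq1, hq2⟩ := mem_formsOfDegree_iff_parts.1 hω.2
  obtain ⟨h1, h2⟩ := closed_iff_parts.1 hω.1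
  obtain ⟨ξ, hξ, hdξ⟩ := h
  have h3 := dForm_map (D := DTheta) (D' := DTheta) (D 0).isLinear (fun α f => D_comm α.succ 0 f) ξ
  rw [hdξ] at h3
  -- With $\omega'=d\xi$, the form $\omega''-D_1\xi$ is closed of degree below the top. Writing it
  -- as $D_1\eta+d\zeta$ with $\eta$ closed makes $\xi+\eta-dx^1\wedge\zeta$ a primitive of
  -- $\omega$.
  obtain ⟨η, hη, ζ, hζ, hdη, hτ⟩ := exists_D_zero_add_dForm (q := q - 1) (by omega)
    (θ := headPart ω - fun s => D 0 (ξ s))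
    (Submodule.sub_mem _ hq2 (formsOfDegree_map hξ (map_zero _)))
    (by rw [map_sub, h3, ← D_family_eq_DTheta, ← h2, sub_self])
  refine ⟨consForm (ξ + η) (-ζ), consForm_mem_formsOfDegree (Submodule.add_mem _ hξ hη)
    (Submodule.neg_mem _ hζ), ?_⟩
  rw [dForm_consForm]
  refine form_ext ?_ ?_
  · rw [tailPart_consForm, D_family_eq_DTheta, map_add, hdξ, hdη, add_zero]
  · rw [headPart_consForm, map_neg, sub_neg_eq_add, eq_add_of_sub_eq hτ]
    funext s
    simp only [Pi.add_apply, map_add]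
    abel

theorem D_algebraMap (μ : Fin (n + 1)) (c : ℝ) : D μ (algebraMap ℝ (ACPE n) c) = 0 := by
  rw [← (restr n).commutes, D_restr, Derivation.map_algebraMap, map_zero]

theorem algebraMap_ACPE_injective : Function.Injective (algebraMap ℝ (ACPE n)) := by
  intro c d h
  rw [← (chart n).commutes, ← (chart n).commutes] at h
  exact congrArg (fun f : FinSmooth (KCoord n) => f.1 0) ((chart n).injective h)

theorem zeroForm_mem_cocycles (c : ℝ) :
    (zeroForm (algebraMap ℝ (ACPE n) c) : Form (Fin (n + 1)) (ACPE n)) ∈ cocycles D 0 :=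
  ⟨dForm_zeroForm fun μ => D_algebraMap μ c, zeroForm_mem _⟩

theorem subsingleton_H {q : ℤ}
    (hq : q < 0 ∨ (1 ≤ q ∧ q ≤ ((n : ℤ) + 1) - 2) ∨ (n : ℤ) + 1 < q) : Subsingleton (H n q) := by
  refine subsingleton_cohomology fun ω hω => ?_
  rcases hq with h | ⟨h, h'⟩ | h
  · rw [eq_zero_of_mem_formsOfDegree hω.2 h]
    exact Submodule.zero_mem _
  · obtain ⟨hd, hdeg⟩ := tailPart_mem_cocycles hω
    exact mem_coboundaries_of_tailPart (by omega) hω (theta_exact h hdeg hd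
      (by rw [apply_univ_eq_zero (by omega) hdeg, map_zero]))
  · have : ω = 0 := funext fun s => hω.2 s (by
      have := s.card_le_univ
      rw [Fintype.card_fin] at this
      omega)
    rw [this]
    exact Submodule.zero_mem _

/-- There are no nonzero exact forms of degree 0, and a closed function is free of jets by
`theta_zero`, hence constant. The map is built from $\mathbb R$ and then inverted. -/
theorem exists_H_zero_equiv (hn : 1 ≤ n) : ∃ φ : H n 0 ≃ₗ[ℝ] ℝ,
    ∀ (ω : cocycles (D (n := n)) 0) (c : ℝ),
      ω.1 ∅ = algebraMap ℝ (ACPE n) c → φ (cls ω) = c := by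
  let Φ : ℝ →ₗ[ℝ] H n 0 :=
    { toFun := fun c => cls ⟨_, zeroForm_mem_cocycles c⟩
      map_add' := fun c d => by
        refine congrArg cls (Subtype.ext (funext fun s => ?_))
        change zeroForm (algebraMap ℝ (ACPE n) (c + d)) s
          = zeroForm (algebraMap ℝ (ACPE n) c) s + zeroForm (algebraMap ℝ (ACPE n) d) s
        unfold zeroForm
        split_ifs <;> simp
      map_smul' := fun c d => by
        refine congrArg cls (Subtype.ext (funext fun s => ?_))
        change zeroForm (algebraMap ℝ (ACPE n) (c • d)) s
          = c • zeroForm (algebraMap ℝ (ACPE n) d) s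
        unfold zeroForm
        split_ifs <;> simp [Algebra.algebraMap_eq_smul_one, mul_smul] }
  have hΦω : ∀ (ω : cocycles (D (n := n)) 0) (c : ℝ), ω.1 ∅ = algebraMap ℝ (ACPE n) c →
      Φ c = cls ω := fun ω c h => by
    refine congrArg cls (Subtype.ext ?_)
    rw [eq_zeroForm ω.2.2, h]
  have hbij : Function.Bijective Φ := by
    constructor
    · refine (injective_iff_map_eq_zero _).2 fun c hc => ?_
      obtain ⟨η, hη, h⟩ := cls_eq_zero.1 hc
      rw [eq_zero_of_mem_formsOfDegree hη (by norm_num), map_zero] at h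
      have h' := congrFun h ∅
      change 0 = zeroForm (ι := Fin (n + 1)) (algebraMap ℝ (ACPE n) c) ∅ at h'
      rw [zeroForm, if_pos Finset.card_empty] at h'
      exact algebraMap_ACPE_injective (h'.symm.trans (map_zero _).symm)
    · intro x
      obtain ⟨ω, rfl⟩ := cls_surjective x
      obtain ⟨hd, hdeg⟩ := tailPart_mem_cocycles ω.2
      have hx := (theta_zero hn hdeg hd).1
      obtain ⟨c, hc⟩ := eq_algebraMap_of_D_eq_zero (f := ω.1 ∅) (by simpa [tailPart] using hx)
        (fun μ => by rw [← dForm_singleton, LinearMap.mem_ker.1 ω.2.1]; rfl)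
      exact ⟨c, hΦω ω c hc⟩
  refine ⟨(LinearEquiv.ofBijective Φ hbij).symm, fun ω c h => ?_⟩
  rw [LinearEquiv.symm_apply_eq]
  exact (hΦω ω c h).symm

/-! ### Degree `m - 1` -/

/-- Restriction of a closed form to the part free of `dx^1`. -/
def tailCocycle (n : ℕ) (q : ℤ) : cocycles (D (n := n)) q →ₗ[ℝ] cocycles (DTheta (n := n)) q where
  toFun ω := ⟨tailPart ω.1, tailPart_mem_cocycles ω.2⟩
  map_add' _ _ := rfl
  map_smul' _ _ := rfl

/-- The map `[ω] ↦ [ω']` in cohomology, where `ω'` is the part of `ω` free of `dx^1`. -/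
def tailClass (n : ℕ) (q : ℤ) : H n q →ₗ[ℝ] HTheta n q :=
  Submodule.mapQ _ _ (tailCocycle n q) (by
    rintro ⟨_, hω⟩ ⟨η, hη, rfl⟩
    exact ⟨tailPart η, (mem_formsOfDegree_iff_parts.1 hη).1, (tailPart_dForm _ _).symm⟩)

theorem tailClass_cls {q : ℤ} (ω : cocycles (D (n := n)) q) :
    tailClass n q (cls ω) = cls (tailCocycle n q ω) := rfl

theorem D1_cls {q : ℤ} (θ : cocycles (DTheta (n := n)) q) :
    D1 n q (cls θ) = cls ⟨fun s => D 0 (θ.1 s),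
      coeffwise_mem_cocycles (fun α a => D_comm α.succ 0 a) θ.2⟩ := rfl

theorem tailClass_mem_ker {q : ℤ} (x : H n q) : tailClass n q x ∈ LinearMap.ker (D1 n q) := by
  obtain ⟨ω, rfl⟩ := cls_surjective x
  rw [LinearMap.mem_ker, tailClass_cls, D1_cls, cls_eq_zero]
  exact ⟨headPart ω.1, (mem_formsOfDegree_iff_parts.1 ω.2.2).2, (closed_iff_parts.1 ω.2.1).2.symm⟩

/-- The isomorphism `H^{m-1} ≅ ker D_1^{m-1}`. -/
def HEquivKer (n : ℕ) : H n n ≃ₗ[ℝ] LinearMap.ker (D1 n n) :=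
  LinearEquiv.ofBijective ((tailClass n n).codRestrict _ tailClass_mem_ker) (by
    constructor
    · refine (injective_iff_map_eq_zero _).2 fun x hx => ?_
      obtain ⟨ω, rfl⟩ := cls_surjective x
      have h : tailClass n n (cls ω) = 0 := congrArg Subtype.val hx
      exact cls_eq_zero.2 (mem_coboundaries_of_tailPart le_rfl ω.2 (cls_eq_zero.1 h))
    · rintro ⟨y, hy⟩
      obtain ⟨θ, rfl⟩ := cls_surjective y
      rw [LinearMap.mem_ker, D1_cls, cls_eq_zero] at hy
      obtain ⟨ζ, hζ, hdζ⟩ := hy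
      -- Any primitive of $D_1\theta$ completes $\theta$ to a closed form.
      refine ⟨cls ⟨consForm θ.1 ζ, ?_, consForm_mem_formsOfDegree θ.2.2 hζ⟩, Subtype.ext ?_⟩
      · refine closed_iff_parts.2 ⟨?_, ?_⟩
        · rw [tailPart_consForm]; exact θ.2.1
        · rw [tailPart_consForm, headPart_consForm]; exact hdζ.symm
      · exact congrArg cls (Subtype.ext (tailPart_consForm _ _)))

theorem HEquivKer_cls (ω : cocycles (D (n := n)) n) :
    (HEquivKer n (cls ω)).1 = cls (tailCocycle n n ω) := rfl

/-- The variational derivatives of a class of top degree. -/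
def varClass (n : ℕ) : HTheta n n →ₗ[ℝ] Dep n →₀ ACPE n :=
  Submodule.liftQ _ (varD ∘ₗ LinearMap.proj Finset.univ ∘ₗ (cocycles (DTheta (n := n)) n).subtype)
    (by
      rintro ⟨_, hω⟩ ⟨η, hη, rfl⟩
      change varD (dForm DTheta η Finset.univ) = 0
      rw [dForm_apply, map_sum]
      exact Finset.sum_eq_zero fun α _ => by rw [map_smul, varD_DTheta, smul_zero])

theorem varClass_cls (θ : cocycles (DTheta (n := n)) n) :
    varClass n (cls θ) = varD (θ.1 Finset.univ) := rfl

/-- Together with injectivity of `varClass`, this identifies $\ker D_1$ with the classes whose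
variational derivatives solve $(D_1+f^*)\chi=0$. -/
theorem varClass_D1 (x : HTheta n n) (a : Dep n) :
    varClass n (D1 n n x) a = D 0 (varClass n x a) + fStar (varClass n x) a := by
  obtain ⟨θ, rfl⟩ := cls_surjective x
  rw [D1_cls, varClass_cls, varClass_cls, varD_D_zero, adjLin_D_zero]

theorem varClass_injective (hn : 1 ≤ n) : Function.Injective (varClass n) :=
  (injective_iff_map_eq_zero _).2 fun x hx => by
    obtain ⟨θ, rfl⟩ := cls_surjective x
    exact cls_eq_zero.2 (theta_exact (by omega) θ.2.2 θ.2.1 hx)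

theorem mem_ker_D1_iff (hn : 1 ≤ n) (x : HTheta n n) :
    x ∈ LinearMap.ker (D1 n n) ↔ varClass n x ∈ Sol n := by
  rw [LinearMap.mem_ker, ← map_eq_zero_iff _ (varClass_injective hn), Finsupp.ext_iff]
  simp only [varClass_D1]
  rfl

theorem varClass_mem_Helmholtz (x : HTheta n n) : varClass n x ∈ Helmholtz n := by
  obtain ⟨θ, rfl⟩ := cls_surjective x
  exact varD_mem_Helmholtz _

/-- The form of top degree with coefficient `f`. -/
def topForm {A : Type*} [Zero A] (f : A) : Form (Fin n) A :=
  fun s => if s.card = n then f else 0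

theorem topForm_mem_cocycles (f : ACPE n) : topForm f ∈ cocycles (DTheta (n := n)) n := by
  constructor
  · funext s
    refine Finset.sum_eq_zero fun α hα => ?_
    rw [topForm, if_neg, map_zero, smul_zero]
    intro h
    have h1 := Finset.card_erase_lt_of_mem hα
    have h2 := s.card_le_univ
    rw [Fintype.card_fin] at h2
    omega
  · intro s hs
    rw [topForm, if_neg (by exact_mod_cast hs)]

theorem exists_varClass_eq {χ : Dep n →₀ ACPE n} (h : χ ∈ Helmholtz n) :
    ∃ x, varClass n x = χ := by
  obtain ⟨f, hf⟩ := exists_varD_eq h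
  exact ⟨cls ⟨_, topForm_mem_cocycles f⟩, by
    rw [varClass_cls]
    change varD (topForm f Finset.univ) = χ
    rw [topForm, if_pos (by simp), hf]⟩

/-- The isomorphism of `ker D_1^{m-1}` and the space of solutions with self-adjoint
linearization. -/
def kerEquivSol (hn : 1 ≤ n) :
    LinearMap.ker (D1 n n) ≃ₗ[ℝ] (Sol n ⊓ Helmholtz n : Submodule ℝ (Dep n →₀ ACPE n)) :=
  LinearEquiv.ofBijective (((varClass n).domRestrict (LinearMap.ker (D1 n n))).codRestrict
    (Sol n ⊓ Helmholtz n) fun x => ⟨(mem_ker_D1_iff hn x.1).1 x.2, varClass_mem_Helmholtz x.1⟩) (by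
    constructor
    · intro x y h
      exact Subtype.ext (varClass_injective hn (congrArg Subtype.val h))
    · rintro ⟨χ, hS, hH⟩
      obtain ⟨x, rfl⟩ := exists_varClass_eq hH
      exact ⟨⟨x, (mem_ker_D1_iff hn x).2 hS⟩, rfl⟩)

theorem kerEquivSol_apply (hn : 1 ≤ n) (θ : cocycles (DTheta (n := n)) n)
    (h : cls θ ∈ LinearMap.ker (D1 n n)) (a : Dep n) :
    (kerEquivSol hn ⟨cls θ, h⟩).1 a = varDeriv (θ.1 Finset.univ) a :=
  varD_apply _ _

/-! ### Degree `m` -/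

theorem consForm_zero_mem_cocycles {θ : Form (Fin n) (ACPE n)} (h : θ ∈ cocycles DTheta n) :
    consForm 0 θ ∈ cocycles (D (n := n)) (n + 1) := by
  constructor
  · refine closed_iff_parts.2 ⟨by rw [tailPart_consForm, map_zero], ?_⟩
    rw [tailPart_consForm, headPart_consForm]
    refine Eq.trans ?_ (Eq.symm h.1)
    funext s
    exact map_zero _
  · exact consForm_mem_formsOfDegree (Submodule.zero_mem _) (by simpa using h.2)

theorem tailPart_add {A : Type*} [AddCommGroup A] (a b : Form (Fin (n + 1)) A) :
    tailPart (a + b) = tailPart a + tailPart b := rfl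

theorem headPart_add {A : Type*} [AddCommGroup A] (a b : Form (Fin (n + 1)) A) :
    headPart (a + b) = headPart a + headPart b := rfl

theorem tailPart_smul {A : Type*} [AddCommGroup A] [Module ℝ A] (c : ℝ)
    (a : Form (Fin (n + 1)) A) : tailPart (c • a) = c • tailPart a := rfl

theorem headPart_smul {A : Type*} [AddCommGroup A] [Module ℝ A] (c : ℝ)
    (a : Form (Fin (n + 1)) A) : headPart (c • a) = c • headPart a := rfl

theorem consForm_add {A : Type*} [AddCommGroup A] (a b a' b' : Form (Fin n) A) :
    consForm (a + a') (b + b') = consForm a b + consForm a' b' :=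
  form_ext (by rw [tailPart_consForm, tailPart_add, tailPart_consForm, tailPart_consForm])
    (by rw [headPart_consForm, headPart_add, headPart_consForm, headPart_consForm])

theorem consForm_smul {A : Type*} [AddCommGroup A] [Module ℝ A] (c : ℝ) (a b : Form (Fin n) A) :
    consForm (c • a) (c • b) = c • consForm a b :=
  form_ext (by rw [tailPart_consForm, tailPart_smul, tailPart_consForm])
    (by rw [headPart_consForm, headPart_smul, headPart_consForm])

/-- The map `θ ↦ [(-1)^{m-1} dx^1 ∧ θ]`. -/
def wedgeClass (n : ℕ) : cocycles (DTheta (n := n)) n →ₗ[ℝ] H n (n + 1) where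
  toFun θ := (-1 : ℝ) ^ n • cls ⟨consForm 0 θ.1, consForm_zero_mem_cocycles θ.2⟩
  map_add' θ θ' := by
    rw [← smul_add]
    refine congrArg _ (congrArg cls (Subtype.ext ?_))
    change consForm 0 (θ.1 + θ'.1) = consForm 0 θ.1 + consForm 0 θ'.1
    rw [← consForm_add, add_zero]
  map_smul' c θ := by
    rw [RingHom.id_apply, smul_comm c]
    refine congrArg _ (congrArg cls (Subtype.ext ?_))
    change consForm 0 (c • θ.1) = c • consForm 0 θ.1
    rw [← consForm_smul, smul_zero]

theorem wedgeClass_eq_zero {θ : cocycles (DTheta (n := n)) n} :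
    wedgeClass n θ = 0 ↔ consForm 0 θ.1 ∈ coboundaries (D (n := n)) (n + 1) := by
  rw [← cls_eq_zero (ω := ⟨consForm 0 θ.1, consForm_zero_mem_cocycles θ.2⟩)]
  exact smul_eq_zero_iff_right (pow_ne_zero _ (by norm_num))

/-- A differential $d_H(\xi+dx^1\wedge\zeta)$ lacks a part free of $dx^1$ iff $\xi$ is closed, and
then its head is $D_1\xi$ up to an exact form. -/
theorem consForm_zero_mem_coboundaries_iff {θ : cocycles (DTheta (n := n)) n} :
    consForm 0 θ.1 ∈ coboundaries (D (n := n)) (n + 1) ↔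
      cls θ ∈ LinearMap.range (D1 n n) := by
  constructor
  · rintro ⟨η, hη, h⟩
    obtain ⟨hq1, hq2⟩ := mem_formsOfDegree_iff_parts.1 hη
    rw [add_sub_cancel_right] at hq1 hq2
    have h1 : dForm DTheta (tailPart η) = 0 := by
      rw [← D_family_eq_DTheta, ← tailPart_dForm, h, tailPart_consForm]
    have h2 := headPart_dForm D η
    rw [h, headPart_consForm] at h2
    refine ⟨cls ⟨tailPart η, h1, hq1⟩, ?_⟩
    rw [D1_cls, ← sub_eq_zero]
    refine cls_eq_zero (ω := _ - _) |>.2 ⟨headPart η, hq2, ?_⟩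
    change _ = (fun s => D 0 (tailPart η s)) - θ.1
    rw [h2, sub_sub_cancel]
  · rintro ⟨y, hy⟩
    obtain ⟨η, rfl⟩ := cls_surjective y
    rw [D1_cls, ← sub_eq_zero] at hy
    obtain ⟨ζ, hζ, hdζ⟩ := cls_eq_zero (ω := _ - _) |>.1 hy
    have hdζ : dForm DTheta ζ = (fun s => D 0 (η.1 s)) - θ.1 := hdζ
    refine ⟨consForm η.1 ζ, ?_, ?_⟩
    · rw [add_sub_cancel_right]
      exact consForm_mem_formsOfDegree η.2.2 hζ
    · have h1 : dForm DTheta η.1 = 0 := η.2.1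
      rw [dForm_consForm, D_family_eq_DTheta, h1, hdζ, sub_sub_cancel]

/-- The isomorphism `H^{m-1}(Θ) / im D_1^{m-1} ≅ H^m`. -/
def cokerEquivH (n : ℕ) : (HTheta n n ⧸ LinearMap.range (D1 n n)) ≃ₗ[ℝ] H n (n + 1) :=
  LinearEquiv.ofBijective
    (Submodule.liftQ _ (Submodule.liftQ _ (wedgeClass n) fun θ hθ => by
        rw [LinearMap.mem_ker, wedgeClass_eq_zero, consForm_zero_mem_coboundaries_iff]
        have : cls θ = 0 := cls_eq_zero.2 hθ
        rw [this]
        exact Submodule.zero_mem _)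
      (fun x hx => by
        obtain ⟨θ, rfl⟩ := cls_surjective x
        exact wedgeClass_eq_zero.2 (consForm_zero_mem_coboundaries_iff.2 hx)))
    (by
      constructor
      · refine (injective_iff_map_eq_zero _).2 fun x hx => ?_
        obtain ⟨x, rfl⟩ := Submodule.Quotient.mk_surjective _ x
        obtain ⟨θ, rfl⟩ := cls_surjective x
        exact (Submodule.Quotient.mk_eq_zero _).2
          (consForm_zero_mem_coboundaries_iff.1 (wedgeClass_eq_zero.1 hx))
      · intro y
        obtain ⟨ω, rfl⟩ := cls_surjective y
        have hq := (mem_formsOfDegree_iff_parts.1 ω.2.2)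
        rw [add_sub_cancel_right] at hq
        have ht : tailPart ω.1 = 0 := funext fun s => hq.1 s (by
          have := s.card_le_univ
          rw [Fintype.card_fin] at this
          omega)
        have hd := (closed_iff_parts.1 ω.2.1).2
        rw [ht] at hd
        have hd' : headPart ω.1 ∈ cocycles DTheta n := ⟨hd.symm.trans (by
          funext s; exact map_zero _), hq.2⟩
        -- The factor $(-1)^n$ meets the one in `wedgeClass`, and the two multiply to $1$.
        refine ⟨Submodule.Quotient.mk (cls ((-1 : ℝ) ^ n • ⟨_, hd'⟩)), ?_⟩
        change wedgeClass n ((-1 : ℝ) ^ n • ⟨_, hd'⟩) = _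
        rw [map_smul]
        change (-1 : ℝ) ^ n • (-1 : ℝ) ^ n • cls _ = _
        rw [smul_smul, ← mul_pow]
        simp only [mul_neg, mul_one, neg_neg, one_pow, one_smul]
        refine congrArg cls (Subtype.ext (form_ext ?_ ?_))
        · rw [tailPart_consForm, ht]
        · rw [headPart_consForm])

theorem cokerEquivH_mk (θ : cocycles (DTheta (n := n)) n) :
    cokerEquivH n (Submodule.Quotient.mk (cls θ)) = wedgeClass n θ := rfl

theorem form_top_ext {ι A : Type*} [Fintype ι] [AddCommGroup A] [Module ℝ A] {q : ℤ}
    (hq : q = Fintype.card ι) {ω η : Form ι A} (hω : ω ∈ formsOfDegree q)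
    (hη : η ∈ formsOfDegree q) (h : ω Finset.univ = η Finset.univ) : ω = η := by
  funext s
  by_cases hs : s = Finset.univ
  · rw [hs, h]
  · have : s.card ≠ Fintype.card ι := fun h => hs ((Finset.card_eq_iff_eq_univ s).1 h)
    rw [hω s (by omega), hη s (by omega)]

theorem wedgeClass_eq_cls {ω : cocycles (D (n := n)) ((n : ℤ) + 1)}
    {θ : cocycles (DTheta (n := n)) n}
    (h : ω.1 Finset.univ = (-1 : ℝ) ^ n • θ.1 Finset.univ) : wedgeClass n θ = cls ω := by
  refine congrArg cls (Subtype.ext ?_ : (-1 : ℝ) ^ n •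
    (⟨consForm 0 θ.1, consForm_zero_mem_cocycles θ.2⟩ : cocycles (D (n := n)) (n + 1)) = ω)
  refine form_top_ext (by simp)
    (Submodule.smul_mem _ _ (consForm_zero_mem_cocycles θ.2).2) ω.2.2 ?_
  have h1 : consForm 0 θ.1 Finset.univ = θ.1 Finset.univ := by
    rw [univ_eq_insert_map_succ]
    exact congrFun (headPart_consForm 0 θ.1) Finset.univ
  rw [h, ← h1]
  rfl

end Horizontal

end NS

theorem mainTheorem2 (n : ℕ) (hn : 1 ≤ n) :
    (∀ q : ℤ, (q < 0 ∨ (1 ≤ q ∧ q ≤ ((n : ℤ) + 1) - 2) ∨ (n : ℤ) + 1 < q) →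
      Subsingleton (NS.H n q)) ∧
    (∃ φ : NS.H n 0 ≃ₗ[ℝ] ℝ,
      ∀ (ω : NS.cocycles (NS.D (n := n)) 0) (c : ℝ),
        ω.1 ∅ = algebraMap ℝ (NS.ACPE n) c → φ (NS.cls ω) = c) ∧
    (∃ (φ : NS.H n (n : ℤ) ≃ₗ[ℝ] LinearMap.ker (NS.D1 n (n : ℤ)))
      (ψ : LinearMap.ker (NS.D1 n (n : ℤ)) ≃ₗ[ℝ] (NS.Sol n ⊓ NS.Helmholtz n : Submodule ℝ _)),
      (∀ (ω : NS.cocycles (NS.D (n := n)) (n : ℤ)) (θ : NS.cocycles (NS.DTheta (n := n)) (n : ℤ)),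
        (∀ s : Finset (Fin n), θ.1 s = ω.1 (s.map (Fin.succEmb n))) →
          (φ (NS.cls ω)).1 = NS.cls θ) ∧
      (∀ (θ : NS.cocycles (NS.DTheta (n := n)) (n : ℤ))
        (h : NS.cls θ ∈ LinearMap.ker (NS.D1 n (n : ℤ))) (a : NS.Dep n),
        (ψ ⟨NS.cls θ, h⟩).1 a = NS.varDeriv (θ.1 Finset.univ) a) ∧
      (∀ (ω : NS.cocycles (NS.D (n := n)) (n : ℤ)) (a : NS.Dep n),
        (ψ (φ (NS.cls ω))).1 a = NS.varDeriv (ω.1 (NS.tailSet n)) a)) ∧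
    (∃ φ : NS.H n ((n : ℤ) + 1) ≃ₗ[ℝ] NS.HTheta n (n : ℤ) ⧸ LinearMap.range (NS.D1 n (n : ℤ)),
      ∀ (ω : NS.cocycles (NS.D (n := n)) ((n : ℤ) + 1))
        (θ : NS.cocycles (NS.DTheta (n := n)) (n : ℤ)),
        ω.1 Finset.univ = (-1 : ℝ) ^ n • θ.1 Finset.univ →
          φ (NS.cls ω) = Submodule.Quotient.mk (NS.cls θ)) := by
  refine ⟨fun q hq => NS.subsingleton_H hq, NS.exists_H_zero_equiv hn,
    ⟨NS.HEquivKer n, NS.kerEquivSol hn, fun ω θ h => ?_, NS.kerEquivSol_apply hn,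
      fun ω a => NS.kerEquivSol_apply hn (NS.tailCocycle n n ω) _ a⟩,
    (NS.cokerEquivH n).symm, fun ω θ h => ?_⟩
  · rw [NS.HEquivKer_cls]
    exact congrArg NS.cls (Subtype.ext (funext fun s => (h s).symm))
  · rw [LinearEquiv.symm_apply_eq, NS.cokerEquivH_mk, NS.wedgeClass_eq_cls h]
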